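/- **Theorem (Density of smooth functions for vector-valued maps).** Let $n,d\ge 1$ and let $\Omega\subset\mathbb{R}^n$ be a bounded Lipschitz domain. *Definitions.* For a finite-dimensional Euclidean space $V$, a function $M:\Omega\times V\to[0,\infty)$ is a *weak $N$-function* if it is measurable in $x$ and continuous in $\xi$ (Carathéodory); for a.e. $x\in\Omega$ one has $M(x,0)=0$, $M(x,\cdot)$ is convex and $M(x,\xi)=M(x,-\xi)$ for all $\xi$; and there are convex $m_1,m_2:[0,\infty)\to[0,\infty)$ with $m_1(0)=0$, $m_1(s)>0$ for $s>0$, such that $m_1(|\xi|)\le M(x,\xi)\le m_2(|\xi|)$ for a.e. $x\in\Omega$ and all $\xi\in V$. For a ball $B$ in $\mathbb{R}^n$ meeting $\Omega$ put $M_B^-(\xi)=\operatorname{ess\,inf}_{y\in B\cap\Omega}M(y,\xi)$ and $M_B^+(\xi)=\operatorname{ess\,sup}_{y\in B\cap\Omega}M(y,\xi)$. For $\gamma\in[0,1]$, $M$ satisfies $(\mathsf{B}^{\mathsf{gen}}_\gamma)$ if $M(x,\xi)=\sum_{j=1}^{L}N_j(x,\xi_j)$ for all $x \in \Omega$ and $\xi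 \in V$, where $L\ge1$, the components $\xi_j=P_j\xi\in\mathbb{R}^{\ell_j}$ depend linearly on $\xi$ and together determine $\xi$ (that is, $\bigcap_j\ker P_j=\{0\}$), each $N_j:\Omega\times\mathbb{R}^{\ell_j}\to[0,\infty)$ is a weak $N$-function, and there are constants $c^\Diamond,C^\Diamond>1$ such that for every ball $B$ of radius $r\in(0,1]$ meeting $\Omega$, every $j$ and every $v\in\mathbb{R}^{\ell_j}$, $$(N_j)_B^-(C^\Diamond v)\le\sup_{|\eta|=1}(N_j)_B^-\big(c^\Diamond r^{\gamma-1}\eta\big)\quad\Longrightarrow\quad (N_j)_B^+(v)\le (N_j)_B^-(C^\Diamond v)+1 .$$ Matrices $\boldsymbol\xi\in\mathbb{R}^{n\times d}$ carry the Euclidean norm and are written $\boldsymbol\xi=(\boldsymbol\xi^1,\dots,\boldsymbol\xi^d)$ with columns $\boldsymbol\xi^i\in\mathbb{R}^n$; the $i$-th column of the gradient $\nabla\boldsymbol\varphi$ of a map $\boldsymbol\varphi=(\varphi^1,\dots,\varphi^d)$ is $\nabla\varphi^i$. $L_M(\Omega;\mathbb{R}^{n\times d})$ is the smallest linear space containing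 all measurable $\boldsymbol\xi:\Omega\to\mathbb{R}^{n\times d}$ with $\int_\Omega M(x,\boldsymbol\xi(x))\,dx<\infty$, and $\boldsymbol\xi_k\to\boldsymbol\xi$ *modularly* in $L_M$ if $\int_\Omega M\big(x,(\boldsymbol\xi_k-\boldsymbol\xi)/\lambda\big)\,dx\to0$ for some $\lambda>0$. $W^{1,1}_0(\Omega;\mathbb{R}^d)$ is the closure of $C_c^\infty(\Omega;\mathbb{R}^d)$ in $W^{1,1}(\Omega;\mathbb{R}^d)$, and $V^1_0L_M(\Omega)=\{\boldsymbol\varphi\in W^{1,1}_0(\Omega;\mathbb{R}^d):\nabla\boldsymbol\varphi\in L_M(\Omega;\mathbb{R}^{n\times d})\}$, with $\nabla$ the distributional gradient. For $\gamma\in(0,1]$, $\boldsymbol\varphi\in C^{0,\gamma}(\Omega)$ means $\sup_{x\neq y\in\Omega}|\boldsymbol\varphi(x)-\boldsymbol\varphi(y)|/|x-y|^\gamma<\infty$. *Statement.* There is a constant $c=c(\Omega)>0$ with the following property. Let $d \geq 1$, let $M:\Omega\times\mathbb{R}^{n\times d}\to[0,\infty)$ be a weak $N$-function that is continuous on $\Omega\times\mathbb{R}^{n\times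 d}$, and suppose that $M(x,\boldsymbol\xi)=\sum_{i=1}^dM_i(x,\boldsymbol\xi^i)$ for all $x \in \Omega$ and $\boldsymbol\xi \in \mathbb{R}^{n \times d}$, with weak $N$-functions $M_i:\Omega\times\mathbb{R}^n\to[0,\infty)$. 1. If $\gamma=0$ and $M$ satisfies $(\mathsf{B}^{\mathsf{gen}}_\gamma)$, then for every $\boldsymbol\varphi\in V^1_0L_M(\Omega)$ there is a sequence $(\boldsymbol\varphi_k)_k\subset C_c^\infty(\Omega;\mathbb{R}^d)$ such that $\boldsymbol\varphi_k\to\boldsymbol\varphi$ strongly in $L^1(\Omega)$ and in measure, and $\nabla\boldsymbol\varphi_k\to\nabla\boldsymbol\varphi$ modularly in $L_M(\Omega;\mathbb{R}^{n\times d})$. 2. If $\gamma\in(0,1]$ and $M$ satisfies $(\mathsf{B}^{\mathsf{gen}}_\gamma)$, then for every $\boldsymbol\varphi\in V^1_0L_M(\Omega)\cap C^{0,\gamma}(\Omega)$ there is a sequence $(\boldsymbol\varphi_k)_k\subset C_c^\infty(\Omega;\mathbb{R}^d)$ with the same properties. Moreover, in both cases, if $\boldsymbol\varphi\in L^\infty(\Omega;\mathbb{R}^d)$,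 then the sequence can be chosen such that, in addition, $\|\boldsymbol\varphi_k\|_{L^\infty(\Omega;\mathbb{R}^d)}\le c\,\|\boldsymbol\varphi\|_{L^\infty(\Omega;\mathbb{R}^d)}$ for all $k$. -/

import Mathlib

open MeasureTheory Filter Topology Set
open scoped ENNReal NNReal ContDiff

/-- Matrices in `ℝ^{n×d}`, written as a tuple of `d` columns in `ℝⁿ`, with the Euclidean
(Frobenius) norm. The `i`-th column of `ξ` is `ξ i`. -/
abbrev ColMatrix (n d : ℕ) : Type := PiLp 2 (fun _ : Fin d => EuclideanSpace ℝ (Fin n))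

section Domain

variable {E : Type*} [NormedAddCommGroup E] [InnerProductSpace ℝ E]

/-- A bounded Lipschitz domain: a nonempty, open, connected, bounded set which near every boundary
point is, in the direction of some unit vector `ν`, the strict supergraph of a Lipschitz function
`g` on the hyperplane orthogonal to `ν` (a Lipschitz function on the hyperplane is composed with
the orthogonal projection `x ↦ x - ⟪ν, x⟫ ν`). -/
def IsBoundedLipschitzDomain (Ω : Set E) : Prop :=
  IsOpen Ω ∧ IsConnected Ω ∧ Bornology.IsBounded Ω ∧
    ∀ x₀ ∈ frontier Ω, ∃ ν : E, ‖ν‖ = 1 ∧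
      ∃ (K : ℝ≥0) (g : E → ℝ), LipschitzWith K g ∧
        ∃ U ∈ 𝓝 x₀, ∀ x ∈ U, x ∈ Ω ↔ g (x - (inner ℝ ν x) • ν) < inner ℝ ν x

end Domain

section Modular

variable {n : ℕ} {V : Type*} [NormedAddCommGroup V] [InnerProductSpace ℝ V]

/-- Weak `N`-functions `M : Ω × V → [0, ∞)`; the values of `M` outside `Ω` play no role. -/
structure IsWeakNFunction (Ω : Set (EuclideanSpace ℝ (Fin n)))
    (M : EuclideanSpace ℝ (Fin n) → V → ℝ) : Prop where
  nonneg : ∀ x ∈ Ω, ∀ ξ, 0 ≤ M x ξ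
  measurable : ∀ ξ, AEMeasurable (fun x => M x ξ) (volume.restrict Ω)
  continuous : ∀ᵐ x ∂(volume.restrict Ω), Continuous (M x)
  zero : ∀ᵐ x ∂(volume.restrict Ω), M x 0 = 0
  convex : ∀ᵐ x ∂(volume.restrict Ω), ConvexOn ℝ univ (M x)
  even : ∀ᵐ x ∂(volume.restrict Ω), ∀ ξ, M x ξ = M x (-ξ)
  bounds : ∃ m₁ m₂ : ℝ → ℝ,
    ConvexOn ℝ (Ici 0) m₁ ∧ ConvexOn ℝ (Ici 0) m₂ ∧
    m₁ 0 = 0 ∧ (∀ s, 0 < s → 0 < m₁ s) ∧ (∀ s, 0 ≤ s → 0 ≤ m₂ s) ∧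
    ∀ᵐ x ∂(volume.restrict Ω), ∀ ξ, m₁ ‖ξ‖ ≤ M x ξ ∧ M x ξ ≤ m₂ ‖ξ‖

/-- The modular `∫_Ω M(x, ξ(x)) dx`, with values in `[0, ∞]`. -/
noncomputable def modular (Ω : Set (EuclideanSpace ℝ (Fin n)))
    (M : EuclideanSpace ℝ (Fin n) → V → ℝ) (ξ : EuclideanSpace ℝ (Fin n) → V) : ℝ≥0∞ :=
  ∫⁻ x in Ω, ENNReal.ofReal (M x (ξ x))

/-- The Musielak–Orlicz space `L_M(Ω; V)`: the smallest linear space containing all measurable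
functions on `Ω` of finite modular. -/
def musielakOrlicz (Ω : Set (EuclideanSpace ℝ (Fin n)))
    (M : EuclideanSpace ℝ (Fin n) → V → ℝ) : Submodule ℝ (EuclideanSpace ℝ (Fin n) → V) :=
  Submodule.span ℝ {ξ | AEStronglyMeasurable ξ (volume.restrict Ω) ∧ modular Ω M ξ < ⊤}

/-- Modular convergence `ξₖ → ξ` in `L_M`: for some `lam > 0`, the modulars of `(ξₖ - ξ) / lam`
tend to zero. -/
def ModularTendsto (Ω : Set (EuclideanSpace ℝ (Fin n)))
    (M : EuclideanSpace ℝ (Fin n) → V → ℝ) (ξs : ℕ → EuclideanSpace ℝ (Fin n) → V)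
    (ξ : EuclideanSpace ℝ (Fin n) → V) : Prop :=
  ∃ lam : ℝ, 0 < lam ∧
    Tendsto (fun k => modular Ω M (fun x => lam⁻¹ • (ξs k x - ξ x))) atTop (𝓝 0)

/-- `M_B^-(ξ) = ess inf_{y ∈ B} M(y, ξ)`; as `M` lives on `Ω`, the points `y` range over
`B ∩ Ω`. -/
noncomputable def lowerEnvelope (Ω : Set (EuclideanSpace ℝ (Fin n)))
    (M : EuclideanSpace ℝ (Fin n) → V → ℝ) (B : Set (EuclideanSpace ℝ (Fin n))) (ξ : V) : ℝ≥0∞ :=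
  essInf (fun y => ENNReal.ofReal (M y ξ)) (volume.restrict (B ∩ Ω))

/-- `M_B^+(ξ) = ess sup_{y ∈ B} M(y, ξ)`, with `y` ranging over `B ∩ Ω`. -/
noncomputable def upperEnvelope (Ω : Set (EuclideanSpace ℝ (Fin n)))
    (M : EuclideanSpace ℝ (Fin n) → V → ℝ) (B : Set (EuclideanSpace ℝ (Fin n))) (ξ : V) : ℝ≥0∞ :=
  essSup (fun y => ENNReal.ofReal (M y ξ)) (volume.restrict (B ∩ Ω))

/-- The general balance condition with exponent `γ`: `M(x, ξ) = ∑ⱼ Mⱼ(x, ξⱼ)` for weak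
`N`-functions `Mⱼ` of components `ξⱼ = P j ξ ∈ ℝ^{ℓ j}` which depend linearly on `ξ` and together
span the whole space (equivalently, together determine `ξ`), and each `Mⱼ` satisfies the balance
inequality on every ball of radius at most one that meets `Ω`. -/
def BalanceGen (Ω : Set (EuclideanSpace ℝ (Fin n))) (γ : ℝ)
    (M : EuclideanSpace ℝ (Fin n) → V → ℝ) : Prop :=
  ∃ (L : ℕ) (ℓ : Fin L → ℕ) (P : ∀ j, V →ₗ[ℝ] EuclideanSpace ℝ (Fin (ℓ j)))
    (Mj : ∀ j, EuclideanSpace ℝ (Fin n) → EuclideanSpace ℝ (Fin (ℓ j)) → ℝ),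
    0 < L ∧
    (∀ ξ : V, (∀ j, P j ξ = 0) → ξ = 0) ∧
    (∀ j, IsWeakNFunction Ω (Mj j)) ∧
    (∀ x ∈ Ω, ∀ ξ : V, M x ξ = ∑ j, Mj j x (P j ξ)) ∧
    ∃ c C : ℝ, 1 < c ∧ 1 < C ∧
      ∀ (z : EuclideanSpace ℝ (Fin n)) (r : ℝ), 0 < r → r ≤ 1 →
        (Metric.ball z r ∩ Ω).Nonempty →
        ∀ (j : Fin L) (v : EuclideanSpace ℝ (Fin (ℓ j))),
          lowerEnvelope Ω (Mj j) (Metric.ball z r) (C • v) ≤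
              (⨆ (η : EuclideanSpace ℝ (Fin (ℓ j))) (_ : ‖η‖ = 1),
                lowerEnvelope Ω (Mj j) (Metric.ball z r) ((c * r ^ (γ - 1)) • η)) →
          upperEnvelope Ω (Mj j) (Metric.ball z r) v ≤
              lowerEnvelope Ω (Mj j) (Metric.ball z r) (C • v) + 1

end Modular

section Sobolev

variable {n d : ℕ}

/-- `C_c^∞(Ω; F)`. -/
def IsTestMap {F : Type*} [NormedAddCommGroup F] [NormedSpace ℝ F]
    (Ω : Set (EuclideanSpace ℝ (Fin n))) (u : EuclideanSpace ℝ (Fin n) → F) : Prop :=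
  ContDiff ℝ ∞ u ∧ HasCompactSupport u ∧ tsupport u ⊆ Ω

/-- The classical gradient of a map into `ℝᵈ`; its `i`-th column is the gradient of the `i`-th
component. -/
noncomputable def gradMap
    (u : EuclideanSpace ℝ (Fin n) → EuclideanSpace ℝ (Fin d)) :
    EuclideanSpace ℝ (Fin n) → ColMatrix n d :=
  fun x => WithLp.toLp 2 (fun i => gradient (fun y => u y i) x)

/-- `G` is the distributional gradient of `f` on `Ω`. -/
def IsWeakGradient (Ω : Set (EuclideanSpace ℝ (Fin n)))
    (f : EuclideanSpace ℝ (Fin n) → EuclideanSpace ℝ (Fin d))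
    (G : EuclideanSpace ℝ (Fin n) → ColMatrix n d) : Prop :=
  LocallyIntegrableOn f Ω ∧ LocallyIntegrableOn G Ω ∧
    ∀ η : EuclideanSpace ℝ (Fin n) → ℝ, IsTestMap Ω η →
      ∀ (i : Fin d) (v : EuclideanSpace ℝ (Fin n)),
        ∫ x in Ω, f x i * fderiv ℝ η x v = -∫ x in Ω, inner ℝ (G x i) v * η x

/-- `W^{1,1}_0(Ω; ℝᵈ)`: the closure of `C_c^∞(Ω; ℝᵈ)` in `W^{1,1}(Ω; ℝᵈ)`. -/
def MemW110 (Ω : Set (EuclideanSpace ℝ (Fin n)))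
    (f : EuclideanSpace ℝ (Fin n) → EuclideanSpace ℝ (Fin d)) : Prop :=
  ∃ G : EuclideanSpace ℝ (Fin n) → ColMatrix n d,
    IsWeakGradient Ω f G ∧ IntegrableOn f Ω ∧ IntegrableOn G Ω ∧
    ∃ u : ℕ → EuclideanSpace ℝ (Fin n) → EuclideanSpace ℝ (Fin d),
      (∀ k, IsTestMap Ω (u k)) ∧
      Tendsto (fun k => eLpNorm (fun x => u k x - f x) 1 (volume.restrict Ω)) atTop (𝓝 0) ∧
      Tendsto (fun k => eLpNorm (fun x => gradMap (u k) x - G x) 1 (volume.restrict Ω))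
        atTop (𝓝 0)

/-- `V^1_0 L_M(Ω)`: the maps in `W^{1,1}_0(Ω; ℝᵈ)` whose distributional gradient is in `L_M`. -/
def MemV10LM (Ω : Set (EuclideanSpace ℝ (Fin n)))
    (M : EuclideanSpace ℝ (Fin n) → ColMatrix n d → ℝ)
    (f : EuclideanSpace ℝ (Fin n) → EuclideanSpace ℝ (Fin d)) : Prop :=
  MemW110 Ω f ∧ ∃ G, IsWeakGradient Ω f G ∧ G ∈ musielakOrlicz Ω M

/-- `C^{0,γ}(Ω; ℝᵈ)`: the Hölder seminorm on `Ω` is finite. -/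
def MemHolderClass (Ω : Set (EuclideanSpace ℝ (Fin n))) (γ : ℝ)
    (f : EuclideanSpace ℝ (Fin n) → EuclideanSpace ℝ (Fin d)) : Prop :=
  ∃ K : ℝ, ∀ x ∈ Ω, ∀ y ∈ Ω, ‖f x - f y‖ ≤ K * ‖x - y‖ ^ γ

/-- There are maps `uₖ ∈ C_c^∞(Ω; ℝᵈ)` with `uₖ → f` in `L¹(Ω)` and in measure, with gradients
converging modularly in `L_M` to the distributional gradient of `f`, and, if `f` is essentially
bounded, with `‖uₖ‖_∞ ≤ c ‖f‖_∞` for all `k`. -/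
def SmoothlyApproximable (Ω : Set (EuclideanSpace ℝ (Fin n)))
    (M : EuclideanSpace ℝ (Fin n) → ColMatrix n d → ℝ) (c : ℝ)
    (f : EuclideanSpace ℝ (Fin n) → EuclideanSpace ℝ (Fin d)) : Prop :=
  ∃ u : ℕ → EuclideanSpace ℝ (Fin n) → EuclideanSpace ℝ (Fin d),
    (∀ k, IsTestMap Ω (u k)) ∧
    Tendsto (fun k => eLpNorm (fun x => u k x - f x) 1 (volume.restrict Ω)) atTop (𝓝 0) ∧
    TendstoInMeasure (volume.restrict Ω) u atTop f ∧
    (∀ G, IsWeakGradient Ω f G → ModularTendsto Ω M (fun k => gradMap (u k)) G) ∧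
    (MemLp f ⊤ (volume.restrict Ω) →
      ∀ k, eLpNorm (u k) ⊤ (volume.restrict Ω) ≤
        ENNReal.ofReal c * eLpNorm f ⊤ (volume.restrict Ω))

end Sobolev

/-! Extend the map by zero and cut it by a smooth partition of unity on the closure of the domain,
subordinate to balls in which the domain can be translated into itself with room to spare
(`IsBoundedLipschitzDomain.exists_translation`). Convolving a piece with a kernel concentrated near
`t • ν` gives a test map. The zero extension of a `W^{1,1}_0` map has the zero extension of the
gradient as its gradient, so the gradient of the convolution is the convolved gradient. `L¹`
convergence is then standard; modular convergence is the point.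

The pointwise core is a Jensen inequality with a non-convex minorant,
`ConvexOn.le_integral_of_minorant`. On a ball of radius `r` the lower envelope of a component of the
integrand is only star-shaped. By the balance condition it nevertheless dominates the component at
almost every point of the ball, up to a dilation and `+1`, on the sublevel set at height `K`, the
supremum of the envelope over the sphere of radius `c * r ^ (γ - 1)`. Hence, if the mollified field
`κ ∗ w` is no larger than that radius, the integrand of a fixed dilate of `κ ∗ w` is at most `A * (κ
∗ F + 1)`, where `F` dominates the integrand of `w` (`BalanceGen.exists_mollifyBound`). Since `κ ∗
F` converges in `L¹`, a form of dominated convergence applies.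

The size condition comes from Hölder continuity: `∇κ` has mean zero and `L¹` norm `O(1/t)`, so the
mollified gradient is `O(H * t ^ (γ - 1))`; for `γ = 0` the oscillation `2 * sup ‖φ‖` plays the part
of `H`. But `H` may be too large for the constants of the balance condition. So every piece is
divided into `N + 1` equal parts, which divides `H` by `N + 1`, and the parts are approximated one
after another. By `ApproxAt.add` this costs nothing in the scale `Λ`: as the new part is mollified
more and more finely, the upper limit of the modular of the total error is at most that of the error
already made. The sup bounds of the parts add up to the number of partition functions times `sup
‖φ‖`, whence a constant depending on the domain alone.

Two supplements remain. For `γ > 0`, Hölder continuity on the domain must pass to the zero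
extension; this holds because a `W^{1,1}` function cannot jump across the boundary
(`HasIntegrableGradient.holder_extension`). For `γ = 0`, unbounded maps are first truncated
componentwise by `arctanTrunc`; this multiplies the columns of the gradient by different factors in
`[0, 1]`, which is harmless because the integrand is a sum over columns. No sup bound is then
required. -/

set_option linter.unusedSectionVars false

/-! ### Convolution with smooth kernels, and approximate identities in `L¹`. -/

section Mollification

variable {E F : Type*} [NormedAddCommGroup E] [NormedSpace ℝ E] [FiniteDimensional ℝ E]
  [MeasureSpace E] [BorelSpace E] [(volume : Measure E).IsAddHaarMeasure]
  [NormedAddCommGroup F] [NormedSpace ℝ F]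

/-- The convolution of a scalar kernel with a vector-valued function. -/
noncomputable def mollify (κ : E → ℝ) (f : E → F) (x : E) : F := ∫ y, κ (x - y) • f y

/-- Smooth probability densities supported in a set `s`. -/
structure IsMollifier (κ : E → ℝ) (s : Set E) : Prop where
  contDiff : ContDiff ℝ ∞ κ
  hasCompactSupport : HasCompactSupport κ
  nonneg : ∀ z, 0 ≤ κ z
  integral_eq_one : ∫ z, κ z = 1
  eq_zero : ∀ z, z ∉ s → κ z = 0

theorem mollify_eq_convolution (κ : E → ℝ) (f : E → F) :
    mollify κ f = convolution κ f (ContinuousLinearMap.lsmul ℝ ℝ) volume := by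
  ext x
  rw [convolution_lsmul_swap]
  rfl

theorem integrable_kernel_smul {κ : E → ℝ} (hκ : Continuous κ) (hc : HasCompactSupport κ)
    {f : E → F} (hf : Integrable f) (x : E) : Integrable (fun y => κ (x - y) • f y) := by
  obtain ⟨C, hC⟩ := hκ.bounded_above_of_compact_support hc
  exact hf.bdd_smul C (hκ.comp (continuous_const.sub continuous_id)).aestronglyMeasurable
    (ae_of_all _ fun y => hC _)

theorem contDiff_mollify {κ : E → ℝ} (hκ : ContDiff ℝ ∞ κ) (hc : HasCompactSupport κ)
    [CompleteSpace F] {f : E → F} (hf : Integrable f) : ContDiff ℝ ∞ (mollify κ f) := by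
  rw [mollify_eq_convolution]
  exact hc.contDiff_convolution_left _ hκ hf.locallyIntegrable

theorem integrable_fderiv_kernel_smul {κ : E → ℝ} (hκ : ContDiff ℝ ∞ κ) (hc : HasCompactSupport κ)
    {f : E → F} (hf : Integrable f) (x v : E) :
    Integrable (fun y => (fderiv ℝ κ (x - y) v) • f y) := by
  have h1 : Continuous (fun z => fderiv ℝ κ z v) :=
    (hκ.continuous_fderiv (by simp)).clm_apply continuous_const
  have h2 : HasCompactSupport (fun z => fderiv ℝ κ z v) := hc.fderiv_apply ℝ v
  exact integrable_kernel_smul h1 h2 hf x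

theorem fderiv_mollify_apply {κ : E → ℝ} (hκ : ContDiff ℝ ∞ κ) (hc : HasCompactSupport κ)
    [CompleteSpace F] {f : E → F} (hf : Integrable f) (x v : E) :
    fderiv ℝ (mollify κ f) x v = ∫ y, (fderiv ℝ κ (x - y) v) • f y := by
  have h := hc.hasFDerivAt_convolution_left (ContinuousLinearMap.lsmul ℝ ℝ)
    (hκ.of_le (by simp)) hf.locallyIntegrable x
  rw [mollify_eq_convolution, h.fderiv, convolution_eq_swap, ContinuousLinearMap.integral_apply]
  · rfl
  · have h1 : Continuous (fderiv ℝ κ) := hκ.continuous_fderiv (by simp)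
    obtain ⟨C, hC⟩ := h1.bounded_above_of_compact_support (hc.fderiv ℝ)
    have := (hc.fderiv ℝ).convolutionExists_left
      (ContinuousLinearMap.precompL E (ContinuousLinearMap.lsmul ℝ ℝ : ℝ →L[ℝ] F →L[ℝ] F)) h1
      hf.locallyIntegrable x
    exact this.integrable_swap

/-- Integration by parts against the constant `1`. This cancellation lets a gradient of a
convolution see only the oscillation of the function. -/
theorem integral_fderiv_kernel_eq_zero {κ : E → ℝ} (hκ : ContDiff ℝ ∞ κ)
    (hc : HasCompactSupport κ) (v : E) : ∫ z, fderiv ℝ κ z v = 0 := by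
  have h1 : Continuous (fun z => fderiv ℝ κ z v) :=
    (hκ.continuous_fderiv (by simp)).clm_apply continuous_const
  have := integral_mul_fderiv_eq_neg_fderiv_mul_of_integrable (μ := (volume : Measure E))
    (f := fun _ => (1 : ℝ)) (g := κ) (v := v) (by simp)
    (by simpa using h1.integrable_of_hasCompactSupport (hc.fderiv_apply ℝ v))
    (by simpa using hκ.continuous.integrable_of_hasCompactSupport hc)
    (fun x _ => by fun_prop) (fun x _ => (hκ.differentiable (by simp)).differentiableAt)
  simpa using this

variable {κ : E → ℝ} {s : Set E}

theorem IsMollifier.integrable (h : IsMollifier κ s) : Integrable κ :=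
  h.contDiff.continuous.integrable_of_hasCompactSupport h.hasCompactSupport

theorem IsMollifier.integral_translate (h : IsMollifier κ s) (x : E) : ∫ y, κ (x - y) = 1 := by
  rw [integral_sub_left_eq_self κ volume x, h.integral_eq_one]

theorem IsMollifier.integrable_translate (h : IsMollifier κ s) (x : E) :
    Integrable (fun y => κ (x - y)) := h.integrable.comp_sub_left x

theorem IsMollifier.norm_mollify_le (h : IsMollifier κ s) {f : E → F} {B : ℝ}
    (hB : ∀ᵐ y, ‖f y‖ ≤ B) (x : E) : ‖mollify κ f x‖ ≤ B := by
  calc ‖mollify κ f x‖ ≤ ∫ y, κ (x - y) * B := by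
        refine norm_integral_le_of_norm_le ((h.integrable_translate x).mul_const B) ?_
        filter_upwards [hB] with y hy
        rw [norm_smul, Real.norm_of_nonneg (h.nonneg _)]
        exact mul_le_mul_of_nonneg_left hy (h.nonneg _)
    _ = B := by rw [integral_mul_const, h.integral_translate, one_mul]

theorem IsMollifier.exists_of_mollify_ne_zero (h : IsMollifier κ s) {f : E → F} {x : E}
    (hx : mollify κ f x ≠ 0) : ∃ y, f y ≠ 0 ∧ x - y ∈ s := by
  by_contra! hcon
  refine hx (integral_eq_zero_of_ae (ae_of_all _ fun y => ?_))
  by_cases hy : f y = 0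
  · simp [hy]
  · simp [h.eq_zero _ (hcon y hy)]

/-- Translations are measure preserving and depend continuously on `z` in the compact-open topology,
so composition with them is continuous into `L¹`. -/
theorem tendsto_lintegral_translate_sub [CompleteSpace F] {f : E → F} (hf : Integrable f) :
    Tendsto (fun z => ∫⁻ x, ‖f (x - z) - f x‖ₑ) (𝓝 0) (𝓝 0) := by
  have hm : MemLp f 1 (volume : Measure E) := memLp_one_iff_integrable.2 hf
  have hg : Continuous (fun z : E => (ContinuousMap.mk (fun p : E × E => p.2 - p.1)
      (by fun_prop)).curry z) := ContinuousMap.continuous _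
  have hmp : ∀ z : E, MeasurePreserving
      ((ContinuousMap.mk (fun p : E × E => p.2 - p.1) (by fun_prop)).curry z) volume volume :=
    fun z => measurePreserving_sub_right volume z
  have key := (Continuous.compMeasurePreservingLp (p := 1) (f := fun _ : E => hm.toLp f)
    continuous_const hg hmp (by simp)).tendsto 0
  have key3 := tendsto_iff_edist_tendsto_0.1 key
  refine key3.congr fun z => ?_
  rw [Lp.edist_def, eLpNorm_one_eq_lintegral_enorm]
  refine lintegral_congr_ae ?_
  have h0 : ∀ z : E, ∀ᵐ x, Lp.compMeasurePreserving _ (hmp z) (hm.toLp f) x = f (x - z) := by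
    intro z
    filter_upwards [Lp.coeFn_compMeasurePreserving (hm.toLp f) (hmp z),
      (hmp z).quasiMeasurePreserving.ae (hm.coeFn_toLp)] with x hx hx'
    rw [hx]; exact hx'
  filter_upwards [h0 z, h0 0] with x h1 h2
  simp only [Pi.sub_apply]
  rw [h1, h2, sub_zero]

/-- The error is a `κ`-average of the translation errors with `z ∈ s`; Tonelli moves the `L¹` norm
inside the average. -/
theorem IsMollifier.lintegral_mollify_sub_le [CompleteSpace F] (h : IsMollifier κ s) {f : E → F}
    (hf : Integrable f) {ε : ℝ≥0∞} (hε : ∀ z ∈ s, ∫⁻ x, ‖f (x - z) - f x‖ₑ ≤ ε) :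
    ∫⁻ x, ‖mollify κ f x - f x‖ₑ ≤ ε := by
  have h1 : ∀ x, mollify κ f x - f x = ∫ z, κ z • (f (x - z) - f x) := by
    intro x
    have e1 : mollify κ f x = ∫ z, κ z • f (x - z) := by
      rw [mollify, ← integral_sub_left_eq_self _ volume x]
      simp
    have i1 : Integrable (fun z => κ z • f (x - z)) := by
      have := (integrable_kernel_smul h.contDiff.continuous h.hasCompactSupport hf x).comp_sub_left x
      simpa using this
    simp_rw [smul_sub]
    rw [integral_sub i1 (h.integrable.smul_const _), integral_smul_const, h.integral_eq_one,
      one_smul, e1]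
  have hmeas : AEMeasurable (Function.uncurry fun x z : E => ‖κ z‖ₑ * ‖f (x - z) - f x‖ₑ)
      (volume.prod volume) := by
    have m1 : AEStronglyMeasurable (fun p : E × E => f (p.1 - p.2)) (volume.prod volume) :=
      hf.aestronglyMeasurable.comp_quasiMeasurePreserving
        (quasiMeasurePreserving_sub_of_right_invariant volume volume)
    have m2 : AEStronglyMeasurable (fun p : E × E => f p.1) (volume.prod volume) :=
      hf.aestronglyMeasurable.comp_fst
    have m3 : AEStronglyMeasurable (fun p : E × E => κ p.2) (volume.prod volume) :=
      h.integrable.aestronglyMeasurable.comp_snd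
    exact m3.enorm.mul (m1.sub m2).enorm
  calc ∫⁻ x, ‖mollify κ f x - f x‖ₑ
      ≤ ∫⁻ x, ∫⁻ z, ‖κ z‖ₑ * ‖f (x - z) - f x‖ₑ := by
        refine lintegral_mono fun x => ?_
        rw [h1]
        refine (enorm_integral_le_lintegral_enorm _).trans (le_of_eq ?_)
        simp_rw [enorm_smul]
    _ = ∫⁻ z, ∫⁻ x, ‖κ z‖ₑ * ‖f (x - z) - f x‖ₑ := lintegral_lintegral_swap hmeas
    _ = ∫⁻ z, ‖κ z‖ₑ * ∫⁻ x, ‖f (x - z) - f x‖ₑ := by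
        refine lintegral_congr fun z => ?_
        rw [lintegral_const_mul' _ _ enorm_ne_top]
    _ ≤ ∫⁻ z, ‖κ z‖ₑ * ε := by
        refine lintegral_mono fun z => ?_
        by_cases hz : z ∈ s
        · exact mul_le_mul_right (hε z hz) _
        · simp [h.eq_zero z hz]
    _ = ε := by
        rw [lintegral_mul_const'' _ h.integrable.aestronglyMeasurable.enorm]
        have : ∫⁻ z, ‖κ z‖ₑ = 1 := by
          rw [← ofReal_integral_norm_eq_lintegral_enorm h.integrable]
          simp_rw [Real.norm_of_nonneg (h.nonneg _), h.integral_eq_one]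
          simp
        rw [this, one_mul]

/-- Mollifiers with supports shrinking to the origin form an approximate identity in `L¹`. -/
theorem tendsto_lintegral_mollify_sub [CompleteSpace F] {κ : ℕ → E → ℝ} {s : ℕ → Set E}
    (h : ∀ k, IsMollifier (κ k) (s k)) (hs : Tendsto s atTop (𝓝 0).smallSets) {f : E → F}
    (hf : Integrable f) :
    Tendsto (fun k => ∫⁻ x, ‖mollify (κ k) f x - f x‖ₑ) atTop (𝓝 0) := by
  rw [ENNReal.tendsto_nhds_zero]
  intro ε hε
  have h1 := (ENNReal.tendsto_nhds_zero.1 (tendsto_lintegral_translate_sub hf)) ε hε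
  filter_upwards [tendsto_smallSets_iff.1 hs _ h1] with k hk
  exact (h k).lintegral_mollify_sub_le hf fun z hz => hk hz

/-- Rescale one bump to radius `a * t` and move it to `t • ν`. Mass is preserved and differentiation
costs a factor `(a * t)⁻¹`, so `D` does not depend on `t`. The displacement is what later pushes
supports into the domain. -/
theorem exists_isMollifier (ν : E) {a : ℝ} (ha : 0 < a) :
    ∃ D : ℝ, 0 ≤ D ∧ ∀ t : ℝ, 0 < t → ∃ κ : E → ℝ,
      IsMollifier κ (Metric.closedBall (t • ν) (a * t)) ∧
      Integrable (fun z => ‖fderiv ℝ κ z‖) ∧ ∫ z, ‖fderiv ℝ κ z‖ ≤ D / t := by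
  let β : ContDiffBump (0 : E) := ⟨1 / 2, 1, by norm_num, by norm_num⟩
  let ρ : E → ℝ := β.normed volume
  have hρ : ContDiff ℝ ∞ ρ := β.contDiff_normed
  have hρc : HasCompactSupport ρ := β.hasCompactSupport_normed
  have hdc : Continuous (fun z => ‖fderiv ℝ ρ z‖) := (hρ.continuous_fderiv (by simp)).norm
  refine ⟨a⁻¹ * ∫ z, ‖fderiv ℝ ρ z‖,
    mul_nonneg (inv_nonneg.2 ha.le) (integral_nonneg fun _ => norm_nonneg _), fun t ht => ?_⟩
  set q : ℝ := a * t with hq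
  have hq0 : 0 < q := mul_pos ha ht
  set N := Module.finrank ℝ E
  let A : E → E := fun z => q⁻¹ • (z - t • ν)
  let κ : E → ℝ := fun z => (q ^ N)⁻¹ * ρ (A z)
  have hscale : ∀ g : E → ℝ, ∫ z, g (A z) = q ^ N * ∫ z, g z := by
    intro g
    have := integral_sub_right_eq_self (μ := (volume : Measure E)) (fun z => g (q⁻¹ • z)) (t • ν)
    rw [show (fun z => g (A z)) = fun z => g (q⁻¹ • (z - t • ν)) from rfl, this,
      Measure.integral_comp_inv_smul_of_nonneg _ _ hq0.le, smul_eq_mul]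
  have hAc : ContDiff ℝ ∞ A := contDiff_const_smul _ |>.comp (contDiff_id.sub contDiff_const)
  have hκc : ContDiff ℝ ∞ κ := contDiff_const.mul (hρ.comp hAc)
  have hz0 : ∀ z, z ∉ Metric.closedBall (t • ν) q → κ z = 0 := by
    intro z hz
    have : A z ∉ Function.support ρ := by
      rw [β.support_normed_eq, Metric.mem_ball, dist_zero_right, norm_smul, norm_inv,
        Real.norm_of_nonneg hq0.le, not_lt]
      rw [Metric.mem_closedBall, dist_eq_norm, not_le] at hz
      change 1 ≤ _
      rw [inv_mul_eq_div, one_le_div hq0]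
      exact hz.le
    simp only [κ, Function.notMem_support.1 this, mul_zero]
  have hκs : HasCompactSupport κ :=
    HasCompactSupport.intro (isCompact_closedBall (t • ν) q) fun z hz => hz0 z hz
  have hfd : ∀ z, ‖fderiv ℝ κ z‖ = (q ^ N)⁻¹ * q⁻¹ * ‖fderiv ℝ ρ (A z)‖ := by
    intro z
    have hA : HasFDerivAt A (q⁻¹ • ContinuousLinearMap.id ℝ E) z :=
      ((hasFDerivAt_id z).sub_const (t • ν)).const_smul q⁻¹
    have h1 : HasFDerivAt κ ((q ^ N)⁻¹ • (fderiv ℝ ρ (A z)).comp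
        (q⁻¹ • ContinuousLinearMap.id ℝ E)) z :=
      (((hρ.differentiable (by simp)).differentiableAt.hasFDerivAt).comp z hA).const_mul _
    rw [h1.fderiv, ContinuousLinearMap.comp_smul, ContinuousLinearMap.comp_id, norm_smul,
      norm_smul, norm_inv, norm_inv, norm_pow, Real.norm_of_nonneg hq0.le, mul_assoc]
  refine ⟨κ, ⟨hκc, hκs, fun z => ?_, ?_, hz0⟩, ?_, ?_⟩
  · exact mul_nonneg (by positivity) (β.nonneg_normed _)
  · simp only [κ]
    rw [integral_const_mul, hscale, β.integral_normed]
    field_simp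
  · exact (hκc.continuous_fderiv (by simp)).norm.integrable_of_hasCompactSupport
      (hκs.fderiv ℝ).norm
  · simp_rw [hfd]
    rw [integral_const_mul, hscale fun z => ‖fderiv ℝ ρ z‖]
    apply le_of_eq
    rw [hq]
    field_simp

end Mollification

/-! ### Consequences of `L¹` convergence. -/

theorem exists_subseq_tendsto_ae_of_lintegral {α F : Type*} [MeasurableSpace α] {μ : Measure α}
    [NormedAddCommGroup F] {f : ℕ → α → F} {g : α → F} (hf : ∀ k, AEStronglyMeasurable (f k) μ)
    (hg : AEStronglyMeasurable g μ)
    (h : Tendsto (fun k => ∫⁻ x, ‖f k x - g x‖ₑ ∂μ) atTop (𝓝 0)) :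
    ∃ ns : ℕ → ℕ, StrictMono ns ∧ ∀ᵐ x ∂μ, Tendsto (fun k => f (ns k) x) atTop (𝓝 (g x)) := by
  refine TendstoInMeasure.exists_seq_tendsto_ae
    (tendstoInMeasure_of_tendsto_eLpNorm one_ne_zero hf hg ?_)
  simpa [eLpNorm_one_eq_lintegral_enorm] using h

/-- Integrals converge when the integrands are dominated, in difference, by an `L¹`-convergent
sequence. -/
theorem tendsto_integral_of_norm_sub_le {α F : Type*} [MeasurableSpace α] {μ : Measure α}
    [NormedAddCommGroup F] {p : ℕ → α → ℝ} {q : α → ℝ} {f : ℕ → α → F} {g : α → F} {C : ℝ} (hC : 0 ≤ C)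
    (hp : ∀ k, Integrable (p k) μ) (hq : Integrable q μ)
    (hle : ∀ k x, ‖p k x - q x‖ ≤ C * ‖f k x - g x‖)
    (h : Tendsto (fun k => ∫⁻ x, ‖f k x - g x‖ₑ ∂μ) atTop (𝓝 0)) :
    Tendsto (fun k => ∫ x, p k x ∂μ) atTop (𝓝 (∫ x, q x ∂μ)) := by
  refine tendsto_integral_of_L1 q hq.1 (Eventually.of_forall hp) ?_
  have h2 : Tendsto (fun k => ENNReal.ofReal C * ∫⁻ x, ‖f k x - g x‖ₑ ∂μ) atTop (𝓝 0) := by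
    simpa using ENNReal.Tendsto.const_mul h (Or.inr ENNReal.ofReal_ne_top)
  refine tendsto_of_tendsto_of_tendsto_of_le_of_le tendsto_const_nhds h2 (fun _ => zero_le)
    fun k => ?_
  rw [← lintegral_const_mul' _ _ ENNReal.ofReal_ne_top]
  refine lintegral_mono fun x => ?_
  have := hle k x
  rw [← ofReal_norm, ← ofReal_norm, ← ENNReal.ofReal_mul hC]
  exact ENNReal.ofReal_le_ofReal this

/-! ### Distributional gradients on the whole space: product rule, convolution, chain rule. -/

section WeakGradient

variable {E : Type*} [NormedAddCommGroup E] [InnerProductSpace ℝ E] [FiniteDimensional ℝ E]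
  [MeasureSpace E] [BorelSpace E] [(volume : Measure E).IsAddHaarMeasure]

/-- `G` is the distributional gradient of the scalar function `g` on the whole space, both being
integrable. -/
structure HasIntegrableGradient (g : E → ℝ) (G : E → E) : Prop where
  integrable : Integrable g
  integrable_gradient : Integrable G
  integral_eq : ∀ η : E → ℝ, ContDiff ℝ ∞ η → HasCompactSupport η → ∀ v : E,
    ∫ x, g x * fderiv ℝ η x v = -∫ x, inner ℝ (G x) v * η x

theorem continuous_fderiv_apply_const {η : E → ℝ} (hη : ContDiff ℝ ∞ η) (v : E) :
    Continuous (fun x => fderiv ℝ η x v) :=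
  (hη.continuous_fderiv (by simp)).clm_apply continuous_const

theorem integrable_mul_of_compactSupport {f b : E → ℝ} (hf : Integrable f) (hb : Continuous b)
    (hc : HasCompactSupport b) : Integrable (fun x => f x * b x) := by
  obtain ⟨C, hC⟩ := hb.bounded_above_of_compact_support hc
  exact hf.mul_bdd (c := C) hb.aestronglyMeasurable (ae_of_all _ hC)

theorem integrable_smul_of_compactSupport {F : Type*} [NormedAddCommGroup F] [NormedSpace ℝ F]
    {f : E → F} {b : E → ℝ} (hf : Integrable f) (hb : Continuous b)
    (hc : HasCompactSupport b) : Integrable (fun x => b x • f x) := by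
  obtain ⟨C, hC⟩ := hb.bounded_above_of_compact_support hc
  exact hf.bdd_smul C hb.aestronglyMeasurable (ae_of_all _ hC)

theorem continuous_gradient {θ : E → ℝ} (hθ : ContDiff ℝ ∞ θ) : Continuous (gradient θ) :=
  (InnerProductSpace.toDual ℝ E).symm.continuous.comp (hθ.continuous_fderiv (by simp))

theorem norm_gradient (θ : E → ℝ) (x : E) : ‖gradient θ x‖ = ‖fderiv ℝ θ x‖ :=
  (InnerProductSpace.toDual ℝ E).symm.norm_map _

theorem HasCompactSupport.gradient {θ : E → ℝ} (hc : HasCompactSupport θ) :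
    HasCompactSupport (gradient θ) :=
  (hc.fderiv ℝ).comp_left (g := (InnerProductSpace.toDual ℝ E).symm) (by simp)

theorem HasIntegrableGradient.mul {g : E → ℝ} {G : E → E} (h : HasIntegrableGradient g G)
    {θ : E → ℝ} (hθ : ContDiff ℝ ∞ θ) (hc : HasCompactSupport θ) :
    HasIntegrableGradient (fun x => θ x * g x) (fun x => θ x • G x + g x • gradient θ x) := by
  have i1 : Integrable (fun x => θ x * g x) := by
    simpa [mul_comm] using integrable_mul_of_compactSupport h.integrable hθ.continuous hc
  have i2 : Integrable (fun x => θ x • G x) :=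
    integrable_smul_of_compactSupport h.integrable_gradient hθ.continuous hc
  have i3 : Integrable (fun x => g x • gradient θ x) := by
    obtain ⟨C, hC⟩ := (continuous_gradient hθ).bounded_above_of_compact_support hc.gradient
    exact h.integrable.smul_bdd C (continuous_gradient hθ).aestronglyMeasurable (ae_of_all _ hC)
  refine ⟨i1, i2.add i3, fun η hη hηc v => ?_⟩
  have key := h.integral_eq (fun x => θ x * η x) (hθ.mul hη) hηc.mul_left v
  have hfd : ∀ x, fderiv ℝ (fun x => θ x * η x) x v
      = θ x * fderiv ℝ η x v + η x * fderiv ℝ θ x v := by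
    intro x
    have := ((hθ.differentiable (by simp) x).hasFDerivAt.mul
      (hη.differentiable (by simp) x).hasFDerivAt).fderiv
    change fderiv ℝ (θ * η) x v = _
    rw [this]
    simp
  have j1 : Integrable (fun x => θ x * g x * fderiv ℝ η x v) :=
    integrable_mul_of_compactSupport i1 (continuous_fderiv_apply_const hη v)
      (hηc.fderiv_apply ℝ v)
  have j2 : Integrable (fun x => g x * (η x * fderiv ℝ θ x v)) :=
    integrable_mul_of_compactSupport h.integrable
      (hη.continuous.mul (continuous_fderiv_apply_const hθ v)) hηc.mul_right
  have j3 : Integrable (fun x => inner ℝ (G x) v * (θ x * η x)) :=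
    integrable_mul_of_compactSupport (h.integrable_gradient.inner_const v)
      (hθ.continuous.mul hη.continuous) hηc.mul_left
  have e1 : ∫ x, g x * fderiv ℝ (fun x => θ x * η x) x v
      = (∫ x, θ x * g x * fderiv ℝ η x v) + ∫ x, g x * (η x * fderiv ℝ θ x v) := by
    rw [← integral_add j1 j2]
    refine integral_congr_ae (ae_of_all _ fun x => ?_)
    simp only [hfd]; ring
  have e2 : ∫ x, inner ℝ (θ x • G x + g x • gradient θ x) v * η x
      = (∫ x, inner ℝ (G x) v * (θ x * η x)) + ∫ x, g x * (η x * fderiv ℝ θ x v) := by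
    rw [← integral_add j3 j2]
    refine integral_congr_ae (ae_of_all _ fun x => ?_)
    simp only [inner_add_left, real_inner_smul_left, inner_gradient_left]; ring
  rw [e2]
  linarith

theorem inner_integral_kernel {κ : E → ℝ} (hκ : Continuous κ) (hc : HasCompactSupport κ)
    {G : E → E} (hG : Integrable G) (x v : E) :
    inner ℝ (mollify κ G x) v = ∫ y, inner ℝ (G y) v * κ (x - y) := by
  rw [mollify, real_inner_comm, ← integral_inner (integrable_kernel_smul hκ hc hG x)]
  refine integral_congr_ae (ae_of_all _ fun y => ?_)
  simp only [inner_smul_right, real_inner_comm v]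
  ring

/-- For fixed `x` the reflected kernel `y ↦ κ (x - y)` is itself a test function; the sign from the
reflection cancels the one in the weak formulation. -/
theorem HasIntegrableGradient.gradient_mollify {g : E → ℝ} {G : E → E}
    (h : HasIntegrableGradient g G) {κ : E → ℝ} (hκ : ContDiff ℝ ∞ κ) (hc : HasCompactSupport κ)
    (x : E) : gradient (mollify κ g) x = mollify κ G x := by
  refine ext_inner_right ℝ fun v => ?_
  rw [inner_gradient_left, inner_integral_kernel hκ.continuous hc h.integrable_gradient,
    fderiv_mollify_apply hκ hc h.integrable]
  have hη : ContDiff ℝ ∞ (fun y => κ (x - y)) := hκ.comp (contDiff_const.sub contDiff_id)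
  have hηc : HasCompactSupport (fun y => κ (x - y)) :=
    hc.comp_homeomorph (Homeomorph.subLeft x)
  have key := h.integral_eq _ hη hηc v
  have hfd : ∀ y, fderiv ℝ (fun y => κ (x - y)) y v = - fderiv ℝ κ (x - y) v := by
    intro y
    have h1 := ((hκ.differentiable (by simp) (x - y)).hasFDerivAt.comp y
      ((hasFDerivAt_id y).const_sub x)).fderiv
    change fderiv ℝ (κ ∘ HSub.hSub x) y v = _
    rw [h1]
    simp
  simp_rw [hfd] at key
  rw [← neg_inj, ← key, ← integral_neg]
  refine integral_congr_ae (ae_of_all _ fun y => ?_)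
  simp only [smul_eq_mul]; ring

/-- Since `∇κ` has mean zero, `g y` may be replaced by `g y - g x`, which is at most `H` wherever
`∇κ (x - y)` is nonzero. -/
theorem norm_gradient_mollify_le {g : E → ℝ} (hg : Integrable g) {κ : E → ℝ} {s : Set E}
    (hκ : IsMollifier κ s) (hs : IsClosed s) {x : E} {H : ℝ} (hH : 0 ≤ H)
    (hosc : ∀ y, x - y ∈ s → |g y - g x| ≤ H) (hi : Integrable (fun z => ‖fderiv ℝ κ z‖)) :
    ‖gradient (mollify κ g) x‖ ≤ H * ∫ z, ‖fderiv ℝ κ z‖ := by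
  have hnn : 0 ≤ H * ∫ z, ‖fderiv ℝ κ z‖ := mul_nonneg hH (integral_nonneg fun _ => norm_nonneg _)
  rw [norm_gradient]
  refine ContinuousLinearMap.opNorm_le_bound _ hnn fun v => ?_
  rw [fderiv_mollify_apply hκ.contDiff hκ.hasCompactSupport hg]
  have z1 : ∫ y, fderiv ℝ κ (x - y) v = 0 := by
    rw [integral_sub_left_eq_self (fun z => fderiv ℝ κ z v) volume x,
      integral_fderiv_kernel_eq_zero hκ.contDiff hκ.hasCompactSupport]
  have hint : Integrable (fun y => fderiv ℝ κ (x - y) v) := by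
    have := ((continuous_fderiv_apply_const hκ.contDiff v).integrable_of_hasCompactSupport
      (μ := volume) (hκ.hasCompactSupport.fderiv_apply ℝ v)).comp_sub_left x
    exact this
  have e1 : ∫ y, fderiv ℝ κ (x - y) v • g y = ∫ y, fderiv ℝ κ (x - y) v * (g y - g x) := by
    simp_rw [mul_sub]
    rw [integral_sub, integral_mul_const, z1, zero_mul, sub_zero]
    · rfl
    · exact integrable_fderiv_kernel_smul hκ.contDiff hκ.hasCompactSupport hg x v
    · exact hint.mul_const _
  rw [e1]
  have hsupp : ∀ z, z ∉ s → fderiv ℝ κ z = 0 := by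
    intro z hz
    have h1 : tsupport κ ⊆ s := closure_minimal
      (fun w hw => by by_contra hws; exact hw (hκ.eq_zero w hws)) hs
    exact fderiv_of_notMem_tsupport ℝ fun hz' => hz (h1 hz')
  calc ‖∫ y, fderiv ℝ κ (x - y) v * (g y - g x)‖
      ≤ ∫ y, ‖fderiv ℝ κ (x - y)‖ * (‖v‖ * H) := by
        refine norm_integral_le_of_norm_le ((hi.comp_sub_left x).mul_const _)
          (ae_of_all _ fun y => ?_)
        by_cases hy : x - y ∈ s
        · rw [norm_mul, ← mul_assoc]
          exact mul_le_mul ((fderiv ℝ κ (x - y)).le_opNorm v) (hosc y hy) (norm_nonneg _)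
            (by positivity)
        · simp [hsupp _ hy]
    _ = H * (∫ z, ‖fderiv ℝ κ z‖) * ‖v‖ := by
        rw [integral_mul_const,
          integral_sub_left_eq_self (fun z => ‖fderiv ℝ κ z‖) volume x]
        ring

theorem exists_seq_isMollifier (E : Type*) [NormedAddCommGroup E] [InnerProductSpace ℝ E]
    [FiniteDimensional ℝ E] [MeasureSpace E] [BorelSpace E]
    [(volume : Measure E).IsAddHaarMeasure] :
    ∃ (κ : ℕ → E → ℝ) (s : ℕ → Set E), (∀ k, IsMollifier (κ k) (s k)) ∧
      Tendsto s atTop (𝓝 0).smallSets := by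
  obtain ⟨D, -, h⟩ := exists_isMollifier (0 : E) one_pos
  choose κ hκ using fun k : ℕ => h (1 / (k + 1)) Nat.one_div_pos_of_nat
  refine ⟨κ, _, fun k => (hκ k).1, ?_⟩
  rw [(Metric.nhds_basis_closedBall).smallSets.tendsto_right_iff]
  intro ε hε
  filter_upwards [(tendsto_one_div_add_atTop_nhds_zero_nat (𝕜 := ℝ)).eventually_lt_const hε]
    with k hk
  rw [smul_zero, one_mul]
  exact Metric.closedBall_subset_closedBall hk.le

/-- The chain rule for distributional gradients. -/
theorem HasIntegrableGradient.comp {g : E → ℝ} {G : E → E} (h : HasIntegrableGradient g G)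
    {T : ℝ → ℝ} (hT : ContDiff ℝ ∞ T) (hT0 : T 0 = 0) {C : ℝ≥0} (hC : ∀ s, |deriv T s| ≤ C) :
    HasIntegrableGradient (fun x => T (g x)) (fun x => deriv T (g x) • G x) := by
  have hlip : ∀ a b, |T a - T b| ≤ C * |a - b| := fun a b =>
    convex_univ.norm_image_sub_le_of_norm_deriv_le (f := T) (C := C) (x := b) (y := a)
      (fun x _ => hT.differentiable (by simp) x) (fun x _ => hC x) (mem_univ _) (mem_univ _)
  have hdc : Continuous (deriv T) := hT.continuous_deriv (by simp)
  have iT : Integrable (fun x => T (g x)) := by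
    refine (h.integrable.norm.const_mul (C : ℝ)).mono'
      (hT.continuous.comp_aestronglyMeasurable h.integrable.1) (ae_of_all _ fun x => ?_)
    simpa [hT0] using hlip (g x) 0
  have iG : Integrable (fun x => deriv T (g x) • G x) :=
    h.integrable_gradient.bdd_smul (C : ℝ) (hdc.comp_aestronglyMeasurable h.integrable.1)
      (ae_of_all _ fun x => hC _)
  refine ⟨iT, iG, fun η hη hηc v => ?_⟩
  obtain ⟨κ, s, hκ, hs⟩ := exists_seq_isMollifier E
  have c1 := tendsto_lintegral_mollify_sub hκ hs h.integrable
  have c2 := tendsto_lintegral_mollify_sub hκ hs h.integrable_gradient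
  have sm : ∀ k, ContDiff ℝ ∞ (mollify (κ k) g) := fun k =>
    contDiff_mollify (hκ k).contDiff (hκ k).hasCompactSupport h.integrable
  have smG : ∀ k, ContDiff ℝ ∞ (mollify (κ k) G) := fun k =>
    contDiff_mollify (hκ k).contDiff (hκ k).hasCompactSupport h.integrable_gradient
  -- `L¹` convergence of the mollified functions does not give pointwise convergence of `deriv T`
  -- along them; a subsequence does.
  obtain ⟨ns, hns, hae⟩ := exists_subseq_tendsto_ae_of_lintegral
    (fun k => (sm k).continuous.aestronglyMeasurable) h.integrable.1 c1
  have c1' := c1.comp hns.tendsto_atTop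
  have c2' := c2.comp hns.tendsto_atTop
  obtain ⟨Cη, hCη⟩ := hη.continuous.bounded_above_of_compact_support hηc
  obtain ⟨Cd, hCd⟩ := (continuous_fderiv_apply_const hη v).bounded_above_of_compact_support
    (hηc.fderiv_apply ℝ v)
  have hCη0 : 0 ≤ Cη := (norm_nonneg _).trans (hCη 0)
  have hCd0 : 0 ≤ Cd := (norm_nonneg _).trans (hCd 0)
  have hcl : ∀ k, ContDiff ℝ ∞ (fun x => T (mollify (κ k) g x)) := fun k => hT.comp (sm k)
  have ibp : ∀ k, ∫ x, T (mollify (κ k) g x) * fderiv ℝ η x v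
      = -∫ x, deriv T (mollify (κ k) g x) * inner ℝ (mollify (κ k) G x) v * η x := by
    intro k
    have hfd : ∀ x, fderiv ℝ (fun x => T (mollify (κ k) g x)) x v
        = deriv T (mollify (κ k) g x) * inner ℝ (mollify (κ k) G x) v := by
      intro x
      have h1 := ((hT.differentiable (by simp) _).hasDerivAt.comp_hasFDerivAt x
        ((sm k).differentiable (by simp) x).hasFDerivAt).fderiv
      change fderiv ℝ (T ∘ mollify (κ k) g) x v = _
      rw [h1, ← h.gradient_mollify (hκ k).contDiff (hκ k).hasCompactSupport x,
        inner_gradient_left]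
      rfl
    have := integral_mul_fderiv_eq_neg_fderiv_mul_of_integrable (μ := (volume : Measure E))
      (f := fun x => T (mollify (κ k) g x)) (g := η) (v := v)
      (((continuous_fderiv_apply_const (hcl k) v).mul
        hη.continuous).integrable_of_hasCompactSupport hηc.mul_left)
      (((hcl k).continuous.mul (continuous_fderiv_apply_const hη v)).integrable_of_hasCompactSupport
        (hηc.fderiv_apply ℝ v).mul_left)
      (((hcl k).continuous.mul hη.continuous).integrable_of_hasCompactSupport hηc.mul_left)
      (fun x _ => (hcl k).differentiable (by simp) x)
      (fun x _ => hη.differentiable (by simp) x)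
    simp_rw [hfd] at this
    exact this
  have l1 : Tendsto (fun k => ∫ x, T (mollify (κ (ns k)) g x) * fderiv ℝ η x v) atTop
      (𝓝 (∫ x, T (g x) * fderiv ℝ η x v)) := by
    refine tendsto_integral_of_norm_sub_le (mul_nonneg C.coe_nonneg hCd0) (fun k => ?_)
      (integrable_mul_of_compactSupport iT (continuous_fderiv_apply_const hη v)
        (hηc.fderiv_apply ℝ v)) (fun k x => ?_) c1'
    · exact ((hcl _).continuous.mul
        (continuous_fderiv_apply_const hη v)).integrable_of_hasCompactSupport
        (hηc.fderiv_apply ℝ v).mul_left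
    · rw [← sub_mul, norm_mul, mul_right_comm]
      exact mul_le_mul (hlip _ _) (hCd x) (norm_nonneg _) (by positivity)
  -- The product of two varying factors is split: here the gradient error goes to zero against a
  -- bounded factor, and in `l3` the gradient is fixed and dominated convergence applies.
  have l2 : Tendsto (fun k => ∫ x, deriv T (mollify (κ (ns k)) g x) *
        inner ℝ (mollify (κ (ns k)) G x - G x) v * η x) atTop (𝓝 (∫ x : E, (0 : ℝ))) := by
    refine tendsto_integral_of_norm_sub_le (C := C * ‖v‖ * Cη) (by positivity) (fun k => ?_)
      (integrable_zero _ _ _) (fun k x => ?_) c2'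
    · have : Integrable (fun x => deriv T (mollify (κ (ns k)) g x) *
          inner ℝ (mollify (κ (ns k)) G x) v * η x -
          (deriv T (mollify (κ (ns k)) g x) * η x) * inner ℝ (G x) v) := by
        refine Integrable.sub ?_ ?_
        · exact (((hdc.comp (sm _).continuous).mul
            ((smG _).continuous.inner continuous_const)).mul
            hη.continuous).integrable_of_hasCompactSupport hηc.mul_left
        · have := integrable_mul_of_compactSupport (h.integrable_gradient.inner_const v)
            ((hdc.comp (sm (ns k)).continuous).mul hη.continuous) hηc.mul_left
          simpa [mul_comm] using this
      refine this.congr (ae_of_all _ fun x => ?_)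
      simp only [inner_sub_left]; ring
    · rw [sub_zero, norm_mul, norm_mul]
      calc _ ≤ (C : ℝ) * (‖mollify (κ (ns k)) G x - G x‖ * ‖v‖) * Cη := by
            gcongr
            · exact hC _
            · exact norm_inner_le_norm _ _
            · exact hCη x
        _ = _ := by ring
  have l3 : Tendsto (fun k => ∫ x, deriv T (mollify (κ (ns k)) g x) * inner ℝ (G x) v * η x) atTop
      (𝓝 (∫ x, deriv T (g x) * inner ℝ (G x) v * η x)) := by
    refine tendsto_integral_of_dominated_convergence (fun x => C * (‖G x‖ * ‖v‖) * Cη)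
      (fun k => ?_) (((h.integrable_gradient.norm.mul_const _).const_mul _).mul_const _)
      (fun k => ae_of_all _ fun x => ?_) ?_
    · exact (((hdc.comp (sm _).continuous).aestronglyMeasurable.mul
        (h.integrable_gradient.inner_const v).1).mul hη.continuous.aestronglyMeasurable)
    · rw [norm_mul, norm_mul]
      gcongr
      · exact hC _
      · exact norm_inner_le_norm _ _
      · exact hCη x
    · filter_upwards [hae] with x hx
      exact (((hdc.tendsto _).comp hx).mul_const _).mul_const _
  have l4 : Tendsto (fun k => -∫ x, deriv T (mollify (κ (ns k)) g x) *
      inner ℝ (mollify (κ (ns k)) G x) v * η x) atTop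
      (𝓝 (-∫ x, deriv T (g x) * inner ℝ (G x) v * η x)) := by
    refine Tendsto.neg ?_
    have := l2.add l3
    rw [integral_zero, zero_add] at this
    refine this.congr fun k => ?_
    rw [← integral_add]
    · refine integral_congr_ae (ae_of_all _ fun x => ?_)
      simp only [inner_sub_left]; ring
    · have : Integrable (fun x => deriv T (mollify (κ (ns k)) g x) *
          inner ℝ (mollify (κ (ns k)) G x) v * η x -
          (inner ℝ (G x) v) * (deriv T (mollify (κ (ns k)) g x) * η x)) := by
        refine Integrable.sub ?_ ?_
        · exact (((hdc.comp (sm _).continuous).mul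
            ((smG _).continuous.inner continuous_const)).mul
            hη.continuous).integrable_of_hasCompactSupport hηc.mul_left
        · exact integrable_mul_of_compactSupport (h.integrable_gradient.inner_const v)
            ((hdc.comp (sm (ns k)).continuous).mul hη.continuous) hηc.mul_left
      refine this.congr (ae_of_all _ fun x => ?_)
      simp only [inner_sub_left]; ring
    · have := integrable_mul_of_compactSupport (h.integrable_gradient.inner_const v)
        ((hdc.comp (sm (ns k)).continuous).mul hη.continuous) hηc.mul_left
      refine this.congr (ae_of_all _ fun x => ?_)
      simp only [Pi.mul_apply, Function.comp]; ring
  have := tendsto_nhds_unique (l1.congr fun k => ibp (ns k)) l4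
  rw [this]
  simp_rw [real_inner_smul_left]

end WeakGradient

/-! ### Interior translations and exterior points of Lipschitz domains. -/

section DomainGeometry

variable {E : Type*} [NormedAddCommGroup E] [InnerProductSpace ℝ E]

theorem norm_sub_inner_smul_le {ν : E} (hν : ‖ν‖ = 1) (e : E) :
    ‖e - (inner ℝ ν e) • ν‖ ≤ 2 * ‖e‖ := by
  have h1 : ‖inner ℝ ν e‖ ≤ ‖e‖ := by simpa [hν] using norm_inner_le_norm (𝕜 := ℝ) ν e
  calc ‖e - (inner ℝ ν e) • ν‖ ≤ ‖e‖ + ‖(inner ℝ ν e) • ν‖ := norm_sub_le _ _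
    _ ≤ ‖e‖ + ‖e‖ := by rw [norm_smul, hν, mul_one]; linarith
    _ = 2 * ‖e‖ := by ring

/-- The uniform interior cone property: near every point of its closure, a Lipschitz domain can be
translated into itself, with room to spare. -/
theorem IsBoundedLipschitzDomain.exists_translation {Ω : Set E} (hΩ : IsBoundedLipschitzDomain Ω)
    {z : E} (hz : z ∈ closure Ω) :
    ∃ (ν : E) (a ρ t₀ : ℝ), ‖ν‖ ≤ 1 ∧ 0 < a ∧ a ≤ 1 ∧ 0 < ρ ∧ 0 < t₀ ∧
      ∀ y ∈ closure Ω, y ∈ Metric.ball z ρ → ∀ t, 0 < t → t < t₀ →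
        Metric.closedBall (y + t • ν) (a * t) ⊆ Ω := by
  obtain ⟨hopen, -, -, hloc⟩ := hΩ
  by_cases hzΩ : z ∈ Ω
  · obtain ⟨ε, hε, hball⟩ := Metric.isOpen_iff.1 hopen z hzΩ
    refine ⟨0, 1, ε / 2, ε / 2, by simp, one_pos, le_rfl, by positivity, by positivity, ?_⟩
    intro y _ hy t ht htt w hw
    refine hball ?_
    rw [smul_zero, add_zero, one_mul, Metric.mem_closedBall] at hw
    rw [Metric.mem_ball] at hy ⊢
    linarith [dist_triangle w y z]
  · have hfr : z ∈ frontier Ω := ⟨hz, by rwa [hopen.interior_eq]⟩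
    obtain ⟨ν, hν, K, g, hg, U, hU, hUg⟩ := hloc z hfr
    obtain ⟨ε, hε, hball⟩ := Metric.mem_nhds_iff.1 hU
    have hK : (0 : ℝ) ≤ K := K.coe_nonneg
    -- A perturbation `e` changes the graph height by at most `2 * K * ‖e‖` and lowers the vertical
    -- coordinate by at most `‖e‖`. The gain `t` beats both as soon as `(2 * K + 1) * ‖e‖ < t`.
    set a : ℝ := 1 / (2 * K + 2) with ha
    have ha0 : 0 < a := by positivity
    have ha1 : a ≤ 1 := by rw [ha, div_le_one (by positivity)]; linarith
    have haK : a * (2 * K + 2) = 1 := by rw [ha]; field_simp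
    refine ⟨ν, a, ε / 2, ε / 4, hν.le, ha0, ha1, by positivity, by positivity, ?_⟩
    intro y hy hyz t ht htt w hw
    rw [Metric.mem_ball, dist_eq_norm] at hyz
    rw [Metric.mem_closedBall, dist_eq_norm] at hw
    have hat : a * t ≤ t := by nlinarith
    -- On the closure only the non-strict graph inequality survives; the translation makes it strict
    -- again.
    have hycl : g (y - (inner ℝ ν y) • ν) ≤ inner ℝ ν y := by
      have hc1 : Continuous fun x : E => g (x - (inner ℝ ν x) • ν) :=
        hg.continuous.comp (by fun_prop)
      have hc2 : Continuous fun x : E => inner ℝ ν x := by fun_prop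
      have hB : y ∈ closure (Ω ∩ Metric.ball z ε) := by
        refine closure_mono (s := Metric.ball z ε ∩ Ω) (by rw [inter_comm]) ?_
        exact Metric.isOpen_ball.inter_closure
          ⟨by rw [Metric.mem_ball, dist_eq_norm]; linarith, hy⟩
      refine closure_minimal ?_ (isClosed_le hc1 hc2) hB
      intro x hx
      exact ((hUg x (hball hx.2)).1 hx.1).le
    obtain ⟨e, rfl⟩ : ∃ e, w = y + t • ν + e := ⟨w - (y + t • ν), by abel⟩
    rw [add_sub_cancel_left] at hw
    have hwU : y + t • ν + e ∈ U := by
      refine hball ?_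
      rw [Metric.mem_ball, dist_eq_norm]
      have h1 : y + t • ν + e - z = (y - z) + t • ν + e := by abel
      have h2 : ‖t • ν‖ = t := by rw [norm_smul, hν, mul_one, Real.norm_of_nonneg ht.le]
      rw [h1]
      have h3 := norm_add_le ((y - z) + t • ν) e
      have h4 := norm_add_le (y - z) (t • ν)
      linarith
    rw [hUg _ hwU]
    have hνν : inner ℝ ν ν = 1 := by rw [real_inner_self_eq_norm_sq, hν, one_pow]
    have hin : inner ℝ ν (y + t • ν + e) = inner ℝ ν y + t + inner ℝ ν e := by
      rw [inner_add_right, inner_add_right, inner_smul_right, hνν, mul_one]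
    have hpr : y + t • ν + e - (inner ℝ ν (y + t • ν + e)) • ν
        = (y - (inner ℝ ν y) • ν) + (e - (inner ℝ ν e) • ν) := by
      rw [hin]; module
    rw [hpr, hin]
    have hl := hg.dist_le_mul ((y - (inner ℝ ν y) • ν) + (e - (inner ℝ ν e) • ν))
      (y - (inner ℝ ν y) • ν)
    rw [dist_eq_norm, dist_eq_norm, add_sub_cancel_left, Real.norm_eq_abs] at hl
    have hl2 := (abs_le.1 hl).2
    have hp := norm_sub_inner_smul_le hν e
    have hie : -‖e‖ ≤ inner ℝ ν e := by
      have : |inner ℝ ν e| ≤ ‖e‖ := by simpa [hν] using abs_real_inner_le_norm ν e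
      exact (abs_le.1 this).1
    have hstrict : (2 * K + 1) * ‖e‖ < t := by
      have : (2 * K + 1) * ‖e‖ ≤ (2 * K + 1) * (a * t) := by gcongr
      nlinarith
    nlinarith [mul_le_mul_of_nonneg_left hp hK]

/-- Moving from a boundary point in the direction `-ν` leaves the graph value unchanged and falls
strictly below it, while points of the closure satisfy the non-strict inequality. So the domain has
true exterior near each boundary point. -/
theorem IsBoundedLipschitzDomain.exists_notMem_closure {Ω : Set E}
    (hΩ : IsBoundedLipschitzDomain Ω) {z : E} (hz : z ∈ frontier Ω) {ρ : ℝ} (hρ : 0 < ρ) :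
    ∃ p ∈ Metric.ball z ρ, p ∉ closure Ω := by
  obtain ⟨hopen, -, -, hloc⟩ := hΩ
  obtain ⟨ν, hν, K, g, hg, U, hU, hUg⟩ := hloc z hz
  obtain ⟨ε, hε, hball⟩ := Metric.mem_nhds_iff.1 hU
  have hzU : z ∉ Ω := by have := hz.2; rwa [hopen.interior_eq] at this
  have hz' : inner ℝ ν z ≤ g (z - (inner ℝ ν z) • ν) :=
    not_lt.1 fun h => hzU ((hUg z (mem_of_mem_nhds hU)).2 h)
  set s : ℝ := min ρ ε / 2 with hs
  have hs0 : 0 < s := by positivity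
  have hsρ : s < ρ := by have := min_le_left ρ ε; linarith
  have hsε : s < ε := by have := min_le_right ρ ε; linarith
  have hd : dist (z - s • ν) z = s := by
    rw [dist_eq_norm, sub_sub_cancel_left, norm_neg, norm_smul, hν, mul_one,
      Real.norm_of_nonneg hs0.le]
  refine ⟨z - s • ν, by rw [Metric.mem_ball, hd]; exact hsρ, fun hcl => ?_⟩
  have hνν : inner ℝ ν ν = 1 := by rw [real_inner_self_eq_norm_sq, hν, one_pow]
  have hc1 : Continuous fun x : E => g (x - (inner ℝ ν x) • ν) :=
    hg.continuous.comp (by fun_prop)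
  have hc2 : Continuous fun x : E => inner ℝ ν x := by fun_prop
  have hB : z - s • ν ∈ closure (Metric.ball z ε ∩ Ω) :=
    Metric.isOpen_ball.inter_closure ⟨by rw [Metric.mem_ball, hd]; exact hsε, hcl⟩
  have hle : z - s • ν ∈ {x : E | g (x - (inner ℝ ν x) • ν) ≤ inner ℝ ν x} :=
    closure_minimal (fun x hx => ((hUg x (hball hx.1)).1 hx.2).le) (isClosed_le hc1 hc2) hB
  rw [mem_ofPred_eq] at hle
  have hin : inner ℝ ν (z - s • ν) = inner ℝ ν z - s := by
    rw [inner_sub_right, inner_smul_right, hνν, mul_one]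
  have hpr : z - s • ν - (inner ℝ ν (z - s • ν)) • ν = z - (inner ℝ ν z) • ν := by
    rw [hin]; module
  rw [hpr, hin] at hle
  linarith

end DomainGeometry

/-! ### Zero boundary values: no jumps, and Hölder continuity of the zero extension. -/

section BoundaryValues

variable {E : Type*} [NormedAddCommGroup E] [InnerProductSpace ℝ E] [FiniteDimensional ℝ E]
  [MeasureSpace E] [BorelSpace E] [(volume : Measure E).IsAddHaarMeasure]

/-- A function with integrable distributional gradient cannot jump from zero to values bounded
away from zero across the boundary of an open set. -/
theorem HasIntegrableGradient.not_forall_le {g : E → ℝ} {G : E → E}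
    (h : HasIntegrableGradient g G) {Ω : Set E} (hΩ : IsOpen Ω) (hg0 : ∀ x, x ∉ Ω → g x = 0)
    (hG0 : ∀ x, x ∉ Ω → G x = 0) {z : E} {ρ a : ℝ} (ha : 0 < a) {p q : E}
    (hp : p ∈ Metric.ball z ρ) (hpΩ : p ∈ Ω) (hq : q ∈ Metric.ball z ρ) (hqΩ : q ∉ closure Ω) :
    ¬ ∀ y ∈ Ω, y ∈ Metric.ball z ρ → a ≤ g y := by
  intro hle
  -- `T` is `0` for `s ≤ 0` and `1` for `s ≥ a / 2`. If `g` took only the value `0` and values at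
  -- least `a` in the ball, `T ∘ g` would be a two-valued function there with vanishing gradient.
  let T : ℝ → ℝ := fun s => Real.smoothTransition (2 / a * s)
  have hT : ContDiff ℝ ∞ T := Real.smoothTransition.contDiff.comp (contDiff_const.mul contDiff_id)
  have hT0 : ∀ s ≤ 0, T s = 0 := fun s hs =>
    Real.smoothTransition.zero_of_nonpos (mul_nonpos_of_nonneg_of_nonpos (by positivity) hs)
  have hT1 : ∀ s, a / 2 ≤ s → T s = 1 := fun s hs =>
    Real.smoothTransition.one_of_one_le (by
      calc 1 = 2 / a * (a / 2) := by field_simp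
        _ ≤ _ := by gcongr)
  have hd1 : ∀ s, a / 2 < s → deriv T s = 0 := by
    intro s hs
    have : T =ᶠ[𝓝 s] fun _ => 1 := by
      filter_upwards [lt_mem_nhds hs] with r hr using hT1 r hr.le
    rw [this.deriv_eq, deriv_const]
  have hd0 : ∀ s, s < 0 → deriv T s = 0 := by
    intro s hs
    have : T =ᶠ[𝓝 s] fun _ => 0 := by
      filter_upwards [gt_mem_nhds hs] with r hr using hT0 r hr.le
    rw [this.deriv_eq, deriv_const]
  obtain ⟨C, hC⟩ : ∃ C : ℝ≥0, ∀ s, |deriv T s| ≤ C := by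
    have hsupp : HasCompactSupport (deriv T) := by
      refine HasCompactSupport.intro (isCompact_Icc (a := (0 : ℝ)) (b := a / 2)) fun s hs => ?_
      rw [mem_Icc, not_and_or, not_le, not_le] at hs
      exact hs.elim (hd0 s) (hd1 s)
    obtain ⟨C, hC⟩ := (hT.continuous_deriv (by simp)).bounded_above_of_compact_support hsupp
    exact ⟨⟨C, (norm_nonneg _).trans (hC 0)⟩, hC⟩
  have hTg := h.comp hT (hT0 0 le_rfl) hC
  obtain ⟨δ, hδ, h1, h2, h3, h4⟩ : ∃ δ > 0, Metric.closedBall p δ ⊆ Ω ∩ Metric.ball z ρ ∧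
      Metric.closedBall q δ ⊆ (closure Ω)ᶜ ∧ p ∈ Metric.ball z (ρ - δ) ∧
      q ∈ Metric.ball z (ρ - δ) := by
    have e1 : ∀ᶠ δ in 𝓝[>] (0 : ℝ), Metric.closedBall p δ ⊆ Ω ∩ Metric.ball z ρ := by
      obtain ⟨ε, hε, hb⟩ := Metric.isOpen_iff.1 (hΩ.inter Metric.isOpen_ball) p ⟨hpΩ, hp⟩
      filter_upwards [Ioo_mem_nhdsGT hε] with δ hδ
      exact (Metric.closedBall_subset_ball hδ.2).trans hb
    have e2 : ∀ᶠ δ in 𝓝[>] (0 : ℝ), Metric.closedBall q δ ⊆ (closure Ω)ᶜ := by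
      obtain ⟨ε, hε, hb⟩ := Metric.isOpen_iff.1 isClosed_closure.isOpen_compl q hqΩ
      filter_upwards [Ioo_mem_nhdsGT hε] with δ hδ
      exact (Metric.closedBall_subset_ball hδ.2).trans hb
    have e3 : ∀ x ∈ Metric.ball z ρ, ∀ᶠ δ in 𝓝[>] (0 : ℝ), x ∈ Metric.ball z (ρ - δ) := by
      intro x hx
      rw [Metric.mem_ball] at hx
      filter_upwards [Ioo_mem_nhdsGT (sub_pos.2 hx)] with δ hδ
      rw [Metric.mem_ball]; linarith [hδ.2]
    have e0 : ∀ᶠ δ in 𝓝[>] (0 : ℝ), 0 < δ := self_mem_nhdsWithin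
    obtain ⟨δ, hδ, hall⟩ := (e0.and (e1.and (e2.and ((e3 p hp).and (e3 q hq))))).exists
    exact ⟨δ, hδ, hall⟩
  obtain ⟨D, -, hκ⟩ := exists_isMollifier (0 : E) one_pos
  obtain ⟨κ, hκ, -⟩ := hκ δ hδ
  rw [smul_zero, one_mul] at hκ
  have hdiff : Differentiable ℝ (mollify κ fun x => T (g x)) :=
    (contDiff_mollify hκ.contDiff hκ.hasCompactSupport hTg.integrable).differentiable (by simp)
  -- The weak gradient `deriv T (g y) • G y` vanishes throughout the larger ball: inside the domain
  -- because `g y ≥ a > a / 2`, outside because `G y = 0`. The mollified function is thus constant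
  -- on the smaller ball, but equals `1` at `p` and `0` at `q`.
  have hgrad : ∀ x ∈ Metric.ball z (ρ - δ), fderiv ℝ (mollify κ fun x => T (g x)) x = 0 := by
    intro x hx
    have hz : gradient (mollify κ fun x => T (g x)) x = 0 := by
      rw [hTg.gradient_mollify hκ.contDiff hκ.hasCompactSupport]
      refine integral_eq_zero_of_ae (ae_of_all _ fun y => ?_)
      by_cases hy : x - y ∈ Metric.closedBall (0 : E) δ
      · by_cases hyΩ : y ∈ Ω
        · have hyb : y ∈ Metric.ball z ρ := by
            rw [mem_closedBall_zero_iff] at hy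
            rw [Metric.mem_ball] at hx ⊢
            have := dist_triangle y x z
            rw [dist_comm y x, dist_eq_norm x y] at this
            linarith
          have := hle y hyΩ hyb
          simp [hd1 (g y) (by linarith)]
        · simp [hG0 y hyΩ]
      · simp [hκ.eq_zero _ hy]
    have : ‖fderiv ℝ (mollify κ fun x => T (g x)) x‖ = 0 := by
      rw [← norm_gradient, hz, norm_zero]
    exact norm_eq_zero.1 this
  have hconst : mollify κ (fun x => T (g x)) p = mollify κ (fun x => T (g x)) q :=
    Metric.isOpen_ball.is_const_of_fderiv_eq_zero
      (convex_ball z (ρ - δ)).isPreconnected hdiff.differentiableOn hgrad h3 h4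
  have hval : ∀ (x : E) (c : ℝ), (∀ y ∈ Metric.closedBall x δ, T (g y) = c) →
      mollify κ (fun x => T (g x)) x = c := by
    intro x c hc
    calc mollify κ (fun x => T (g x)) x = ∫ y, κ (x - y) * c := by
          refine integral_congr_ae (ae_of_all _ fun y => ?_)
          by_cases hy : x - y ∈ Metric.closedBall (0 : E) δ
          · have : y ∈ Metric.closedBall x δ := by
              rwa [Metric.mem_closedBall, dist_comm, dist_eq_norm, ← mem_closedBall_zero_iff]
            simp [hc y this]
          · simp [hκ.eq_zero _ hy]
      _ = c := by rw [integral_mul_const, hκ.integral_translate, one_mul]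
  rw [hval p 1 fun y hy => hT1 _ (by
      have := hle y (h1 hy).1 (h1 hy).2
      linarith),
    hval q 0 fun y hy => hT0 _ (hg0 y fun hyΩ => h2 hy (subset_closure hyΩ)).le] at hconst
  exact one_ne_zero hconst

theorem HasIntegrableGradient.neg {g : E → ℝ} {G : E → E} (h : HasIntegrableGradient g G) :
    HasIntegrableGradient (fun x => -g x) (fun x => -G x) := by
  refine ⟨h.integrable.neg, h.integrable_gradient.neg, fun η hη hηc v => ?_⟩
  have := h.integral_eq η hη hηc v
  simp only [neg_mul, integral_neg, inner_neg_left, this]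

/-- The extension by zero of a Hölder function in `W^{1,1}_0` of a Lipschitz domain is Hölder. -/
theorem HasIntegrableGradient.holder_extension {g : E → ℝ} {G : E → E}
    (h : HasIntegrableGradient g G) {Ω : Set E} (hΩ : IsBoundedLipschitzDomain Ω)
    (hg0 : ∀ x, x ∉ Ω → g x = 0) (hG0 : ∀ x, x ∉ Ω → G x = 0) {K γ : ℝ} (hK : 0 ≤ K)
    (hγ : 0 < γ) (hg : ∀ x ∈ Ω, ∀ y ∈ Ω, |g x - g y| ≤ K * ‖x - y‖ ^ γ) (x y : E) :
    |g x - g y| ≤ K * ‖x - y‖ ^ γ := by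
  have hopen := hΩ.1
  have one_sided : ∀ (f : E → ℝ) (F : E → E), HasIntegrableGradient f F →
      (∀ x, x ∉ Ω → f x = 0) → (∀ x, x ∉ Ω → F x = 0) →
      (∀ x ∈ Ω, ∀ y ∈ Ω, |f x - f y| ≤ K * ‖x - y‖ ^ γ) →
      ∀ x ∈ Ω, ∀ z ∈ frontier Ω, f x ≤ K * ‖x - z‖ ^ γ := by
    intro f F hf hf0 hF0 hfK x hx z hz
    by_contra! hcon
    obtain ⟨b, hb1, hb2⟩ := exists_between hcon
    have hcont : ContinuousAt (fun y : E => K * ‖x - y‖ ^ γ) z := by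
      have : Continuous fun y : E => ‖x - y‖ := by fun_prop
      exact ((this.rpow_const fun _ => Or.inr hγ.le).const_mul K).continuousAt
    obtain ⟨ρ, hρ, hball⟩ := Metric.mem_nhds_iff.1 (hcont.eventually_lt_const hb1)
    obtain ⟨q, hq, hqΩ⟩ := hΩ.exists_notMem_closure hz hρ
    obtain ⟨p, hp, hpΩ⟩ := mem_closure_iff_nhds.1 hz.1 _ (Metric.ball_mem_nhds z hρ)
    -- If the bound failed at `z`, the Hölder estimate inside the domain would keep `f` above `f x -
    -- b > 0` at all interior points near `z`: a jump to the zero values outside.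
    refine hf.not_forall_le hopen hf0 hF0 (sub_pos.2 hb2) hp hpΩ hq hqΩ fun w hw hwz => ?_
    have h1 := (abs_le.1 (hfK x hx w hw)).2
    have h2 : K * ‖x - w‖ ^ γ < b := hball hwz
    linarith
  have bdry : ∀ x ∈ Ω, ∀ z ∈ frontier Ω, |g x| ≤ K * ‖x - z‖ ^ γ := by
    intro x hx z hz
    refine abs_le'.2 ⟨one_sided g G h hg0 hG0 hg x hx z hz,
      one_sided _ _ h.neg (fun x hx => by simp [hg0 x hx]) (fun x hx => by simp [hG0 x hx])
        (fun x hx y hy => ?_) x hx z hz⟩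
    rw [neg_sub_neg, abs_sub_comm]
    exact hg x hx y hy
  have mixed : ∀ x ∈ Ω, ∀ y ∉ Ω, |g x| ≤ K * ‖x - y‖ ^ γ := by
    intro x hx y hy
    -- A segment from inside to outside meets the boundary by connectedness, and the crossing point
    -- is no farther from `x` than `y` is.
    obtain ⟨z, hz, hzf⟩ : (segment ℝ x y ∩ frontier Ω).Nonempty := by
      by_contra! hemp
      have hnf : ∀ w ∈ segment ℝ x y, w ∉ frontier Ω := fun w hw hwf =>
        (hemp ▸ (⟨hw, hwf⟩ : w ∈ segment ℝ x y ∩ frontier Ω) : w ∈ (∅ : Set E))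
      rw [hopen.frontier_eq] at hnf
      obtain ⟨w, -, hw, hw'⟩ := (convex_segment x y).isPreconnected Ω (closure Ω)ᶜ hopen
        isClosed_closure.isOpen_compl
        (fun w hw => by
          by_cases hwΩ : w ∈ Ω
          · exact Or.inl hwΩ
          · exact Or.inr fun hcl => hnf w hw ⟨hcl, hwΩ⟩)
        ⟨x, left_mem_segment ℝ x y, hx⟩
        ⟨y, right_mem_segment ℝ x y, fun hcl => hnf y (right_mem_segment ℝ x y) ⟨hcl, hy⟩⟩
      exact hw' (subset_closure hw)
    refine (bdry x hx z hzf).trans ?_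
    gcongr
    have := dist_add_dist_of_mem_segment hz
    rw [dist_eq_norm, dist_eq_norm x y] at this
    linarith [dist_nonneg (x := z) (y := y)]
  by_cases hx : x ∈ Ω <;> by_cases hy : y ∈ Ω
  · exact hg x hx y hy
  · rw [hg0 y hy, sub_zero]; exact mixed x hx y hy
  · rw [hg0 x hx, zero_sub, abs_neg, norm_sub_rev]; exact mixed y hy x hx
  · rw [hg0 x hx, hg0 y hy, sub_self, abs_zero]; positivity

end BoundaryValues

/-! ### Vector-valued maps, zero extension in `W^{1,1}_0`, uniqueness of weak gradients. -/

section VectorValued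

variable {n d : ℕ}

theorem mollify_apply {κ : EuclideanSpace ℝ (Fin n) → ℝ} (hκ : Continuous κ)
    (hc : HasCompactSupport κ) {ι : Type*} [Fintype ι] {F : ι → Type*}
    [∀ i, NormedAddCommGroup (F i)] [∀ i, NormedSpace ℝ (F i)] [∀ i, CompleteSpace (F i)]
    {f : EuclideanSpace ℝ (Fin n) → PiLp 2 F} (hf : Integrable f)
    (x : EuclideanSpace ℝ (Fin n)) (i : ι) :
    mollify κ f x i = mollify κ (fun y => f y i) x := by
  have hint := integrable_kernel_smul hκ hc hf x
  rw [mollify, eval_integral_piLp fun j => hint.eval_piLp j]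
  rfl

theorem gradMap_mollify {ψ : EuclideanSpace ℝ (Fin n) → EuclideanSpace ℝ (Fin d)}
    {ξ : EuclideanSpace ℝ (Fin n) → ColMatrix n d}
    (h : ∀ i, HasIntegrableGradient (fun x => ψ x i) (fun x => ξ x i))
    {κ : EuclideanSpace ℝ (Fin n) → ℝ} (hκ : ContDiff ℝ ∞ κ) (hc : HasCompactSupport κ) :
    gradMap (mollify κ ψ) = mollify κ ξ := by
  have hψ : Integrable ψ := integrable_piLp_iff.2 fun i => (h i).integrable
  have hξ : Integrable ξ := integrable_piLp_iff.2 fun i => (h i).integrable_gradient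
  ext x i : 2
  rw [mollify_apply hκ.continuous hc hξ, ← (h i).gradient_mollify hκ hc x]
  simp only [gradMap]
  congr 1
  ext y
  exact mollify_apply hκ.continuous hc hψ y i

theorem inner_gradMap (u : EuclideanSpace ℝ (Fin n) → EuclideanSpace ℝ (Fin d))
    (x v : EuclideanSpace ℝ (Fin n)) (i : Fin d) :
    inner ℝ (gradMap u x i) v = fderiv ℝ (fun y => u y i) x v := by
  simp only [gradMap]
  rw [inner_gradient_left]

theorem contDiff_apply_piLp {u : EuclideanSpace ℝ (Fin n) → EuclideanSpace ℝ (Fin d)}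
    (hu : ContDiff ℝ ∞ u) (i : Fin d) : ContDiff ℝ ∞ (fun y => u y i) :=
  (contDiff_piLp 2).1 hu i

theorem continuous_gradMap {u : EuclideanSpace ℝ (Fin n) → EuclideanSpace ℝ (Fin d)}
    (hu : ContDiff ℝ ∞ u) : Continuous (gradMap u) := by
  refine (PiLp.continuous_toLp 2 _).comp (continuous_pi fun i => ?_)
  exact continuous_gradient (contDiff_apply_piLp hu i)

theorem gradMap_add {u v : EuclideanSpace ℝ (Fin n) → EuclideanSpace ℝ (Fin d)}
    (hu : ContDiff ℝ ∞ u) (hv : ContDiff ℝ ∞ v) (x : EuclideanSpace ℝ (Fin n)) :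
    gradMap (fun y => u y + v y) x = gradMap u x + gradMap v x := by
  ext i : 1
  refine ext_inner_right ℝ fun w => ?_
  have h1 : HasFDerivAt (fun y => (u y + v y) i) _ x :=
    ((contDiff_apply_piLp hu i).differentiable (by simp) x).hasFDerivAt.add
    ((contDiff_apply_piLp hv i).differentiable (by simp) x).hasFDerivAt
  rw [PiLp.add_apply, inner_add_left, inner_gradMap, inner_gradMap, inner_gradMap, h1.fderiv]
  rfl

/-- Membership in `W^{1,1}_0` is what allows test functions `η` not supported in the domain:
integration by parts has no boundary term for the approximating test maps, and both sides pass to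
the limit in `L¹`. -/
theorem MemW110.exists_hasIntegrableGradient {Ω : Set (EuclideanSpace ℝ (Fin n))}
    (hΩ : IsOpen Ω) {f : EuclideanSpace ℝ (Fin n) → EuclideanSpace ℝ (Fin d)}
    (hf : MemW110 Ω f) :
    ∃ G, IsWeakGradient Ω f G ∧
      ∀ i, HasIntegrableGradient (fun x => Ω.indicator f x i) (fun x => Ω.indicator G x i) := by
  obtain ⟨G, hG, hfi, hGi, u, hu, hu1, hu2⟩ := hf
  refine ⟨G, hG, fun i => ?_⟩
  have hfI : Integrable (Ω.indicator f) := hfi.integrable_indicator hΩ.measurableSet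
  have hGI : Integrable (Ω.indicator G) := hGi.integrable_indicator hΩ.measurableSet
  refine ⟨hfI.eval_piLp i, hGI.eval_piLp i, fun η hη hηc v => ?_⟩
  have e1 : ∫ x, Ω.indicator f x i * fderiv ℝ η x v = ∫ x in Ω, f x i * fderiv ℝ η x v := by
    rw [← integral_indicator hΩ.measurableSet]
    refine integral_congr_ae (ae_of_all _ fun x => ?_)
    by_cases hx : x ∈ Ω <;> simp [hx]
  have e2 : ∫ x, inner ℝ (Ω.indicator G x i) v * η x = ∫ x in Ω, inner ℝ (G x i) v * η x := by
    rw [← integral_indicator hΩ.measurableSet]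
    refine integral_congr_ae (ae_of_all _ fun x => ?_)
    by_cases hx : x ∈ Ω <;> simp [hx]
  rw [e1, e2]
  obtain ⟨Cη, hCη⟩ := hη.continuous.bounded_above_of_compact_support hηc
  obtain ⟨Cd, hCd⟩ := (continuous_fderiv_apply_const hη v).bounded_above_of_compact_support
    (hηc.fderiv_apply ℝ v)
  have hCη0 : 0 ≤ Cη := (norm_nonneg _).trans (hCη 0)
  have hCd0 : 0 ≤ Cd := (norm_nonneg _).trans (hCd 0)
  simp only [eLpNorm_one_eq_lintegral_enorm] at hu1 hu2
  have hui : ∀ k, ContDiff ℝ ∞ (fun y => u k y i) := fun k => contDiff_apply_piLp (hu k).1 i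
  have l1 : Tendsto (fun k => ∫ x in Ω, u k x i * fderiv ℝ η x v) atTop
      (𝓝 (∫ x in Ω, f x i * fderiv ℝ η x v)) := by
    refine tendsto_integral_of_norm_sub_le hCd0 (fun k => ?_) ?_ (fun k x => ?_) hu1
    · exact (((hui k).continuous.mul
        (continuous_fderiv_apply_const hη v)).integrable_of_hasCompactSupport
        (hηc.fderiv_apply ℝ v).mul_left).integrableOn
    · exact (hfi.eval_piLp i).mul_bdd (c := Cd)
        (continuous_fderiv_apply_const hη v).aestronglyMeasurable (ae_of_all _ hCd)
    · rw [← sub_mul, norm_mul, mul_comm Cd]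
      exact mul_le_mul (PiLp.norm_apply_le (u k x - f x) i) (hCd x) (norm_nonneg _)
        (norm_nonneg _)
  have l2 : Tendsto (fun k => ∫ x in Ω, inner ℝ (gradMap (u k) x i) v * η x) atTop
      (𝓝 (∫ x in Ω, inner ℝ (G x i) v * η x)) := by
    refine tendsto_integral_of_norm_sub_le (C := ‖v‖ * Cη) (by positivity) (fun k => ?_) ?_
      (fun k x => ?_) hu2
    · simp_rw [inner_gradMap]
      exact (((continuous_fderiv_apply_const (hui k) v).mul
        hη.continuous).integrable_of_hasCompactSupport hηc.mul_left).integrableOn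
    · exact ((hGi.eval_piLp i).inner_const v).mul_bdd (c := Cη)
        hη.continuous.aestronglyMeasurable (ae_of_all _ hCη)
    · rw [← sub_mul, ← inner_sub_left, norm_mul]
      calc _ ≤ (‖gradMap (u k) x - G x‖ * ‖v‖) * Cη := by
            refine mul_le_mul ((norm_inner_le_norm _ _).trans ?_) (hCη x) (norm_nonneg _)
              (by positivity)
            gcongr
            exact PiLp.norm_apply_le (gradMap (u k) x - G x) i
        _ = _ := by ring
  refine tendsto_nhds_unique l1 (l2.neg.congr fun k => ?_)
  have hsupp : ∀ x, x ∉ Ω → ∀ᶠ y in 𝓝 x, u k y = 0 := fun x hx =>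
    notMem_tsupport_iff_eventuallyEq.1 fun hx' => hx ((hu k).2.2 hx')
  have s1 : ∫ x in Ω, u k x i * fderiv ℝ η x v = ∫ x, u k x i * fderiv ℝ η x v :=
    setIntegral_eq_integral_of_forall_compl_eq_zero fun x hx => by
      rw [(hsupp x hx).self_of_nhds]; simp
  have s2 : ∫ x in Ω, inner ℝ (gradMap (u k) x i) v * η x
      = ∫ x, fderiv ℝ (fun y => u k y i) x v * η x := by
    simp_rw [inner_gradMap]
    refine setIntegral_eq_integral_of_forall_compl_eq_zero fun x hx => ?_
    have : (fun y => u k y i) =ᶠ[𝓝 x] fun _ => 0 := by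
      filter_upwards [hsupp x hx] with y hy
      rw [hy]; rfl
    rw [this.fderiv_eq]; simp
  rw [s1, s2]
  exact (integral_mul_fderiv_eq_neg_fderiv_mul_of_integrable
      (((continuous_fderiv_apply_const (hui k) v).mul
        hη.continuous).integrable_of_hasCompactSupport hηc.mul_left)
      (((hui k).continuous.mul
        (continuous_fderiv_apply_const hη v)).integrable_of_hasCompactSupport
        (hηc.fderiv_apply ℝ v).mul_left)
      (((hui k).continuous.mul hη.continuous).integrable_of_hasCompactSupport hηc.mul_left)
      (fun x _ => (hui k).differentiable (by simp) x)
      (fun x _ => hη.differentiable (by simp) x)).symm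

/-- Fundamental lemma of the calculus of variations. It identifies the gradient from `MemW110`, the
one from `MemV10LM` and the arbitrary one in the conclusion. -/
theorem IsWeakGradient.ae_eq {Ω : Set (EuclideanSpace ℝ (Fin n))} (hΩ : IsOpen Ω)
    {f : EuclideanSpace ℝ (Fin n) → EuclideanSpace ℝ (Fin d)}
    {G G' : EuclideanSpace ℝ (Fin n) → ColMatrix n d} (h : IsWeakGradient Ω f G)
    (h' : IsWeakGradient Ω f G') : ∀ᵐ x ∂(volume.restrict Ω), G x = G' x := by
  have key : ∀ᵐ x, x ∈ Ω → G x - G' x = 0 := by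
    refine hΩ.ae_eq_zero_of_integral_contDiff_smul_eq_zero (h.2.1.sub h'.2.1)
      fun η hη hηc hηΩ => ?_
    have hsub : ∀ F : EuclideanSpace ℝ (Fin n) → ColMatrix n d, LocallyIntegrableOn F Ω →
        Integrable (fun x => η x • F x) := fun F hF => by
      have h1 : IntegrableOn F (tsupport η) := hF.integrableOn_compact_subset hηΩ hηc
      obtain ⟨C, hC⟩ := hη.continuous.bounded_above_of_compact_support hηc
      refine (integrableOn_iff_integrable_of_support_subset (s := tsupport η) ?_).1
        (h1.bdd_smul C hη.continuous.aestronglyMeasurable (ae_of_all _ hC))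
      intro x hx
      by_contra hx'
      exact hx (by simp [image_eq_zero_of_notMem_tsupport hx'])
    have hi1 := hsub G h.2.1
    have hi2 := hsub G' h'.2.1
    simp_rw [smul_sub]
    rw [integral_sub hi1 hi2, sub_eq_zero]
    ext i : 1
    rw [eval_integral_piLp fun j => hi1.eval_piLp j, eval_integral_piLp fun j => hi2.eval_piLp j]
    refine ext_inner_left ℝ fun v => ?_
    rw [← integral_inner (hi1.eval_piLp i), ← integral_inner (hi2.eval_piLp i)]
    have e : ∀ F : EuclideanSpace ℝ (Fin n) → ColMatrix n d, IsWeakGradient Ω f F →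
        ∫ x, inner ℝ v ((η x • F x) i) = -∫ x in Ω, f x i * fderiv ℝ η x v := by
      intro F hF
      rw [hF.2.2 η ⟨hη, hηc, hηΩ⟩ i v, neg_neg,
        setIntegral_eq_integral_of_forall_compl_eq_zero]
      · refine integral_congr_ae (ae_of_all _ fun x => ?_)
        simp only [PiLp.smul_apply, inner_smul_right, real_inner_comm v]
        ring
      · intro x hx
        rw [image_eq_zero_of_notMem_tsupport fun hx' => hx (hηΩ hx'), mul_zero]
    rw [e G h, e G' h']
  rw [ae_restrict_iff' hΩ.measurableSet]
  filter_upwards [key] with x hx hxΩ using sub_eq_zero.1 (hx hxΩ)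

end VectorValued

/-! ### Convexity at a single point, and the Jensen inequality with a star-shaped minorant. -/

section ConvexPointwise

variable {V : Type*} [NormedAddCommGroup V] [InnerProductSpace ℝ V] {Φ : V → ℝ}

theorem ConvexOn.map_smul_le_of_map_zero (hΦ : ConvexOn ℝ univ Φ) (h0 : Φ 0 = 0) {s : ℝ}
    (hs0 : 0 ≤ s) (hs1 : s ≤ 1) (w : V) : Φ (s • w) ≤ s * Φ w := by
  have := hΦ.2 (mem_univ w) (mem_univ (0 : V)) hs0 (sub_nonneg.2 hs1) (by ring)
  simpa [h0] using this

theorem ConvexOn.map_smul_le_self (hΦ : ConvexOn ℝ univ Φ) (h0 : Φ 0 = 0) (hnn : ∀ w, 0 ≤ Φ w)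
    {s : ℝ} (hs0 : 0 ≤ s) (hs1 : s ≤ 1) (w : V) : Φ (s • w) ≤ Φ w :=
  (hΦ.map_smul_le_of_map_zero h0 hs0 hs1 w).trans (mul_le_of_le_one_left (hnn w) hs1)

variable {m : ℝ → ℝ}

theorem ConvexOn.le_of_norm_le (hΦ : ConvexOn ℝ univ Φ) (h0 : Φ 0 = 0) (hnn : ∀ w, 0 ≤ Φ w)
    (hm : ∀ s, 0 ≤ s → 0 ≤ m s) (hle : ∀ w, Φ w ≤ m ‖w‖) {R : ℝ} {w : V} (hw : ‖w‖ ≤ R) :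
    Φ w ≤ m R := by
  rcases eq_or_ne w 0 with rfl | hw0
  · rw [h0]; exact hm R ((norm_nonneg _).trans hw)
  · have hpos : 0 < ‖w‖ := norm_pos_iff.2 hw0
    have hR : 0 < R := hpos.trans_le hw
    have h1 : w = (‖w‖ / R) • ((R / ‖w‖) • w) := by
      rw [smul_smul, div_mul_div_cancel₀ hR.ne', div_self hpos.ne', one_smul]
    have h2 : ‖(R / ‖w‖) • w‖ = R := by
      rw [norm_smul, Real.norm_of_nonneg (by positivity), div_mul_cancel₀ _ hpos.ne']
    calc Φ w = Φ ((‖w‖ / R) • ((R / ‖w‖) • w)) := by rw [← h1]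
      _ ≤ Φ ((R / ‖w‖) • w) :=
        hΦ.map_smul_le_self h0 hnn (by positivity) ((div_le_one hR).2 hw) _
      _ ≤ m R := by simpa only [h2] using hle ((R / ‖w‖) • w)

/-- `b` lies on the segment from `a` to the point at distance `1` from `a` in the same direction,
where `Φ` is at most `m (R + 1)`. The resulting Lipschitz constant depends on `m` only, hence is
uniform over a family of convex functions with a common bound. -/
theorem ConvexOn.le_add_of_norm_sub_le (hΦ : ConvexOn ℝ univ Φ) (h0 : Φ 0 = 0)
    (hnn : ∀ w, 0 ≤ Φ w) (hm : ∀ s, 0 ≤ s → 0 ≤ m s) (hle : ∀ w, Φ w ≤ m ‖w‖) {R : ℝ} {a b : V}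
    (ha : ‖a‖ ≤ R) (hab : ‖b - a‖ ≤ 1) : Φ b ≤ Φ a + ‖b - a‖ * m (R + 1) := by
  rcases eq_or_ne b a with rfl | hne
  · simp
  · have hpos : 0 < ‖b - a‖ := norm_pos_iff.2 (sub_ne_zero.2 hne)
    set s := ‖b - a‖ with hs
    have h1 : b = (1 - s) • a + s • (a + s⁻¹ • (b - a)) := by
      rw [smul_add, smul_smul, mul_inv_cancel₀ hpos.ne', one_smul]; module
    have h2 : ‖a + s⁻¹ • (b - a)‖ ≤ R + 1 := by
      refine (norm_add_le _ _).trans (add_le_add ha (le_of_eq ?_))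
      rw [norm_smul, norm_inv, Real.norm_of_nonneg hpos.le, ← hs, inv_mul_cancel₀ hpos.ne']
    have h3 := hΦ.le_of_norm_le h0 hnn hm hle h2
    have h4 := hΦ.2 (mem_univ a) (mem_univ (a + s⁻¹ • (b - a))) (sub_nonneg.2 hab) hpos.le
      (by ring)
    rw [← h1, smul_eq_mul, smul_eq_mul] at h4
    have h5 := mul_le_mul_of_nonneg_left h3 hpos.le
    have h6 := mul_nonneg hpos.le (hnn a)
    linarith

/-- A Jensen type inequality for a convex function which is controlled, only on a sublevel set of
a possibly non-convex minorant `nl`, by that minorant. -/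
theorem ConvexOn.le_integral_of_minorant {Y : Type*} [MeasurableSpace Y] {μ : Measure Y}
    [CompleteSpace V] (hΦ : ConvexOn ℝ univ Φ) (hΦc : Continuous Φ) (hΦ0 : Φ 0 = 0)
    (hΦnn : ∀ w, 0 ≤ Φ w) {nl : V → ℝ} {K C : ℝ} (hK : 0 < K) (hC : 1 ≤ C)
    (hnls : ∀ s, 0 ≤ s → s ≤ 1 → ∀ w, nl (s • w) ≤ s * nl w)
    (hgood : ∀ w, nl w ≤ K → Φ (C⁻¹ • w) ≤ nl w + 1)
    {k : Y → ℝ} (hk0 : ∀ y, 0 ≤ k y) (hk : Integrable k μ) (hk1 : ∫ y, k y ∂μ = 1)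
    {w : Y → V} (hw : Integrable (fun y => k y • w y) μ) {F : Y → ℝ}
    (hF : Integrable (fun y => k y * F y) μ) (hF0 : ∀ y, 0 ≤ F y)
    (hnlF : ∀ᵐ y ∂μ, k y ≠ 0 → nl (w y) ≤ F y) (hv : nl (∫ y, k y • w y ∂μ) ≤ K) :
    Φ ((2 * C)⁻¹ • ∫ y, k y • w y ∂μ) ≤ (1 + 1 / K) * (∫ y, k y * F y ∂μ) + 1 := by
  set v := ∫ y, k y • w y ∂μ with hvdef
  set I := ∫ y, k y * F y ∂μ with hI
  have hI0 : 0 ≤ I := integral_nonneg fun y => mul_nonneg (hk0 y) (hF0 y)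
  have hC0 : 0 < C := one_pos.trans_le hC
  have hIK : 0 ≤ 1 / K * I := by positivity
  -- If `I` exceeds `K`, no averaging is needed: `v` is in the sublevel set, so `Φ (C⁻¹ • v) ≤ K + 1
  -- < I + 1`. Otherwise `I ≤ K`, which is what allows the constant term of an affine minorant to be
  -- absorbed below.
  by_cases hlarge : K < I
  · have h1 : (2 * C)⁻¹ • v = (1 / 2 : ℝ) • C⁻¹ • v := by
      rw [smul_smul]; congr 1; field_simp
    rw [h1]
    have h2 := hΦ.map_smul_le_self hΦ0 hΦnn (s := 1 / 2) (by norm_num) (by norm_num) (C⁻¹ • v)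
    have h3 := hgood v hv
    linarith
  · rw [not_lt] at hlarge
    refine le_of_forall_lt fun a ha => ?_
    obtain ⟨b, hab, hb⟩ := exists_between ha
    refine hab.trans_le ?_
    obtain ⟨L, q, hLq, hval⟩ := hΦ.exists_affine_le_of_lt (𝕜 := ℝ) (mem_univ _) hb isClosed_univ
      (hΦc.lowerSemicontinuous.lowerSemicontinuousOn _)
    have hLq' : ∀ u, L u + q ≤ Φ u := fun u => hLq ⟨u, mem_univ u⟩
    have hq : q ≤ 0 := by simpa [hΦ0] using hLq' 0
    have hval' : L ((2 * C)⁻¹ • v) + q = b := hval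
    have hpt : ∀ᵐ y ∂μ, (q / 2 * k y + q / (2 * K) * (k y * F y)) + (2 * C)⁻¹ * L (k y • w y)
        ≤ (1 / 2) * ((1 + 1 / K) * (k y * F y) + k y) := by
      filter_upwards [hnlF] with y hy
      by_cases hky : k y = 0
      · simp [hky]
      -- The values `w y` need not lie in the sublevel set; dividing by `σ` puts them there, since
      -- `F y / σ ≤ K`. The affine minorant is applied to the shrunken vector and the inequality
      -- multiplied back by `σ`, so that `L` acts linearly on `w y` and the loss is only in the
      -- constant terms.
      set σ : ℝ := 1 + F y / K with hσ
      have hσ1 : 1 ≤ σ := by have := div_nonneg (hF0 y) hK.le; linarith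
      have hσ0 : 0 < σ := one_pos.trans_le hσ1
      have hinv1 : σ⁻¹ ≤ 1 := inv_le_one_of_one_le₀ hσ1
      have h1 : nl (σ⁻¹ • w y) ≤ σ⁻¹ * F y :=
        (hnls _ (inv_nonneg.2 hσ0.le) hinv1 _).trans
          (mul_le_mul_of_nonneg_left (hy hky) (inv_nonneg.2 hσ0.le))
      have h2 : σ⁻¹ * F y ≤ K := by
        rw [inv_mul_le_iff₀ hσ0, hσ]
        have : (1 + F y / K) * K = K + F y := by field_simp
        linarith
      have h3 := (hLq' _).trans (hgood _ (h1.trans h2))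
      have h4 : L (C⁻¹ • σ⁻¹ • w y) = C⁻¹ * σ⁻¹ * L (w y) := by
        rw [map_smul, map_smul, smul_eq_mul, smul_eq_mul]; ring
      rw [h4] at h3
      have h5 : C⁻¹ * L (w y) + σ * q ≤ F y + σ := by
        have := mul_le_mul_of_nonneg_left (h3.trans (add_le_add_left h1 1)) hσ0.le
        have e1 : σ * (C⁻¹ * σ⁻¹ * L (w y) + q) = C⁻¹ * L (w y) + σ * q := by field_simp
        have e2 : σ * (σ⁻¹ * F y + 1) = F y + σ := by field_simp
        rwa [e1, e2] at this
      have h6 := mul_le_mul_of_nonneg_left h5 (hk0 y)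
      rw [map_smul, smul_eq_mul]
      have e1 : q / 2 * k y + q / (2 * K) * (k y * F y) + (2 * C)⁻¹ * (k y * L (w y))
          = (1 / 2) * (k y * (C⁻¹ * L (w y) + σ * q)) := by rw [hσ]; field_simp; ring
      have e2 : (1 / 2) * ((1 + 1 / K) * (k y * F y) + k y) = (1 / 2) * (k y * (F y + σ)) := by
        rw [hσ]; field_simp; ring
      rw [e1, e2]
      linarith
    have iL : Integrable (fun y => L (k y • w y)) μ := L.integrable_comp hw
    have hint := integral_mono_ae (((hk.const_mul (q / 2)).add (hF.const_mul (q / (2 * K)))).add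
      (iL.const_mul (2 * C)⁻¹)) (((hF.const_mul (1 + 1 / K)).add hk).const_mul (1 / 2)) hpt
    simp only [Pi.add_apply] at hint
    rw [integral_add, integral_add, integral_const_mul, integral_const_mul, integral_const_mul,
      integral_const_mul, integral_add, integral_const_mul, hk1, L.integral_comp_comm hw,
      ← hvdef, ← hI] at hint
    rotate_left
    · exact hF.const_mul _
    · exact hk
    · exact hk.const_mul _
    · exact hF.const_mul _
    · exact (hk.const_mul (q / 2)).add (hF.const_mul (q / (2 * K)))
    · exact iL.const_mul _
    rw [map_smul, smul_eq_mul] at hval'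
    -- The dilation by `1 / 2` pays for the weights `σ`: they average to `1 + I / K ≤ 2`, and `q ≤
    -- 0`.
    have h7 : q ≤ q / 2 * 1 + q / (2 * K) * I := by
      have h8 : I / K ≤ 1 := (div_le_one hK).2 hlarge
      have h9 : q / (2 * K) * I = q / 2 * (I / K) := by field_simp
      rw [h9]
      nlinarith
    have h10 : I / K ≤ 1 := (div_le_one hK).2 hlarge
    linarith

end ConvexPointwise

/-! ### Envelopes over balls and the minorant extracted from the balance inequality. -/

section Envelopes

variable {n : ℕ} {V : Type*} [NormedAddCommGroup V] [InnerProductSpace ℝ V]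
  {Ω : Set (EuclideanSpace ℝ (Fin n))} {N : EuclideanSpace ℝ (Fin n) → V → ℝ}

/-- The regularity of the integrand at a single good point. -/
structure IsEvenConvex (Φ : V → ℝ) : Prop where
  continuous : Continuous Φ
  zero : Φ 0 = 0
  convex : ConvexOn ℝ univ Φ
  even : ∀ w, Φ w = Φ (-w)
  nonneg : ∀ w, 0 ≤ Φ w

theorem IsWeakNFunction.ae_isEvenConvex (hN : IsWeakNFunction Ω N) (hΩ : MeasurableSet Ω) :
    ∀ᵐ x ∂(volume.restrict Ω), IsEvenConvex (N x) := by
  filter_upwards [hN.continuous, hN.zero, hN.convex, hN.even, ae_restrict_mem hΩ]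
    with x h1 h2 h3 h4 h5 using ⟨h1, h2, h3, h4, hN.nonneg x h5⟩

variable {B : Set (EuclideanSpace ℝ (Fin n))}

theorem ae_restrict_inter_of_ae {p : EuclideanSpace ℝ (Fin n) → Prop}
    (h : ∀ᵐ x ∂(volume.restrict Ω), p x) : ∀ᵐ x ∂(volume.restrict (B ∩ Ω)), p x :=
  ae_mono (Measure.restrict_mono inter_subset_right le_rfl) h

theorem lowerEnvelope_le {w : V} {a : ℝ≥0∞} (hB : volume.restrict (B ∩ Ω) ≠ 0)
    (h : ∀ᵐ y ∂(volume.restrict (B ∩ Ω)), ENNReal.ofReal (N y w) ≤ a) :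
    lowerEnvelope Ω N B w ≤ a := by
  have : (ae (volume.restrict (B ∩ Ω))).NeBot := ae_neBot.2 hB
  have h2 : ∀ᵐ y ∂(volume.restrict (B ∩ Ω)), lowerEnvelope Ω N B w ≤ ENNReal.ofReal (N y w) :=
    ae_essInf_le
  obtain ⟨y, h3, h4⟩ := (h.and h2).exists
  exact h4.trans h3

theorem le_lowerEnvelope {w : V} {a : ℝ≥0∞}
    (h : ∀ᵐ y ∂(volume.restrict (B ∩ Ω)), a ≤ ENNReal.ofReal (N y w)) :
    a ≤ lowerEnvelope Ω N B w := le_essInf_of_ae_le a h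

theorem ae_lowerEnvelope_le (w : V) :
    ∀ᵐ y ∂(volume.restrict (B ∩ Ω)), lowerEnvelope Ω N B w ≤ ENNReal.ofReal (N y w) :=
  ae_essInf_le

theorem ae_le_upperEnvelope (w : V) :
    ∀ᵐ y ∂(volume.restrict (B ∩ Ω)), ENNReal.ofReal (N y w) ≤ upperEnvelope Ω N B w :=
  ae_le_essSup

theorem upperEnvelope_le {w : V} {a : ℝ≥0∞}
    (h : ∀ᵐ y ∂(volume.restrict (B ∩ Ω)), ENNReal.ofReal (N y w) ≤ a) :
    upperEnvelope Ω N B w ≤ a := essSup_le_of_ae_le a h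

/-- An infimum of convex functions need not be convex, but the inequality along rays from the origin
survives. This is the only convexity of the envelope that the Jensen argument uses. -/
theorem lowerEnvelope_smul_le (hN : IsWeakNFunction Ω N) (hΩ : MeasurableSet Ω)
    (hB : volume.restrict (B ∩ Ω) ≠ 0) {s : ℝ} (hs0 : 0 ≤ s) (hs1 : s ≤ 1) (w : V) :
    lowerEnvelope Ω N B (s • w) ≤ ENNReal.ofReal s * lowerEnvelope Ω N B w := by
  have hae := ae_restrict_inter_of_ae (B := B) (hN.ae_isEvenConvex hΩ)
  rcases hs0.eq_or_lt with rfl | hs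
  · simp only [zero_smul, ENNReal.ofReal_zero, zero_mul]
    refine lowerEnvelope_le hB ?_
    filter_upwards [hae] with y hy
    simp [hy.zero]
  · rw [mul_comm, ← ENNReal.div_le_iff (by simpa using hs) ENNReal.ofReal_ne_top]
    refine le_lowerEnvelope ?_
    filter_upwards [hae, ae_lowerEnvelope_le (Ω := Ω) (N := N) (B := B) (s • w)] with y hy hle
    rw [ENNReal.div_le_iff (by simpa using hs) ENNReal.ofReal_ne_top, mul_comm,
      ← ENNReal.ofReal_mul hs.le]
    exact hle.trans (ENNReal.ofReal_le_ofReal (hy.convex.map_smul_le_of_map_zero hy.zero hs0 hs1 w))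

variable [FiniteDimensional ℝ V]

/-- Almost everywhere, the envelopes bound the integrand simultaneously for all vectors. -/
theorem IsWeakNFunction.ae_envelope_bounds (hN : IsWeakNFunction Ω N) (hΩ : MeasurableSet Ω) :
    ∀ᵐ y ∂(volume.restrict (B ∩ Ω)), ∀ w, lowerEnvelope Ω N B w ≤ ENNReal.ofReal (N y w) ∧
      ENNReal.ofReal (N y w) ≤ upperEnvelope Ω N B w := by
  obtain ⟨m₁, m₂, -, -, -, -, hm₂, hbd⟩ := hN.bounds
  have hlip : ∀ᵐ y ∂(volume.restrict (B ∩ Ω)), ∀ (R : ℝ) (a b : V), ‖a‖ ≤ R → ‖b - a‖ ≤ 1 →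
      N y b ≤ N y a + ‖b - a‖ * m₂ (R + 1) := by
    filter_upwards [ae_restrict_inter_of_ae (B := B) (hN.ae_isEvenConvex hΩ),
      ae_restrict_inter_of_ae (B := B) hbd] with y hy hb R a b ha hab
    exact hy.convex.le_add_of_norm_sub_le hy.zero hy.nonneg hm₂ (fun w => (hb w).2) ha hab
  have hnn : ∀ᵐ y ∂(volume.restrict (B ∩ Ω)), IsEvenConvex (N y) :=
    ae_restrict_inter_of_ae (B := B) (hN.ae_isEvenConvex hΩ)
  have hlipL : ∀ (R : ℝ) (a b : V), 0 ≤ R → ‖a‖ ≤ R → ‖b - a‖ ≤ 1 →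
      lowerEnvelope Ω N B b ≤ lowerEnvelope Ω N B a + ENNReal.ofReal (‖b - a‖ * m₂ (R + 1)) := by
    intro R a b hR ha hab
    rw [← tsub_le_iff_right]
    refine le_lowerEnvelope ?_
    filter_upwards [hlip, hnn, ae_lowerEnvelope_le (Ω := Ω) (N := N) (B := B) b] with y hy hn hle
    rw [tsub_le_iff_right, ← ENNReal.ofReal_add (hn.nonneg _)
      (mul_nonneg (norm_nonneg _) (hm₂ _ (by positivity)))]
    exact hle.trans (ENNReal.ofReal_le_ofReal (hy R a b ha hab))
  have hlipU : ∀ (R : ℝ) (a b : V), 0 ≤ R → ‖a‖ ≤ R → ‖b - a‖ ≤ 1 →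
      upperEnvelope Ω N B b ≤ upperEnvelope Ω N B a + ENNReal.ofReal (‖b - a‖ * m₂ (R + 1)) := by
    intro R a b hR ha hab
    refine upperEnvelope_le ?_
    filter_upwards [hlip, hnn, ae_le_upperEnvelope (Ω := Ω) (N := N) (B := B) a] with y hy hn hle
    refine (ENNReal.ofReal_le_ofReal (hy R a b ha hab)).trans ?_
    rw [ENNReal.ofReal_add (hn.nonneg _) (mul_nonneg (norm_nonneg _) (hm₂ _ (by positivity)))]
    exact add_le_add_left hle _
  -- The exceptional null set in the definition of an envelope depends on the vector. It is removed
  -- for a dense sequence, and the Lipschitz bounds, uniform in `y`, carry the inequalities to all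
  -- vectors.
  have hq : ∀ᵐ y ∂(volume.restrict (B ∩ Ω)), ∀ k,
      lowerEnvelope Ω N B (TopologicalSpace.denseSeq V k)
        ≤ ENNReal.ofReal (N y (TopologicalSpace.denseSeq V k)) ∧
      ENNReal.ofReal (N y (TopologicalSpace.denseSeq V k))
        ≤ upperEnvelope Ω N B (TopologicalSpace.denseSeq V k) := by
    rw [ae_all_iff]
    exact fun k => (ae_lowerEnvelope_le _).and (ae_le_upperEnvelope _)
  filter_upwards [hq, hlip, hnn] with y hy hl hn w
  set m := m₂ (‖w‖ + 1 + 1) with hm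
  have hm0 : 0 ≤ m := hm₂ _ (by positivity)
  have approx : ∀ ε : ℝ, 0 < ε → ∃ k, ‖TopologicalSpace.denseSeq V k - w‖ ≤ 1 ∧
      ‖TopologicalSpace.denseSeq V k‖ ≤ ‖w‖ + 1 ∧
      ‖TopologicalSpace.denseSeq V k - w‖ * m ≤ ε / 2 := by
    intro ε hε
    have hδ : 0 < min 1 (ε / 2 / (m + 1)) := by positivity
    obtain ⟨k, hk⟩ := Metric.denseRange_iff.1 (TopologicalSpace.denseRange_denseSeq V) w _ hδ
    rw [dist_comm, dist_eq_norm] at hk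
    have h1 := hk.trans_le (min_le_left _ _)
    have h2 := hk.trans_le (min_le_right _ _)
    refine ⟨k, h1.le, ?_, ?_⟩
    · have := norm_add_le (TopologicalSpace.denseSeq V k - w) w
      rw [sub_add_cancel] at this
      linarith
    · rw [lt_div_iff₀ (by positivity)] at h2
      nlinarith [norm_nonneg (TopologicalSpace.denseSeq V k - w)]
  have hw1 : ‖w‖ ≤ ‖w‖ + 1 := by linarith
  have hw0 : 0 ≤ ‖w‖ + 1 := by positivity
  constructor
  · refine ENNReal.le_of_forall_pos_le_add fun ε hε _ => ?_
    obtain ⟨k, h1, h2, h3⟩ := approx ε hε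
    set q := TopologicalSpace.denseSeq V k
    have h1' : ‖w - q‖ ≤ 1 := by rwa [norm_sub_rev]
    have e1 := hlipL _ q w hw0 h2 h1'
    have e2 := hl _ w q hw1 h1
    rw [norm_sub_rev] at e1
    calc lowerEnvelope Ω N B w ≤ lowerEnvelope Ω N B q + ENNReal.ofReal (‖q - w‖ * m) := e1
      _ ≤ ENNReal.ofReal (N y w + ‖q - w‖ * m) + ENNReal.ofReal (‖q - w‖ * m) := by
          gcongr
          exact (hy k).1.trans (ENNReal.ofReal_le_ofReal e2)
      _ = ENNReal.ofReal (N y w) + ENNReal.ofReal (‖q - w‖ * m + ‖q - w‖ * m) := by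
          rw [ENNReal.ofReal_add (hn.nonneg _) (by positivity),
            ENNReal.ofReal_add (by positivity) (by positivity), add_assoc]
      _ ≤ ENNReal.ofReal (N y w) + ε := by
          gcongr
          rw [← ENNReal.ofReal_coe_nnreal]
          exact ENNReal.ofReal_le_ofReal (by linarith)
  · refine ENNReal.le_of_forall_pos_le_add fun ε hε _ => ?_
    obtain ⟨k, h1, h2, h3⟩ := approx ε hε
    set q := TopologicalSpace.denseSeq V k
    have h1' : ‖w - q‖ ≤ 1 := by rwa [norm_sub_rev]
    have e1 := hlipU _ w q hw0 hw1 h1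
    have e2 := hl _ q w h2 h1'
    rw [norm_sub_rev] at e2
    calc ENNReal.ofReal (N y w) ≤ ENNReal.ofReal (N y q) + ENNReal.ofReal (‖q - w‖ * m) := by
          rw [← ENNReal.ofReal_add (hn.nonneg _) (by positivity)]
          exact ENNReal.ofReal_le_ofReal e2
      _ ≤ (upperEnvelope Ω N B w + ENNReal.ofReal (‖q - w‖ * m)) +
          ENNReal.ofReal (‖q - w‖ * m) := by
          gcongr
          exact (hy k).2.trans e1
      _ = upperEnvelope Ω N B w + ENNReal.ofReal (‖q - w‖ * m + ‖q - w‖ * m) := by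
          rw [ENNReal.ofReal_add (by positivity) (by positivity), add_assoc]
      _ ≤ upperEnvelope Ω N B w + ε := by
          gcongr
          rw [← ENNReal.ofReal_coe_nnreal]
          exact ENNReal.ofReal_le_ofReal (by linarith)

/-- On a ball where the balance inequality holds, the integrand is controlled at almost every point
by a common star-shaped minorant `nl`, on a sublevel set of `nl`. -/
theorem IsWeakNFunction.exists_minorant (hN : IsWeakNFunction Ω N) (hΩ : MeasurableSet Ω)
    [Nontrivial V] :
    ∃ k₀ : ℝ, 0 < k₀ ∧ ∀ (B : Set (EuclideanSpace ℝ (Fin n))) (C τ : ℝ),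
      volume.restrict (B ∩ Ω) ≠ 0 → 0 < C → 1 ≤ τ →
      (∀ v : V, lowerEnvelope Ω N B (C • v) ≤
        (⨆ (η : V) (_ : ‖η‖ = 1), lowerEnvelope Ω N B (τ • η)) →
        upperEnvelope Ω N B v ≤ lowerEnvelope Ω N B (C • v) + 1) →
      ∃ (nl : V → ℝ) (K : ℝ), k₀ ≤ K ∧ (∀ w, 0 ≤ nl w) ∧
        (∀ s, 0 ≤ s → s ≤ 1 → ∀ w, nl (s • w) ≤ s * nl w) ∧
        (∀ w, ‖w‖ ≤ τ → nl w ≤ K) ∧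
        ∀ᵐ y ∂(volume.restrict (B ∩ Ω)), (∀ w, nl w ≤ N y w) ∧
          ∀ w, nl w ≤ K → N y (C⁻¹ • w) ≤ nl w + 1 := by
  obtain ⟨m₁, m₂, hm₁c, -, hm₁0, hm₁p, hm₂, hbd⟩ := hN.bounds
  -- The sublevel height is bounded below independently of the ball: the envelope on the sphere of
  -- radius `τ ≥ 1` is at least `m₁ τ ≥ m₁ 1`. This keeps the factor `1 + 1 / K` in the Jensen
  -- inequality bounded.
  refine ⟨m₁ 1, hm₁p 1 one_pos, fun B C τ hB hC hτ hbal => ?_⟩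
  have hτ0 : 0 < τ := one_pos.trans_le hτ
  have hbd' := ae_restrict_inter_of_ae (B := B) hbd
  have hnn := ae_restrict_inter_of_ae (B := B) (hN.ae_isEvenConvex hΩ)
  have hub : ∀ w, lowerEnvelope Ω N B w ≤ ENNReal.ofReal (m₂ ‖w‖) := fun w => by
    refine lowerEnvelope_le hB ?_
    filter_upwards [hbd'] with y hy
    exact ENNReal.ofReal_le_ofReal (hy w).2
  have hfin : ∀ w, lowerEnvelope Ω N B w ≠ ⊤ := fun w =>
    ne_top_of_le_ne_top ENNReal.ofReal_ne_top (hub w)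
  set K : ℝ≥0∞ := ⨆ (η : V) (_ : ‖η‖ = 1), lowerEnvelope Ω N B (τ • η) with hK
  have hKtop : K ≠ ⊤ := by
    refine ne_top_of_le_ne_top ENNReal.ofReal_ne_top (b := ENNReal.ofReal (m₂ τ)) ?_
    refine iSup₂_le fun η hη => (hub _).trans (le_of_eq ?_)
    rw [norm_smul, hη, mul_one, Real.norm_of_nonneg hτ0.le]
  have hm₁τ : m₁ 1 ≤ m₁ τ := by
    have h := hm₁c.2 (mem_Ici.2 hτ0.le) (mem_Ici.2 le_rfl) (inv_nonneg.2 hτ0.le) (sub_nonneg.2 (inv_le_one_of_one_le₀ hτ)) (by ring)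
    rw [smul_eq_mul, inv_mul_cancel₀ hτ0.ne', hm₁0, smul_zero, add_zero, add_zero,
      smul_eq_mul] at h
    exact h.trans (mul_le_of_le_one_left (hm₁p τ hτ0).le (inv_le_one_of_one_le₀ hτ))
  have hKlow : ENNReal.ofReal (m₁ 1) ≤ K := by
    obtain ⟨η, hη⟩ := exists_norm_eq V zero_le_one
    refine le_iSup₂_of_le η hη (le_lowerEnvelope ?_)
    filter_upwards [hbd'] with y hy
    refine ENNReal.ofReal_le_ofReal (hm₁τ.trans ?_)
    have := (hy (τ • η)).1
    rwa [norm_smul, hη, mul_one, Real.norm_of_nonneg hτ0.le] at this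
  have hsmul := fun {s : ℝ} (hs0 : 0 ≤ s) (hs1 : s ≤ 1) (w : V) =>
    lowerEnvelope_smul_le hN hΩ hB hs0 hs1 w
  refine ⟨fun w => (lowerEnvelope Ω N B w).toReal, K.toReal, ?_, fun w => ENNReal.toReal_nonneg,
    ?_, ?_, ?_⟩
  · exact (ENNReal.ofReal_le_iff_le_toReal hKtop).1 hKlow
  · intro s hs0 hs1 w
    have := ENNReal.toReal_mono (ENNReal.mul_ne_top ENNReal.ofReal_ne_top (hfin w))
      (hsmul hs0 hs1 w)
    rwa [ENNReal.toReal_mul, ENNReal.toReal_ofReal hs0] at this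
  · intro w hw
    refine ENNReal.toReal_mono hKtop ?_
    obtain ⟨η, hη, hwη⟩ : ∃ η : V, ‖η‖ = 1 ∧ w = (‖w‖ / τ) • τ • η := by
      rcases eq_or_ne w 0 with rfl | hw0
      · obtain ⟨η, hη⟩ := exists_norm_eq V zero_le_one
        exact ⟨η, hη, by simp⟩
      · have hpos : 0 < ‖w‖ := norm_pos_iff.2 hw0
        refine ⟨‖w‖⁻¹ • w, norm_smul_inv_norm hw0, ?_⟩
        rw [smul_smul, smul_smul, div_mul_cancel₀ _ hτ0.ne', mul_inv_cancel₀ hpos.ne', one_smul]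
    rw [hwη]
    have h1 : ‖w‖ / τ ≤ 1 := (div_le_one hτ0).2 hw
    refine (hsmul (by positivity) h1 _).trans ?_
    refine le_iSup₂_of_le η hη ?_
    exact mul_le_of_le_one_left zero_le (ENNReal.ofReal_le_one.2 h1)
  · filter_upwards [hN.ae_envelope_bounds hΩ, hnn] with y hy hn
    refine ⟨fun w => ?_, fun w hw => ?_⟩
    · have := ENNReal.toReal_mono ENNReal.ofReal_ne_top (hy w).1
      rwa [ENNReal.toReal_ofReal (hn.nonneg w)] at this
    · have hC' : C • C⁻¹ • w = w := by rw [smul_smul, mul_inv_cancel₀ hC.ne', one_smul]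
      have h1 : lowerEnvelope Ω N B w ≤ K := (ENNReal.toReal_le_toReal (hfin w) hKtop).1 hw
      have h2 := hbal (C⁻¹ • w) (by rwa [hC'])
      rw [hC'] at h2
      have h3 := ENNReal.toReal_mono (ENNReal.add_ne_top.2 ⟨hfin w, ENNReal.one_ne_top⟩)
        ((hy (C⁻¹ • w)).2.trans h2)
      rwa [ENNReal.toReal_ofReal (hn.nonneg _), ENNReal.toReal_add (hfin w) ENNReal.one_ne_top,
        ENNReal.toReal_one] at h3

end Envelopes

/-! ### The balance condition bounds the integrand of a mollified field. -/

section ModularMollification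

variable {n : ℕ} {V : Type*} [NormedAddCommGroup V] [InnerProductSpace ℝ V]
  [FiniteDimensional ℝ V]
  {Ω : Set (EuclideanSpace ℝ (Fin n))} {N : EuclideanSpace ℝ (Fin n) → V → ℝ}

/-- A single component satisfying the balance inequality: the integrand of a mollified field is
controlled by the mollified integrand. -/
theorem IsWeakNFunction.exists_mollify_le (hN : IsWeakNFunction Ω N) (hΩ : IsOpen Ω) {γ c C : ℝ}
    (hγ : γ ≤ 1) (hc : 1 < c) (hC : 1 < C)
    (hbal : ∀ (z : EuclideanSpace ℝ (Fin n)) (r : ℝ), 0 < r → r ≤ 1 →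
      (Metric.ball z r ∩ Ω).Nonempty → ∀ v : V,
      lowerEnvelope Ω N (Metric.ball z r) (C • v) ≤
        (⨆ (η : V) (_ : ‖η‖ = 1), lowerEnvelope Ω N (Metric.ball z r) ((c * r ^ (γ - 1)) • η)) →
      upperEnvelope Ω N (Metric.ball z r) v ≤ lowerEnvelope Ω N (Metric.ball z r) (C • v) + 1) :
    ∃ A : ℝ, 0 < A ∧ ∀ (t : ℝ) (κ : EuclideanSpace ℝ (Fin n) → ℝ)
      (w : EuclideanSpace ℝ (Fin n) → V) (F : EuclideanSpace ℝ (Fin n) → ℝ), 0 < t → 4 * t ≤ 1 →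
      IsMollifier κ (Metric.closedBall 0 (2 * t)) → Integrable w → Integrable F →
      (∀ y, 0 ≤ F y) → (∀ y ∈ Ω, N y (w y) ≤ F y) → (∀ y, y ∉ Ω → w y = 0) →
      (∀ x, ‖mollify κ w x‖ ≤ c * (4 * t) ^ (γ - 1)) →
      ∀ᵐ x ∂(volume.restrict Ω), N x ((2 * C)⁻¹ • mollify κ w x) ≤ A * (mollify κ F x + 1) := by
  have hΩm := hΩ.measurableSet
  have hF1 : ∀ (t : ℝ) (κ : EuclideanSpace ℝ (Fin n) → ℝ) (F : EuclideanSpace ℝ (Fin n) → ℝ),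
      IsMollifier κ (Metric.closedBall 0 (2 * t)) → (∀ y, 0 ≤ F y) → ∀ x, 0 ≤ mollify κ F x :=
    fun t κ F hκ hF0 x => integral_nonneg fun y => mul_nonneg (hκ.nonneg _) (hF0 y)
  rcases subsingleton_or_nontrivial V with hV | hV
  · refine ⟨1, one_pos, fun t κ w F ht ht1 hκ hw hF hF0 hNF hw0 hS => ?_⟩
    filter_upwards [hN.zero] with x hx
    rw [Subsingleton.elim ((2 * C)⁻¹ • mollify κ w x) 0, hx, one_mul]
    linarith [hF1 t κ F hκ hF0 x]
  obtain ⟨k₀, hk₀, hmin⟩ := hN.exists_minorant hΩm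
  refine ⟨1 + (1 + 1 / k₀), by positivity, fun t κ w F ht ht1 hκ hw hF hF0 hNF hw0 hS => ?_⟩
  have hr : 0 < 4 * t := by positivity
  set τ := c * (4 * t) ^ (γ - 1) with hτdef
  have hτ : 1 ≤ τ := by
    have h1 : 1 ≤ (4 * t) ^ (γ - 1) :=
      Real.one_le_rpow_of_pos_of_le_one_of_nonpos hr ht1 (by linarith)
    nlinarith
  -- Balls with centres in a countable dense set keep the union of null sets null. If `x` is within
  -- `t` of a centre, then the points `y` with `x - y` in the support of the kernel are within `3 *
  -- t`, hence in the ball of radius `4 * t`.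
  set D := TopologicalSpace.denseSeq (EuclideanSpace ℝ (Fin n)) with hD
  have hball : ∀ k, (Metric.ball (D k) (4 * t) ∩ Ω).Nonempty →
      ∃ (nl : V → ℝ) (K : ℝ), k₀ ≤ K ∧ (∀ w, 0 ≤ nl w) ∧
        (∀ s, 0 ≤ s → s ≤ 1 → ∀ w, nl (s • w) ≤ s * nl w) ∧
        (∀ w, ‖w‖ ≤ τ → nl w ≤ K) ∧
        ∀ᵐ y ∂(volume.restrict (Metric.ball (D k) (4 * t) ∩ Ω)), (∀ w, nl w ≤ N y w) ∧
          ∀ w, nl w ≤ K → N y (C⁻¹ • w) ≤ nl w + 1 := by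
    intro k hk
    refine hmin _ C τ ?_ (one_pos.trans hC) hτ (hbal _ _ hr ht1 hk)
    rw [Ne, Measure.restrict_eq_zero]
    exact ((Metric.isOpen_ball.inter hΩ).measure_pos volume hk).ne'
  have hae : ∀ᵐ x, ∀ k, x ∈ Metric.ball (D k) (4 * t) ∩ Ω → IsEvenConvex (N x) →
      dist x (D k) < t →
      N x ((2 * C)⁻¹ • mollify κ w x) ≤ (1 + (1 + 1 / k₀)) * (mollify κ F x + 1) := by
    rw [ae_all_iff]
    intro k
    by_cases hk : (Metric.ball (D k) (4 * t) ∩ Ω).Nonempty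
    swap
    · exact ae_of_all _ fun x hx => absurd ⟨x, hx⟩ hk
    obtain ⟨nl, K, hkK, hnl0, hnls, hnlτ, hprop⟩ := hball k hk
    have hK : 0 < K := hk₀.trans_le hkK
    have hmeas : MeasurableSet (Metric.ball (D k) (4 * t) ∩ Ω) :=
      Metric.isOpen_ball.measurableSet.inter hΩm
    rw [ae_restrict_iff' hmeas] at hprop
    filter_upwards [hprop] with x hx hxB hNx hdist
    have hint : ∀ᵐ y, κ (x - y) ≠ 0 → nl (w y) ≤ F y := by
      filter_upwards [hprop] with y hy hκy
      have hyb : y ∈ Metric.ball (D k) (4 * t) := by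
        have h1 : x - y ∈ Metric.closedBall (0 : EuclideanSpace ℝ (Fin n)) (2 * t) := by
          by_contra hcon; exact hκy (hκ.eq_zero _ hcon)
        rw [mem_closedBall_zero_iff] at h1
        rw [Metric.mem_ball]
        have h2 := dist_triangle y x (D k)
        rw [dist_comm y x, dist_eq_norm x y] at h2
        linarith
      by_cases hyΩ : y ∈ Ω
      · exact ((hy ⟨hyb, hyΩ⟩).1 _).trans (hNF y hyΩ)
      · rw [hw0 y hyΩ]
        have := hnls 0 le_rfl zero_le_one 0
        rw [zero_smul, zero_mul] at this
        exact this.trans (hF0 y)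
    have key := hNx.convex.le_integral_of_minorant (μ := volume) hNx.continuous hNx.zero hNx.nonneg
      hK hC.le hnls (hx hxB).2 (k := fun y => κ (x - y)) (fun y => hκ.nonneg _)
      (hκ.integrable_translate x) (hκ.integral_translate x) (w := w)
      (integrable_kernel_smul hκ.contDiff.continuous hκ.hasCompactSupport hw x) (F := F)
      (integrable_kernel_smul hκ.contDiff.continuous hκ.hasCompactSupport hF x) hF0 hint
      (hnlτ _ (hS x))
    have hI0 := hF1 t κ F hκ hF0 x
    have e1 : mollify κ F x = ∫ y, κ (x - y) * F y := rfl
    rw [e1] at hI0 ⊢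
    refine (show N x ((2 * C)⁻¹ • mollify κ w x) ≤ _ from key).trans ?_
    have h1 : 1 / K ≤ 1 / k₀ := one_div_le_one_div_of_le hk₀ hkK
    have h2 : 0 ≤ 1 / k₀ := by positivity
    have h3 := mul_le_mul_of_nonneg_right h1 hI0
    linarith
  filter_upwards [ae_restrict_of_ae hae, hN.ae_isEvenConvex hΩm, ae_restrict_mem hΩm]
    with x hx hNx hxΩ
  obtain ⟨k, hk⟩ := Metric.denseRange_iff.1
    (TopologicalSpace.denseRange_denseSeq (EuclideanSpace ℝ (Fin n))) x t ht
  refine hx k ⟨?_, hxΩ⟩ hNx hk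
  rw [Metric.mem_ball]
  exact hk.trans (by linarith)

/-- The integrand of a mollified field is controlled by the mollified integrand, up to the dilation
`C`, as long as the mollified field grows at most like `b * t ^ (γ - 1)`. -/
def MollifyBound (Ω : Set (EuclideanSpace ℝ (Fin n))) (γ : ℝ)
    (M : EuclideanSpace ℝ (Fin n) → V → ℝ) (C A b : ℝ) : Prop :=
  ∀ (t : ℝ) (κ : EuclideanSpace ℝ (Fin n) → ℝ)
    (w : EuclideanSpace ℝ (Fin n) → V) (F : EuclideanSpace ℝ (Fin n) → ℝ), 0 < t → 4 * t ≤ 1 →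
    IsMollifier κ (Metric.closedBall 0 (2 * t)) → Integrable w → Integrable F →
    (∀ y, 0 ≤ F y) → (∀ y ∈ Ω, M y (w y) ≤ F y) → (∀ y, y ∉ Ω → w y = 0) →
    (∀ x, ‖mollify κ w x‖ ≤ b * t ^ (γ - 1)) →
    ∀ᵐ x ∂(volume.restrict Ω), M x (C⁻¹ • mollify κ w x) ≤ A * (mollify κ F x + 1)

/-- Linear components commute with mollification, and each summand of `M` is bounded by `M`, hence
by the same `F`; so the estimates for the summands add up. The constant `b` is chosen so that every
component of the mollified field meets its own size bound. -/
theorem BalanceGen.exists_mollifyBound {M : EuclideanSpace ℝ (Fin n) → V → ℝ} {γ : ℝ}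
    (hM : BalanceGen Ω γ M) (hΩ : IsOpen Ω) (hγ : γ ≤ 1) :
    ∃ C A b : ℝ, 1 ≤ C ∧ 0 < A ∧ 0 < b ∧ MollifyBound Ω γ M C A b := by
  obtain ⟨L, ℓ, P, Mj, hL, -, hMj, hsum, c, C, hc, hC, hbal⟩ := hM
  choose A hA hAb using fun j => (hMj j).exists_mollify_le hΩ hγ hc hC
    (fun z r hr hr1 hz v => hbal z r hr hr1 hz j v)
  let Q : ∀ j, V →L[ℝ] EuclideanSpace ℝ (Fin (ℓ j)) := fun j => (P j).toContinuousLinearMap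
  set p : ℝ := 1 + ∑ j, ‖Q j‖ with hp
  have hp0 : 0 < p := by positivity
  have hQp : ∀ j, ‖Q j‖ ≤ p := fun j => by
    have := Finset.single_le_sum (f := fun j => ‖Q j‖) (fun i _ => norm_nonneg _)
      (Finset.mem_univ j)
    linarith
  have : Nonempty (Fin L) := ⟨⟨0, hL⟩⟩
  refine ⟨2 * C, ∑ j, A j, c * 4 ^ (γ - 1) / p, by linarith,
    Finset.sum_pos (fun j _ => hA j) Finset.univ_nonempty, by positivity, ?_⟩
  intro t κ w F ht ht1 hκ hw hF hF0 hMF hw0 hS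
  have hcomm : ∀ j x, mollify κ (fun y => Q j (w y)) x = Q j (mollify κ w x) := by
    intro j x
    rw [mollify, mollify, ← (Q j).integral_comp_comm
      (integrable_kernel_smul hκ.contDiff.continuous hκ.hasCompactSupport hw x)]
    simp_rw [map_smul]
  have hj : ∀ᵐ x ∂(volume.restrict Ω), ∀ j,
      Mj j x ((2 * C)⁻¹ • mollify κ (fun y => Q j (w y)) x) ≤ A j * (mollify κ F x + 1) := by
    rw [ae_all_iff]
    intro j
    refine hAb j t κ (fun y => Q j (w y)) F ht ht1 hκ ((Q j).integrable_comp hw) hF hF0 ?_ ?_ ?_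
    · intro y hy
      refine le_trans ?_ (hMF y hy)
      rw [hsum y hy]
      exact Finset.single_le_sum (f := fun j => Mj j y (P j (w y)))
        (fun i _ => (hMj i).nonneg y hy _) (Finset.mem_univ j)
    · intro y hy
      simp only [hw0 y hy, map_zero]
    · intro x
      rw [hcomm]
      calc ‖Q j (mollify κ w x)‖ ≤ ‖Q j‖ * ‖mollify κ w x‖ := (Q j).le_opNorm _
        _ ≤ p * (c * 4 ^ (γ - 1) / p * t ^ (γ - 1)) :=
          mul_le_mul (hQp j) (hS x) (norm_nonneg _) hp0.le
        _ = c * (4 * t) ^ (γ - 1) := by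
          rw [Real.mul_rpow (by norm_num) ht.le]; field_simp
  filter_upwards [hj, ae_restrict_mem hΩ.measurableSet] with x hx hxΩ
  rw [hsum x hxΩ, Finset.sum_mul]
  refine Finset.sum_le_sum fun j _ => ?_
  have := hx j
  rw [hcomm, ← map_smul] at this
  exact this

end ModularMollification

/-! ### Measurability, dominated convergence and elementary estimates for modulars. -/

section ModularApproximation

variable {n : ℕ} {V : Type*} [NormedAddCommGroup V] [InnerProductSpace ℝ V]
  [FiniteDimensional ℝ V] {Ω : Set (EuclideanSpace ℝ (Fin n))}

theorem aemeasurable_comp_of_continuousOn {M : EuclideanSpace ℝ (Fin n) → V → ℝ}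
    (hΩ : MeasurableSet Ω)
    (hM : ContinuousOn (fun p : EuclideanSpace ℝ (Fin n) × V => M p.1 p.2) (Ω ×ˢ univ))
    {w : EuclideanSpace ℝ (Fin n) → V} (hw : AEStronglyMeasurable w (volume.restrict Ω)) :
    AEMeasurable (fun x => M x (w x)) (volume.restrict Ω) := by
  borelize V
  have : ProperSpace V := FiniteDimensional.proper ℝ V
  have hs : MeasurableSet (Ω ×ˢ (univ : Set V)) := hΩ.prod MeasurableSet.univ
  classical
  have h1 : Measurable ((Ω ×ˢ (univ : Set V)).piecewise (fun p => M p.1 p.2) fun _ => 0) :=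
    hM.measurable_piecewise continuousOn_const hs
  have h2 : AEMeasurable (fun x => (x, w x)) (volume.restrict Ω) :=
    aemeasurable_id.prodMk hw.aemeasurable
  refine (h1.comp_aemeasurable h2).congr ?_
  filter_upwards [ae_restrict_mem hΩ] with x hx
  exact piecewise_eq_of_mem _ _ _ ⟨hx, mem_univ _⟩

/-- An upper bound for limits of integrals under domination by an `L¹`-convergent sequence. -/
theorem eventually_lintegral_le_add {α : Type*} [MeasurableSpace α] {μ : Measure α}
    {f : ℕ → α → ℝ≥0∞} {f₀ h g : α → ℝ≥0∞} {gk : ℕ → α → ℝ≥0∞}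
    (hf : ∀ k, AEMeasurable (f k) μ)
    (hlim : ∀ᵐ x ∂μ, Tendsto (fun k => f k x) atTop (𝓝 (f₀ x)))
    (hle : ∀ k, ∀ᵐ x ∂μ, f k x ≤ h x + gk k x) (hh : AEMeasurable h μ) (hg : AEMeasurable g μ)
    (hhfin : ∫⁻ x, h x ∂μ ≠ ⊤) (hgfin : ∫⁻ x, g x ∂μ ≠ ⊤)
    (hgk : Tendsto (fun k => ∫⁻ x, (gk k x - g x) ∂μ) atTop (𝓝 0)) {ε : ℝ≥0∞} (hε : 0 < ε) :
    ∀ᶠ k in atTop, ∫⁻ x, f k x ∂μ ≤ ∫⁻ x, f₀ x ∂μ + ε := by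
  have hsum : ∫⁻ x, (h x + g x) ∂μ ≠ ⊤ := by
    rw [lintegral_add_left' hh]; exact ENNReal.add_ne_top.2 ⟨hhfin, hgfin⟩
  -- Cutting `f k` at `h + g` makes ordinary dominated convergence available; what is cut off is at
  -- most the truncated difference `gk k - g`, whose integral tends to zero.
  have hdct : Tendsto (fun k => ∫⁻ x, min (f k x) (h x + g x) ∂μ) atTop
      (𝓝 (∫⁻ x, min (f₀ x) (h x + g x) ∂μ)) := by
    refine tendsto_lintegral_of_dominated_convergence' (fun x => h x + g x)
      (fun k => (hf k).min (hh.add hg)) (fun k => ae_of_all _ fun x => min_le_right _ _) hsum ?_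
    filter_upwards [hlim] with x hx
    exact hx.min tendsto_const_nhds
  have htot := hdct.add hgk
  rw [add_zero] at htot
  have hfin : ∫⁻ x, min (f₀ x) (h x + g x) ∂μ ≠ ⊤ :=
    ne_top_of_le_ne_top hsum (lintegral_mono fun x => min_le_right _ _)
  filter_upwards [htot.eventually_lt_const (ENNReal.lt_add_right hfin hε.ne')] with k hk
  calc ∫⁻ x, f k x ∂μ ≤ ∫⁻ x, (min (f k x) (h x + g x) + (gk k x - g x)) ∂μ := by
        refine lintegral_mono_ae ?_
        filter_upwards [hle k] with x hx
        rcases le_total (f k x) (h x + g x) with hc | hc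
        · rw [min_eq_left hc]; exact le_self_add
        · rw [min_eq_right hc]
          refine hx.trans ?_
          rw [add_assoc]
          gcongr
          exact le_add_tsub
    _ = ∫⁻ x, min (f k x) (h x + g x) ∂μ + ∫⁻ x, (gk k x - g x) ∂μ :=
        lintegral_add_left' ((hf k).min (hh.add hg)) _
    _ ≤ ∫⁻ x, min (f₀ x) (h x + g x) ∂μ + ε := hk.le
    _ ≤ ∫⁻ x, f₀ x ∂μ + ε := by
        gcongr
        exact min_le_left _ _

theorem IsEvenConvex.half_add_le {Φ : V → ℝ} (h : IsEvenConvex Φ) (a b : V) :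
    Φ ((1 / 2 : ℝ) • (a + b)) ≤ Φ a / 2 + Φ b / 2 := by
  have := h.convex.2 (mem_univ a) (mem_univ b) (show (0 : ℝ) ≤ 1 / 2 by norm_num)
    (show (0 : ℝ) ≤ 1 / 2 by norm_num) (by norm_num)
  rw [smul_add]
  simp only [smul_eq_mul] at this
  linarith

/-- Used with `a` and `c` the gradients of the old and the new test map and `b` the target. It is
responsible for the factor `3` in the scales `3 * (C * lam)` below. -/
theorem IsEvenConvex.third_le {Φ : V → ℝ} (h : IsEvenConvex Φ) (Λ : ℝ) (a b c : V) :
    Φ (Λ⁻¹ • (a + c - b)) ≤ Φ ((3 / Λ) • a) + Φ ((3 / Λ) • b) + Φ ((3 / Λ) • c) := by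
  have h1 := h.convex.2 (mem_univ ((3 / Λ) • a))
    (mem_univ ((1 / 2 : ℝ) • ((3 / Λ) • c + -((3 / Λ) • b))))
    (show (0 : ℝ) ≤ 1 / 3 by norm_num) (show (0 : ℝ) ≤ 2 / 3 by norm_num) (by norm_num)
  have h2 := h.half_add_le ((3 / Λ) • c) (-((3 / Λ) • b))
  rw [← h.even] at h2
  have e : (1 / 3 : ℝ) • (3 / Λ) • a + (2 / 3 : ℝ) • (1 / 2 : ℝ) • ((3 / Λ) • c + -((3 / Λ) • b))
      = Λ⁻¹ • (a + c - b) := by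
    rw [div_eq_mul_inv]; module
  rw [e] at h1
  simp only [smul_eq_mul] at h1
  have h3 := h.nonneg ((3 / Λ) • a)
  have h4 := h.nonneg ((3 / Λ) • b)
  have h5 := h.nonneg ((3 / Λ) • c)
  linarith

theorem IsEvenConvex.smul_le {Φ : V → ℝ} (h : IsEvenConvex Φ) {s : ℝ} (hs : |s| ≤ 1) (w : V) :
    Φ (s • w) ≤ Φ w := by
  rcases le_total 0 s with h0 | h0
  · exact h.convex.map_smul_le_self h.zero h.nonneg h0 ((le_abs_self s).trans hs) w
  · rw [h.even, ← neg_smul]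
    exact h.convex.map_smul_le_self h.zero h.nonneg (neg_nonneg.2 h0)
      ((neg_le_abs s).trans hs) w

theorem IsWeakNFunction.modular_lt_top_of_bounded {M : EuclideanSpace ℝ (Fin n) → V → ℝ}
    (hM : IsWeakNFunction Ω M) (hΩ : MeasurableSet Ω) (hfin : volume Ω ≠ ⊤)
    {w : EuclideanSpace ℝ (Fin n) → V} {R : ℝ}
    (hw : ∀ᵐ x ∂(volume.restrict Ω), ‖w x‖ ≤ R) : modular Ω M w < ⊤ := by
  obtain ⟨m₁, m₂, -, -, -, -, hm₂, hbd⟩ := hM.bounds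
  have h1 : modular Ω M w ≤ ∫⁻ _ in Ω, ENNReal.ofReal (m₂ R) := by
    refine lintegral_mono_ae ?_
    filter_upwards [hw, hbd, hM.ae_isEvenConvex hΩ] with x hx hb hc
    exact ENNReal.ofReal_le_ofReal
      (hc.convex.le_of_norm_le hc.zero hc.nonneg hm₂ (fun w => (hb w).2) hx)
  refine h1.trans_lt ?_
  rw [setLIntegral_const]
  exact ENNReal.mul_lt_top ENNReal.ofReal_lt_top hfin.lt_top

theorem IsWeakNFunction.modular_mono {M : EuclideanSpace ℝ (Fin n) → V → ℝ}
    (hM : IsWeakNFunction Ω M) (hΩ : MeasurableSet Ω)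
    {w : EuclideanSpace ℝ (Fin n) → V} {s : ℝ} (hs : |s| ≤ 1) :
    modular Ω M (fun x => s • w x) ≤ modular Ω M w := by
  refine lintegral_mono_ae ?_
  filter_upwards [hM.ae_isEvenConvex hΩ] with x hx
  exact ENNReal.ofReal_le_ofReal (hx.smul_le hs _)

theorem IsWeakNFunction.modular_half_add_le {M : EuclideanSpace ℝ (Fin n) → V → ℝ}
    (hM : IsWeakNFunction Ω M) (hΩ : MeasurableSet Ω)
    (hMc : ContinuousOn (fun p : EuclideanSpace ℝ (Fin n) × V => M p.1 p.2) (Ω ×ˢ univ))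
    {a b : EuclideanSpace ℝ (Fin n) → V} (ha : AEStronglyMeasurable a (volume.restrict Ω)) :
    modular Ω M (fun x => (1 / 2 : ℝ) • (a x + b x)) ≤ modular Ω M a + modular Ω M b := by
  unfold modular
  rw [← lintegral_add_left' (aemeasurable_comp_of_continuousOn hΩ hMc ha).ennreal_ofReal]
  refine lintegral_mono_ae ?_
  filter_upwards [hM.ae_isEvenConvex hΩ] with x hx
  rw [← ENNReal.ofReal_add (hx.nonneg _) (hx.nonneg _)]
  refine ENNReal.ofReal_le_ofReal ((hx.half_add_le _ _).trans ?_)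
  linarith [hx.nonneg (a x), hx.nonneg (b x)]

end ModularApproximation

/-! ### Approximation by test maps at a fixed modular scale. -/

section TestMapApproximation

variable {n d : ℕ} {Ω : Set (EuclideanSpace ℝ (Fin n))}
  {M : EuclideanSpace ℝ (Fin n) → ColMatrix n d → ℝ}

/-- `ψ` can be approximated in `L¹(Ω)` by test maps bounded by `B`, with gradients approximating `ξ`
in the modular at the fixed scale `Λ`. -/
def ApproxAt (Ω : Set (EuclideanSpace ℝ (Fin n)))
    (M : EuclideanSpace ℝ (Fin n) → ColMatrix n d → ℝ) (Λ B : ℝ)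
    (ψ : EuclideanSpace ℝ (Fin n) → EuclideanSpace ℝ (Fin d))
    (ξ : EuclideanSpace ℝ (Fin n) → ColMatrix n d) : Prop :=
  ∀ ε : ℝ≥0∞, 0 < ε → ∃ u, IsTestMap Ω u ∧ ∫⁻ x in Ω, ‖u x - ψ x‖ₑ ≤ ε ∧
    modular Ω M (fun x => Λ⁻¹ • (gradMap u x - ξ x)) ≤ ε ∧ ∀ x, ‖u x‖ ≤ B

theorem ApproxAt.congr {Λ B : ℝ} {ψ ψ' : EuclideanSpace ℝ (Fin n) → EuclideanSpace ℝ (Fin d)}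
    {ξ ξ' : EuclideanSpace ℝ (Fin n) → ColMatrix n d} (h : ApproxAt Ω M Λ B ψ ξ)
    (hψ : ∀ᵐ x ∂(volume.restrict Ω), ψ x = ψ' x) (hξ : ∀ᵐ x ∂(volume.restrict Ω), ξ x = ξ' x) :
    ApproxAt Ω M Λ B ψ' ξ' := by
  intro ε hε
  obtain ⟨u, hu, h1, h2, h3⟩ := h ε hε
  refine ⟨u, hu, ?_, ?_, h3⟩
  · refine (le_of_eq (lintegral_congr_ae ?_)).trans h1
    filter_upwards [hψ] with x hx
    rw [hx]
  · refine (le_of_eq (lintegral_congr_ae ?_)).trans h2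
    filter_upwards [hξ] with x hx
    rw [hx]

theorem IsTestMap.add {F : Type*} [NormedAddCommGroup F] [NormedSpace ℝ F]
    {u v : EuclideanSpace ℝ (Fin n) → F} (hu : IsTestMap Ω u) (hv : IsTestMap Ω v) :
    IsTestMap Ω (fun x => u x + v x) :=
  ⟨hu.1.add hv.1, hu.2.1.add hv.2.1,
    (tsupport_add u v).trans (union_subset hu.2.2 hv.2.2)⟩

theorem HasCompactSupport.gradMap {u : EuclideanSpace ℝ (Fin n) → EuclideanSpace ℝ (Fin d)}
    (hc : HasCompactSupport u) : HasCompactSupport (gradMap u) := by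
  refine HasCompactSupport.intro hc fun x hx => ?_
  have : u =ᶠ[𝓝 x] 0 := notMem_tsupport_iff_eventuallyEq.1 hx
  ext i : 1
  refine ext_inner_right ℝ fun v => ?_
  rw [inner_gradMap]
  have h2 : (fun y => u y i) =ᶠ[𝓝 x] fun _ => 0 := by
    filter_upwards [this] with y hy
    rw [hy]; rfl
  rw [h2.fderiv_eq]; simp

theorem approxAt_zero (hM : IsWeakNFunction Ω M) {Λ : ℝ} :
    ApproxAt Ω M Λ 0 (fun _ => 0) (fun _ => 0) := by
  intro ε hε
  refine ⟨fun _ => 0, ⟨contDiff_const, HasCompactSupport.zero, ?_⟩, by simp, ?_, by simp⟩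
  · rw [show (fun _ => 0 : EuclideanSpace ℝ (Fin n) → EuclideanSpace ℝ (Fin d)) = 0 from rfl,
      tsupport_zero]
    exact empty_subset _
  · refine le_trans (le_of_eq ?_) zero_le
    refine (lintegral_congr_ae ?_).trans lintegral_zero
    filter_upwards [hM.zero] with x hx
    have : gradMap (fun _ : EuclideanSpace ℝ (Fin n) => (0 : EuclideanSpace ℝ (Fin d))) x = 0 := by
      ext i : 1
      refine ext_inner_right ℝ fun v => ?_
      rw [inner_gradMap]
      simp
    rw [this, sub_zero, smul_zero, hx, ENNReal.ofReal_zero]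

/-- Approximability at a fixed scale is preserved when adding a function with a good approximating
sequence. The scale does not deteriorate. -/
theorem ApproxAt.add (hM : IsWeakNFunction Ω M) (hΩ : MeasurableSet Ω) (hΩfin : volume Ω ≠ ⊤)
    (hMc : ContinuousOn (fun p : EuclideanSpace ℝ (Fin n) × ColMatrix n d => M p.1 p.2)
      (Ω ×ˢ univ)) {Λ B B' : ℝ}
    {ψ ψ' : EuclideanSpace ℝ (Fin n) → EuclideanSpace ℝ (Fin d)}
    {ξ ξ' : EuclideanSpace ℝ (Fin n) → ColMatrix n d} (h : ApproxAt Ω M Λ B ψ ξ)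
    {v : ℕ → EuclideanSpace ℝ (Fin n) → EuclideanSpace ℝ (Fin d)}
    (hξ : AEStronglyMeasurable ξ (volume.restrict Ω))
    (hξ' : AEStronglyMeasurable ξ' (volume.restrict Ω))
    (hψ' : AEStronglyMeasurable ψ' (volume.restrict Ω))
    (hv : ∀ k, IsTestMap Ω (v k)) (hvB : ∀ k x, ‖v k x‖ ≤ B')
    (hv1 : Tendsto (fun k => ∫⁻ x in Ω, ‖v k x - ψ' x‖ₑ) atTop (𝓝 0))
    (hvae : ∀ᵐ x ∂(volume.restrict Ω), Tendsto (fun k => gradMap (v k) x) atTop (𝓝 (ξ' x)))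
    {gk : ℕ → EuclideanSpace ℝ (Fin n) → ℝ≥0∞} {g : EuclideanSpace ℝ (Fin n) → ℝ≥0∞}
    (hg : AEMeasurable g (volume.restrict Ω)) (hgfin : ∫⁻ x in Ω, g x ≠ ⊤)
    (hle : ∀ k, ∀ᵐ x ∂(volume.restrict Ω),
      ENNReal.ofReal (M x ((3 / Λ) • gradMap (v k) x)) ≤ gk k x)
    (hgk : Tendsto (fun k => ∫⁻ x in Ω, (gk k x - g x)) atTop (𝓝 0))
    (hfin : modular Ω M (fun x => (3 / Λ) • (ξ x + ξ' x)) < ⊤) :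
    ApproxAt Ω M Λ (B + B') (fun x => ψ x + ψ' x) (fun x => ξ x + ξ' x) := by
  intro ε hε
  have hε2 : 0 < ε / 2 := ENNReal.half_pos hε.ne'
  obtain ⟨u, hu, hu1, hu2, hu3⟩ := h (ε / 2) hε2
  have cu : Continuous (gradMap u) := continuous_gradMap hu.1
  have cv : ∀ k, Continuous (gradMap (v k)) := fun k => continuous_gradMap (hv k).1
  have hconv := hM.ae_isEvenConvex hΩ
  have p1 : ∀ k, AEMeasurable (fun x => ENNReal.ofReal
      (M x (Λ⁻¹ • (gradMap u x + gradMap (v k) x - (ξ x + ξ' x))))) (volume.restrict Ω) := by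
    intro k
    have h1 : AEStronglyMeasurable
        (fun x => gradMap u x + gradMap (v k) x) (volume.restrict Ω) :=
      (cu.add (cv k)).aestronglyMeasurable
    have h2 : AEStronglyMeasurable
        (fun x => gradMap u x + gradMap (v k) x - (ξ x + ξ' x)) (volume.restrict Ω) :=
      h1.sub (hξ.add hξ')
    exact (aemeasurable_comp_of_continuousOn hΩ hMc (h2.const_smul Λ⁻¹)).ennreal_ofReal
  have p2 : ∀ᵐ x ∂(volume.restrict Ω), Tendsto (fun k => ENNReal.ofReal
      (M x (Λ⁻¹ • (gradMap u x + gradMap (v k) x - (ξ x + ξ' x))))) atTop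
      (𝓝 (ENNReal.ofReal (M x (Λ⁻¹ • (gradMap u x - ξ x))))) := by
    filter_upwards [hvae, hconv] with x hx hc
    -- The new piece cancels in the limit, so the integrand converges to the error of `u` alone at
    -- the same scale `Λ`. The triangle inequality would double the scale at each addition; here it
    -- serves only for the domination.
    have h1 : Tendsto (fun k => Λ⁻¹ • (gradMap u x + gradMap (v k) x - (ξ x + ξ' x))) atTop
        (𝓝 (Λ⁻¹ • (gradMap u x - ξ x))) := by
      have := ((hx.const_add (gradMap u x)).sub_const (ξ x + ξ' x)).const_smul Λ⁻¹
      rwa [add_sub_add_right_eq_sub] at this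
    exact ENNReal.tendsto_ofReal ((hc.continuous.tendsto _).comp h1)
  have p3 : ∀ k, ∀ᵐ x ∂(volume.restrict Ω), ENNReal.ofReal
      (M x (Λ⁻¹ • (gradMap u x + gradMap (v k) x - (ξ x + ξ' x)))) ≤
      (ENNReal.ofReal (M x ((3 / Λ) • gradMap u x)) +
      ENNReal.ofReal (M x ((3 / Λ) • (ξ x + ξ' x)))) + gk k x := by
    intro k
    filter_upwards [hle k, hconv] with x hx hc
    refine (ENNReal.ofReal_le_ofReal (hc.third_le Λ _ _ _)).trans ?_
    rw [ENNReal.ofReal_add (add_nonneg (hc.nonneg _) (hc.nonneg _)) (hc.nonneg _),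
      ENNReal.ofReal_add (hc.nonneg _) (hc.nonneg _)]
    exact add_le_add_right hx _
  have p4 : AEMeasurable (fun x => ENNReal.ofReal (M x ((3 / Λ) • gradMap u x)))
      (volume.restrict Ω) :=
    (aemeasurable_comp_of_continuousOn hΩ hMc
      (cu.aestronglyMeasurable.const_smul (3 / Λ))).ennreal_ofReal
  have p5 : AEMeasurable (fun x => ENNReal.ofReal (M x ((3 / Λ) • (ξ x + ξ' x))))
      (volume.restrict Ω) :=
    (aemeasurable_comp_of_continuousOn hΩ hMc ((hξ.add hξ').const_smul (3 / Λ))).ennreal_ofReal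
  have p6 : ∫⁻ x in Ω, (ENNReal.ofReal (M x ((3 / Λ) • gradMap u x)) +
      ENNReal.ofReal (M x ((3 / Λ) • (ξ x + ξ' x)))) ≠ ⊤ := by
    rw [lintegral_add_left' p4]
    refine ENNReal.add_ne_top.2 ⟨?_, hfin.ne⟩
    obtain ⟨R, hR⟩ := cu.bounded_above_of_compact_support hu.2.1.gradMap
    refine (hM.modular_lt_top_of_bounded hΩ hΩfin (w := fun x => (3 / Λ) • gradMap u x)
      (R := ‖3 / Λ‖ * R) (ae_of_all _ fun x => ?_)).ne
    rw [norm_smul]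
    exact mul_le_mul_of_nonneg_left (hR x) (norm_nonneg _)
  have key := eventually_lintegral_le_add p1 p2 p3 (p4.add p5) hg p6 hgfin hgk hε2
  have ev2 : ∀ᶠ k in atTop, ∫⁻ x in Ω, ‖v k x - ψ' x‖ₑ ≤ ε / 2 :=
    (ENNReal.tendsto_nhds_zero.1 hv1) _ hε2
  obtain ⟨k, hk1, hk2⟩ := (key.and ev2).exists
  refine ⟨fun x => u x + v k x, hu.add (hv k), ?_, ?_, fun x => ?_⟩
  · calc ∫⁻ x in Ω, ‖u x + v k x - (ψ x + ψ' x)‖ₑ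
        ≤ ∫⁻ x in Ω, (‖u x - ψ x‖ₑ + ‖v k x - ψ' x‖ₑ) := by
          refine lintegral_mono fun x => ?_
          rw [add_sub_add_comm]
          exact enorm_add_le _ _
      _ = (∫⁻ x in Ω, ‖u x - ψ x‖ₑ) + ∫⁻ x in Ω, ‖v k x - ψ' x‖ₑ := by
          have h1 : AEStronglyMeasurable (fun x => v k x - ψ' x) (volume.restrict Ω) :=
            (hv k).1.continuous.aestronglyMeasurable.sub hψ'
          exact lintegral_add_right' _ h1.enorm
      _ ≤ ε / 2 + ε / 2 := add_le_add hu1 hk2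
      _ = ε := ENNReal.add_halves ε
  · calc modular Ω M (fun x => Λ⁻¹ • (gradMap (fun x => u x + v k x) x - (ξ x + ξ' x)))
        = ∫⁻ x in Ω, ENNReal.ofReal
            (M x (Λ⁻¹ • (gradMap u x + gradMap (v k) x - (ξ x + ξ' x)))) := by
          refine lintegral_congr fun x => ?_
          simp only [gradMap_add hu.1 (hv k).1]
      _ ≤ _ := hk1
      _ ≤ ε / 2 + ε / 2 := by
          gcongr
          exact hu2
      _ = ε := ENNReal.add_halves ε
  · exact (norm_add_le _ _).trans (add_le_add (hu3 x) (hvB k x))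

end TestMapApproximation

/-! ### Mollifying one localized piece into the domain. -/

section InwardMollification

open scoped Pointwise

variable {n d : ℕ} {Ω : Set (EuclideanSpace ℝ (Fin n))}

/-- There are mollifiers of scale `t`, with derivatives bounded by `D / t` in `L¹`, which move the
part of `closure Ω` in `K` into `Ω`. -/
def TranslatesInto (Ω K : Set (EuclideanSpace ℝ (Fin n))) (D : ℝ) : Prop :=
  0 ≤ D ∧ ∃ t₀ : ℝ, 0 < t₀ ∧ ∀ t : ℝ, 0 < t → t < t₀ →
    ∃ (κ : EuclideanSpace ℝ (Fin n) → ℝ) (s : Set (EuclideanSpace ℝ (Fin n))),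
      IsMollifier κ s ∧ IsCompact s ∧ s ⊆ Metric.closedBall 0 (2 * t) ∧
      (∀ y ∈ closure Ω, y ∈ K → ∀ e ∈ s, y + e ∈ Ω) ∧
      Integrable (fun z => ‖fderiv ℝ κ z‖) ∧ ∫ z, ‖fderiv ℝ κ z‖ ≤ D / t

theorem IsBoundedLipschitzDomain.exists_translatesInto (hΩ : IsBoundedLipschitzDomain Ω)
    {z : EuclideanSpace ℝ (Fin n)} (hz : z ∈ closure Ω) :
    ∃ ρ D : ℝ, 0 < ρ ∧ TranslatesInto Ω (Metric.ball z ρ) D := by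
  obtain ⟨ν, a, ρ, t₀, hν, ha, ha1, hρ, ht₀, htr⟩ := hΩ.exists_translation hz
  obtain ⟨D, hD, hκ⟩ := exists_isMollifier ν ha
  refine ⟨ρ, D, hρ, hD, t₀, ht₀, fun t ht htt => ?_⟩
  obtain ⟨κ, h1, h2, h3⟩ := hκ t ht
  refine ⟨κ, _, h1, isCompact_closedBall _ _, ?_, ?_, h2, h3⟩
  · refine Metric.closedBall_subset_closedBall' ?_
    rw [dist_zero_right, norm_smul, Real.norm_of_nonneg ht.le]
    nlinarith
  · intro y hy hyz e he
    refine htr y hy hyz t ht htt ?_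
    rw [Metric.mem_closedBall, dist_eq_norm] at he ⊢
    rwa [add_sub_add_left_eq_sub]

theorem IsMollifier.mono {κ : EuclideanSpace ℝ (Fin n) → ℝ}
    {s s' : Set (EuclideanSpace ℝ (Fin n))} (h : IsMollifier κ s) (hs : s ⊆ s') :
    IsMollifier κ s' :=
  ⟨h.1, h.2, h.3, h.4, fun z hz => h.5 z fun hz' => hz (hs hz')⟩

theorem IsMollifier.isTestMap {F : Type*} [NormedAddCommGroup F] [NormedSpace ℝ F]
    [CompleteSpace F] {κ : EuclideanSpace ℝ (Fin n) → ℝ}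
    {s K : Set (EuclideanSpace ℝ (Fin n))} (h : IsMollifier κ s) (hs : IsCompact s)
    (hK : IsCompact K) (hsub : ∀ y ∈ K, ∀ e ∈ s, y + e ∈ Ω)
    {ψ : EuclideanSpace ℝ (Fin n) → F} (hψ : Integrable ψ) (hψ0 : ∀ y, y ∉ K → ψ y = 0) :
    IsTestMap Ω (mollify κ ψ) := by
  have hKs : IsCompact (K + s) := hK.add hs
  have h0 : ∀ x, x ∉ K + s → mollify κ ψ x = 0 := by
    intro x hx
    by_contra hne
    obtain ⟨y, hy, hxy⟩ := h.exists_of_mollify_ne_zero hne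
    exact hx ⟨y, not_not.1 fun hyK => hy (hψ0 y hyK), x - y, hxy, by simp⟩
  refine ⟨contDiff_mollify h.contDiff h.hasCompactSupport hψ,
    HasCompactSupport.intro hKs h0, ?_⟩
  have h1 : tsupport (mollify κ ψ) ⊆ K + s :=
    closure_minimal (fun x hx => not_not.1 fun hxs => hx (h0 x hxs)) hKs.isClosed
  refine h1.trans ?_
  rintro _ ⟨y, hy, e, he, rfl⟩
  exact hsub y hy e he

theorem mollify_const_smul {F : Type*} [NormedAddCommGroup F] [NormedSpace ℝ F]
    (κ : EuclideanSpace ℝ (Fin n) → ℝ) (a : ℝ) (f : EuclideanSpace ℝ (Fin n) → F)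
    (x : EuclideanSpace ℝ (Fin n)) : mollify κ (fun y => a • f y) x = a • mollify κ f x := by
  unfold mollify
  rw [← integral_smul]
  simp_rw [smul_comm a]

theorem norm_piLp_two_le_sum {ι : Type*} [Fintype ι] {F : ι → Type*}
    [∀ i, NormedAddCommGroup (F i)] (x : PiLp 2 F) : ‖x‖ ≤ ∑ i, ‖x i‖ := by
  rw [PiLp.norm_eq_of_L2]
  refine Real.sqrt_le_iff.2 ⟨Finset.sum_nonneg fun i _ => norm_nonneg _, ?_⟩
  exact Finset.sum_sq_le_sq_sum_of_nonneg fun i _ => norm_nonneg _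

/-- The oscillation over the kernel is at most `H * (2 * t) ^ γ` and the derivative of the kernel
costs `D / t`, which gives the growth `t ^ (γ - 1)` admitted by `MollifyBound`. For `γ = 0` the
hypothesis only bounds the oscillation. -/
theorem norm_mollify_gradient_le {ψ : EuclideanSpace ℝ (Fin n) → EuclideanSpace ℝ (Fin d)}
    {ξ : EuclideanSpace ℝ (Fin n) → ColMatrix n d}
    (h : ∀ i, HasIntegrableGradient (fun x => ψ x i) (fun x => ξ x i)) {H γ D t : ℝ}
    (hH : 0 ≤ H) (hγ : 0 ≤ γ) (ht : 0 < t) (hψ : ∀ x y, ‖ψ x - ψ y‖ ≤ H * ‖x - y‖ ^ γ)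
    {κ : EuclideanSpace ℝ (Fin n) → ℝ} {s : Set (EuclideanSpace ℝ (Fin n))}
    (hκ : IsMollifier κ s) (hs : IsCompact s) (hst : s ⊆ Metric.closedBall 0 (2 * t))
    (hi : Integrable (fun z => ‖fderiv ℝ κ z‖)) (hD : ∫ z, ‖fderiv ℝ κ z‖ ≤ D / t)
    (x : EuclideanSpace ℝ (Fin n)) :
    ‖mollify κ ξ x‖ ≤ d * H * 2 ^ γ * D * t ^ (γ - 1) := by
  have hξ : Integrable ξ := integrable_piLp_iff.2 fun i => (h i).integrable_gradient
  have hcomp : ∀ i, ‖mollify κ ξ x i‖ ≤ H * (2 * t) ^ γ * (D / t) := by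
    intro i
    rw [mollify_apply hκ.contDiff.continuous hκ.hasCompactSupport hξ,
      ← (h i).gradient_mollify hκ.contDiff hκ.hasCompactSupport]
    refine (norm_gradient_mollify_le (h i).integrable hκ hs.isClosed (H := H * (2 * t) ^ γ)
      (by positivity) (fun y hy => ?_) hi).trans
      (mul_le_mul_of_nonneg_left hD (by positivity))
    have h1 : ‖y - x‖ ≤ 2 * t := by
      have := hst hy
      rwa [mem_closedBall_zero_iff, norm_sub_rev] at this
    calc |ψ y i - ψ x i| = ‖(ψ y - ψ x) i‖ := rfl
      _ ≤ ‖ψ y - ψ x‖ := PiLp.norm_apply_le _ i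
      _ ≤ H * ‖y - x‖ ^ γ := hψ y x
      _ ≤ H * (2 * t) ^ γ := by gcongr
  calc ‖mollify κ ξ x‖ ≤ ∑ i, ‖mollify κ ξ x i‖ := norm_piLp_two_le_sum _
    _ ≤ ∑ _i : Fin d, H * (2 * t) ^ γ * (D / t) := Finset.sum_le_sum fun i _ => hcomp i
    _ = d * H * 2 ^ γ * D * t ^ (γ - 1) := by
      rw [Finset.sum_const, Finset.card_univ, Fintype.card_fin, nsmul_eq_mul,
        Real.mul_rpow (by norm_num) ht.le, Real.rpow_sub_one ht.ne']
      ring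

variable {M : EuclideanSpace ℝ (Fin n) → ColMatrix n d → ℝ}

/-- Inward mollifications of `ψ'` are test maps converging to it, and `hsmall` puts their gradients
within reach of `MollifyBound`; the mollified integrand is then the dominating sequence needed in
`ApproxAt.add`. -/
theorem ApproxAt.add_piece (hM : IsWeakNFunction Ω M) (hΩ : IsOpen Ω)
    (hΩb : Bornology.IsBounded Ω)
    (hMc : ContinuousOn (fun p : EuclideanSpace ℝ (Fin n) × ColMatrix n d => M p.1 p.2)
      (Ω ×ˢ univ)) {γ C A b lam D H B B' : ℝ} (hγ : 0 ≤ γ) (hC : 1 ≤ C) (hA : 0 < A)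
    (hlam : 0 < lam) (hbal : MollifyBound Ω γ M C A b)
    {K : Set (EuclideanSpace ℝ (Fin n))} (hK : IsClosed K) (hTr : TranslatesInto Ω K D)
    {ψ ψ' : EuclideanSpace ℝ (Fin n) → EuclideanSpace ℝ (Fin d)}
    {ξ ξ' : EuclideanSpace ℝ (Fin n) → ColMatrix n d}
    (h : ApproxAt Ω M (3 * (C * lam)) B ψ ξ)
    (hξ : AEStronglyMeasurable ξ (volume.restrict Ω))
    (hg : ∀ i, HasIntegrableGradient (fun x => ψ' x i) (fun x => ξ' x i))
    (hψ0 : ∀ x, x ∉ Ω → ψ' x = 0) (hξ0 : ∀ x, x ∉ Ω → ξ' x = 0) (hψK : ∀ x, x ∉ K → ψ' x = 0)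
    (hH : 0 ≤ H) (hhol : ∀ x y, ‖ψ' x - ψ' y‖ ≤ H * ‖x - y‖ ^ γ) (hB' : ∀ᵐ x, ‖ψ' x‖ ≤ B')
    (hsmall : lam⁻¹ * (d * H * 2 ^ γ * D) ≤ b)
    (hmod : modular Ω M (fun x => lam⁻¹ • ξ' x) < ⊤)
    (hfin : modular Ω M (fun x => (C * lam)⁻¹ • (ξ x + ξ' x)) < ⊤) :
    ApproxAt Ω M (3 * (C * lam)) (B + B') (fun x => ψ x + ψ' x) (fun x => ξ x + ξ' x) := by
  have hΩm := hΩ.measurableSet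
  have hΩfin : volume Ω ≠ ⊤ := hΩb.measure_lt_top.ne
  have hψi : Integrable ψ' := integrable_piLp_iff.2 fun i => (hg i).integrable
  have hξi : Integrable ξ' := integrable_piLp_iff.2 fun i => (hg i).integrable_gradient
  have hscale : 3 / (3 * (C * lam)) = (C * lam)⁻¹ := by
    have : C ≠ 0 := by positivity
    field_simp
  obtain ⟨-, t₀, ht₀, hκ⟩ := hTr
  -- Scales below `t₀` keep the mollified piece inside the domain; scales at most `1 / 4` make the
  -- balls of radius `4 * t` admissible in the balance condition.
  set T : ℝ := min (t₀ / 2) (1 / 4) with hT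
  have hT0 : 0 < T := by positivity
  let t : ℕ → ℝ := fun k => T * (1 / ((k : ℝ) + 1))
  have htpos : ∀ k, 0 < t k := fun k => by positivity
  have htT : ∀ k, t k ≤ T := fun k => mul_le_of_le_one_right hT0.le (by
    rw [div_le_one (by positivity)]; linarith [(Nat.cast_nonneg k : (0 : ℝ) ≤ k)])
  have ht1 : ∀ k, t k < t₀ := fun k => by
    have := (htT k).trans (min_le_left _ _); linarith
  have ht2 : ∀ k, 4 * t k ≤ 1 := fun k => by
    have := (htT k).trans (min_le_right _ _); linarith
  have htlim : Tendsto t atTop (𝓝 0) := by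
    have := (tendsto_one_div_add_atTop_nhds_zero_nat (𝕜 := ℝ)).const_mul T
    rwa [mul_zero] at this
  choose κ s hκs hsc hst htr hdi hdD using fun k => hκ (t k) (htpos k) (ht1 k)
  have hκB : ∀ k, IsMollifier (κ k) (Metric.closedBall 0 (2 * t k)) := fun k =>
    (hκs k).mono (hst k)
  have hsmallsets : Tendsto s atTop (𝓝 0).smallSets := by
    rw [(Metric.nhds_basis_closedBall).smallSets.tendsto_right_iff]
    intro ε hε
    have h2 : Tendsto (fun k => 2 * t k) atTop (𝓝 0) := by simpa using htlim.const_mul 2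
    filter_upwards [h2.eventually_lt_const hε] with k hk
    exact (hst k).trans (Metric.closedBall_subset_closedBall hk.le)
  have hcpt : IsCompact (closure Ω ∩ K) := hΩb.isCompact_closure.inter_right hK
  have htest : ∀ k, IsTestMap Ω (mollify (κ k) ψ') := fun k =>
    (hκs k).isTestMap (hsc k) hcpt (fun y hy e he => htr k y hy.1 hy.2 e he) hψi fun y hy => by
      by_cases hyΩ : y ∈ Ω
      · exact hψK y fun hyK => hy ⟨subset_closure hyΩ, hyK⟩
      · exact hψ0 y hyΩ
  have hgrad : ∀ k, gradMap (mollify (κ k) ψ') = mollify (κ k) ξ' := fun k =>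
    gradMap_mollify hg (hκs k).contDiff (hκs k).hasCompactSupport
  have l1ψ := tendsto_lintegral_mollify_sub hκs hsmallsets hψi
  have l1ξ := tendsto_lintegral_mollify_sub hκs hsmallsets hξi
  obtain ⟨ns, hns, hae⟩ := exists_subseq_tendsto_ae_of_lintegral
    (fun k => (contDiff_mollify (hκs k).contDiff (hκs k).hasCompactSupport
      hξi).continuous.aestronglyMeasurable) hξi.1 l1ξ
  let F : EuclideanSpace ℝ (Fin n) → ℝ := Ω.indicator fun y => M y (lam⁻¹ • ξ' y)
  have hF0 : ∀ y, 0 ≤ F y := fun y => indicator_nonneg (fun y hy => hM.nonneg y hy _) y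
  have hFmeas : AEMeasurable (fun y => M y (lam⁻¹ • ξ' y)) (volume.restrict Ω) :=
    aemeasurable_comp_of_continuousOn hΩm hMc (hξi.1.restrict.const_smul lam⁻¹)
  have hFint : Integrable F := by
    refine (integrable_indicator_iff hΩm).2 ⟨hFmeas.aestronglyMeasurable, ?_⟩
    rw [hasFiniteIntegral_iff_ofReal]
    · exact hmod
    · filter_upwards [ae_restrict_mem hΩm] with y hy using hM.nonneg y hy _
  have l1F := (tendsto_lintegral_mollify_sub hκs hsmallsets hFint).comp hns.tendsto_atTop
  refine ApproxAt.add hM hΩm hΩfin hMc h (v := fun k => mollify (κ (ns k)) ψ') hξ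
    hξi.1.restrict hψi.1.restrict (fun k => htest (ns k))
    (fun k x => (hκs (ns k)).norm_mollify_le hB' x) ?_ ?_
    (gk := fun k x => ENNReal.ofReal (A * (mollify (κ (ns k)) F x + 1)))
    (g := fun x => ENNReal.ofReal (A * (F x + 1))) ?_ ?_ ?_ ?_ ?_
  · refine tendsto_of_tendsto_of_tendsto_of_le_of_le tendsto_const_nhds
      (l1ψ.comp hns.tendsto_atTop) (fun _ => zero_le) fun k => ?_
    exact lintegral_mono' Measure.restrict_le_self le_rfl
  · simp_rw [hgrad]
    exact ae_restrict_of_ae hae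
  · exact ((hFint.1.restrict.aemeasurable.add_const 1).const_mul A).ennreal_ofReal
  · have : Integrable (fun x => A * (F x + 1)) (volume.restrict Ω) :=
      (hFint.restrict.add (integrableOn_const hΩfin)).const_mul A
    exact (hasFiniteIntegral_iff_ofReal (ae_of_all _ fun x =>
      mul_nonneg hA.le (by linarith [hF0 x]))).1 this.2 |>.ne
  · intro k
    have hb := hbal (t (ns k)) (κ (ns k)) (fun y => lam⁻¹ • ξ' y) F (htpos _) (ht2 _) (hκB _)
      (hξi.smul lam⁻¹) hFint hF0
      (fun y hy => by simp [F, hy]) (fun y hy => by simp [hξ0 y hy]) (fun x => ?_)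
    · filter_upwards [hb] with x hx
      refine ENNReal.ofReal_le_ofReal ((le_of_eq ?_).trans hx)
      rw [hscale, hgrad, mollify_const_smul, smul_smul, mul_inv]
    · rw [mollify_const_smul, norm_smul, norm_inv, Real.norm_of_nonneg hlam.le]
      have h1 := norm_mollify_gradient_le hg hH hγ (htpos (ns k)) hhol (hκs _) (hsc _) (hst _)
        (hdi _) (hdD _) x
      calc _ ≤ lam⁻¹ * (d * H * 2 ^ γ * D * t (ns k) ^ (γ - 1)) :=
            mul_le_mul_of_nonneg_left h1 (inv_nonneg.2 hlam.le)
        _ = lam⁻¹ * (d * H * 2 ^ γ * D) * t (ns k) ^ (γ - 1) := by ring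
        _ ≤ b * t (ns k) ^ (γ - 1) :=
            mul_le_mul_of_nonneg_right hsmall (Real.rpow_nonneg (htpos _).le _)
  · have h2 : Tendsto (fun k => ENNReal.ofReal A * ∫⁻ x, ‖mollify (κ (ns k)) F x - F x‖ₑ) atTop
        (𝓝 0) := by
      simpa using ENNReal.Tendsto.const_mul l1F (Or.inr ENNReal.ofReal_ne_top)
    refine tendsto_of_tendsto_of_tendsto_of_le_of_le tendsto_const_nhds h2 (fun _ => zero_le)
      fun k => ?_
    rw [← lintegral_const_mul' _ _ ENNReal.ofReal_ne_top]
    refine (lintegral_mono' Measure.restrict_le_self le_rfl).trans (lintegral_mono fun x => ?_)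
    rw [← ENNReal.ofReal_sub _ (mul_nonneg hA.le (by linarith [hF0 x])), ← ofReal_norm,
      ← ENNReal.ofReal_mul hA.le]
    refine ENNReal.ofReal_le_ofReal ?_
    rw [← mul_sub, add_sub_add_right_eq_sub]
    exact mul_le_mul_of_nonneg_left (le_abs_self _) hA.le
  · rw [hscale]; exact hfin

end InwardMollification

/-! ### Cut-offs, subdivided partitions of unity, and bounded Hölder maps. -/

section ProductGradient

variable {n d : ℕ} {Ω : Set (EuclideanSpace ℝ (Fin n))}

/-- The gradient of the product `θ • φ`, where `G` is the gradient of `φ`. -/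
noncomputable def prodGrad (θ : EuclideanSpace ℝ (Fin n) → ℝ)
    (φ : EuclideanSpace ℝ (Fin n) → EuclideanSpace ℝ (Fin d))
    (G : EuclideanSpace ℝ (Fin n) → ColMatrix n d) (x : EuclideanSpace ℝ (Fin n)) :
    ColMatrix n d :=
  θ x • G x + WithLp.toLp 2 fun i => φ x i • gradient θ x

variable {φ : EuclideanSpace ℝ (Fin n) → EuclideanSpace ℝ (Fin d)}
  {G : EuclideanSpace ℝ (Fin n) → ColMatrix n d} {θ θ' : EuclideanSpace ℝ (Fin n) → ℝ}

theorem hasIntegrableGradient_prodGrad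
    (h : ∀ i, HasIntegrableGradient (fun x => φ x i) (fun x => G x i)) (hθ : ContDiff ℝ ∞ θ)
    (hc : HasCompactSupport θ) (i : Fin d) :
    HasIntegrableGradient (fun x => (θ x • φ x) i) (fun x => prodGrad θ φ G x i) :=
  (h i).mul hθ hc

theorem prodGrad_add (hθ : ContDiff ℝ ∞ θ) (hθ' : ContDiff ℝ ∞ θ')
    (x : EuclideanSpace ℝ (Fin n)) :
    prodGrad (fun x => θ x + θ' x) φ G x = prodGrad θ φ G x + prodGrad θ' φ G x := by
  have h : gradient (fun x => θ x + θ' x) x = gradient θ x + gradient θ' x := by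
    refine ext_inner_right ℝ fun v => ?_
    rw [inner_add_left, inner_gradient_left, inner_gradient_left, inner_gradient_left,
      fderiv_fun_add (hθ.differentiable (by simp) x) (hθ'.differentiable (by simp) x)]
    rfl
  ext i : 1
  simp only [prodGrad, h, PiLp.add_apply, PiLp.smul_apply, smul_add, add_smul]
  abel

theorem prodGrad_of_eventuallyEq_const {x : EuclideanSpace ℝ (Fin n)} {a : ℝ}
    (h : θ =ᶠ[𝓝 x] fun _ => a) : prodGrad θ φ G x = a • G x := by
  have h1 : gradient θ x = 0 := by
    refine ext_inner_right ℝ fun v => ?_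
    rw [inner_gradient_left, h.fderiv_eq]
    simp
  ext i : 1
  simp [prodGrad, h1, h.eq_of_nhds]

theorem norm_toLp_smul_le (a : EuclideanSpace ℝ (Fin d)) (v : EuclideanSpace ℝ (Fin n)) :
    ‖(WithLp.toLp 2 fun i => a i • v : ColMatrix n d)‖ ≤ d * ‖a‖ * ‖v‖ := by
  refine (norm_piLp_two_le_sum _).trans ?_
  calc _ ≤ ∑ _i : Fin d, ‖a‖ * ‖v‖ := by
        refine Finset.sum_le_sum fun i _ => ?_
        rw [norm_smul]
        gcongr
        exact PiLp.norm_apply_le a i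
    _ = d * ‖a‖ * ‖v‖ := by
        rw [Finset.sum_const, Finset.card_univ, Fintype.card_fin, nsmul_eq_mul, mul_assoc]

/-- A Lipschitz bounded cut-off is `γ`-Hölder because `γ ≤ 1`: the Lipschitz bound serves at
distances below `1`, the sup bound above. -/
theorem holder_smul {γ H B : ℝ} (hγ0 : 0 ≤ γ) (hγ : γ ≤ 1) (hH : 0 ≤ H)
    (hφ : ∀ x y, ‖φ x - φ y‖ ≤ H * ‖x - y‖ ^ γ) (hB0 : 0 ≤ B) (hB : ∀ x, ‖φ x‖ ≤ B)
    (hθ : ContDiff ℝ ∞ θ) (hc : HasCompactSupport θ) :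
    ∃ H', 0 ≤ H' ∧ ∀ x y, ‖θ x • φ x - θ y • φ y‖ ≤ H' * ‖x - y‖ ^ γ := by
  obtain ⟨a, ha⟩ := hθ.continuous.bounded_above_of_compact_support hc
  obtain ⟨L, hL⟩ := (hθ.lipschitzWith_of_hasCompactSupport hc (by simp) : ∃ L, LipschitzWith L θ)
  have ha0 : 0 ≤ a := (norm_nonneg _).trans (ha 0)
  have h2 : ∀ x y, ‖θ x - θ y‖ ≤ (L + 2 * a) * ‖x - y‖ ^ γ := by
    intro x y
    rcases le_total ‖x - y‖ 1 with h | h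
    · calc ‖θ x - θ y‖ ≤ L * ‖x - y‖ := hL.norm_sub_le x y
        _ ≤ L * ‖x - y‖ ^ γ := by
          gcongr
          rcases (norm_nonneg (x - y)).eq_or_lt with h0 | h0
          · rw [← h0]; exact Real.rpow_nonneg le_rfl _
          · simpa using Real.rpow_le_rpow_of_exponent_ge h0 h hγ
        _ ≤ _ := by gcongr; linarith
    · calc ‖θ x - θ y‖ ≤ ‖θ x‖ + ‖θ y‖ := norm_sub_le _ _
        _ ≤ (L + 2 * a) * 1 := by linarith [ha x, ha y, L.coe_nonneg]
        _ ≤ _ := by gcongr; exact Real.one_le_rpow h hγ0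
  refine ⟨a * H + (L + 2 * a) * B, by positivity, fun x y => ?_⟩
  have e : θ x • φ x - θ y • φ y = θ x • (φ x - φ y) + (θ x - θ y) • φ y := by module
  rw [e]
  refine (norm_add_le _ _).trans ?_
  rw [norm_smul, norm_smul]
  calc _ ≤ a * (H * ‖x - y‖ ^ γ) + (L + 2 * a) * ‖x - y‖ ^ γ * B := by
        gcongr
        · exact ha x
        · exact hφ x y
        · exact h2 x y
        · exact hB y
    _ = _ := by ring

variable {M : EuclideanSpace ℝ (Fin n) → ColMatrix n d → ℝ}

/-- Half of the dilation goes to `θ • G`, controlled by `|θ| ≤ 1`, and half to the term with `∇θ`,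
which is bounded because `φ` is. Hence the scale `2 * lam`, whatever the size of `∇θ`. -/
theorem IsWeakNFunction.modular_prodGrad_lt_top (hM : IsWeakNFunction Ω M)
    (hΩ : MeasurableSet Ω) (hΩfin : volume Ω ≠ ⊤)
    (hMc : ContinuousOn (fun p : EuclideanSpace ℝ (Fin n) × ColMatrix n d => M p.1 p.2)
      (Ω ×ˢ univ)) (hG : AEStronglyMeasurable G (volume.restrict Ω)) {lam B : ℝ}
    (hB0 : 0 ≤ B) (hB : ∀ x, ‖φ x‖ ≤ B) (hfin : modular Ω M (fun x => lam⁻¹ • G x) < ⊤)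
    (hθ : ContDiff ℝ ∞ θ) (hc : HasCompactSupport θ) (h1 : ∀ x, |θ x| ≤ 1) :
    modular Ω M (fun x => (2 * lam)⁻¹ • prodGrad θ φ G x) < ⊤ := by
  obtain ⟨a, ha⟩ := (continuous_gradient hθ).bounded_above_of_compact_support hc.gradient
  have e : (fun x => (2 * lam)⁻¹ • prodGrad θ φ G x) = fun x => (1 / 2 : ℝ) •
      (θ x • lam⁻¹ • G x +
        lam⁻¹ • (WithLp.toLp 2 fun i => φ x i • gradient θ x : ColMatrix n d)) := by
    funext x
    rw [prodGrad, mul_inv]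
    module
  have hmeas : AEStronglyMeasurable (fun x => θ x • lam⁻¹ • G x) (volume.restrict Ω) :=
    hθ.continuous.aestronglyMeasurable.smul (hG.const_smul lam⁻¹)
  rw [e]
  refine (hM.modular_half_add_le hΩ hMc hmeas).trans_lt (ENNReal.add_lt_top.2 ⟨?_, ?_⟩)
  · refine lt_of_le_of_lt (lintegral_mono_ae ?_) hfin
    filter_upwards [hM.ae_isEvenConvex hΩ] with x hx
    exact ENNReal.ofReal_le_ofReal (hx.smul_le (h1 x) _)
  · refine hM.modular_lt_top_of_bounded hΩ hΩfin (R := |lam⁻¹| * (d * B * a))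
      (ae_of_all _ fun x => ?_)
    rw [norm_smul, Real.norm_eq_abs]
    refine mul_le_mul_of_nonneg_left ((norm_toLp_smul_le _ _).trans ?_) (abs_nonneg _)
    gcongr
    · exact hB x
    · exact ha x

/-- The scale is the same for every finite set of pieces. The modular of the accumulated gradient
stays finite at scale `2 * lam` because each partial sum of the cut-offs is again a cut-off with
values in `[0, 1]`. -/
theorem approxAt_sum_smul (hM : IsWeakNFunction Ω M) (hΩ : IsOpen Ω)
    (hΩb : Bornology.IsBounded Ω)
    (hMc : ContinuousOn (fun p : EuclideanSpace ℝ (Fin n) × ColMatrix n d => M p.1 p.2)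
      (Ω ×ˢ univ)) {γ C A b lam B : ℝ} (hγ : 0 ≤ γ) (hC : 1 ≤ C) (hA : 0 < A)
    (hlam : 0 < lam) (hbal : MollifyBound Ω γ M C A b)
    (hg : ∀ i, HasIntegrableGradient (fun x => φ x i) (fun x => G x i))
    (hφ0 : ∀ x, x ∉ Ω → φ x = 0) (hG0 : ∀ x, x ∉ Ω → G x = 0)
    (hB0 : 0 ≤ B) (hB : ∀ x, ‖φ x‖ ≤ B) (hfin : modular Ω M (fun x => lam⁻¹ • G x) < ⊤)
    {ι : Type*} {θ : ι → EuclideanSpace ℝ (Fin n) → ℝ} {D H B' : ι → ℝ}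
    (hθ : ∀ i, ContDiff ℝ ∞ (θ i)) (hc : ∀ i, HasCompactSupport (θ i)) (hθ0 : ∀ i x, 0 ≤ θ i x)
    (hTr : ∀ i, TranslatesInto Ω (tsupport (θ i)) (D i)) (hH : ∀ i, 0 ≤ H i)
    (hhol : ∀ i x y, ‖θ i x • φ x - θ i y • φ y‖ ≤ H i * ‖x - y‖ ^ γ)
    (hsmall : ∀ i, (2 * lam)⁻¹ * (d * H i * 2 ^ γ * D i) ≤ b)
    (hB' : ∀ i x, ‖θ i x • φ x‖ ≤ B' i) (s : Finset ι) (hs : ∀ x, ∑ i ∈ s, θ i x ≤ 1) :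
    ApproxAt Ω M (3 * (C * (2 * lam))) (∑ i ∈ s, B' i) (fun x => (∑ i ∈ s, θ i x) • φ x)
      (prodGrad (fun x => ∑ i ∈ s, θ i x) φ G) := by
  classical
  have hGi : Integrable G := integrable_piLp_iff.2 fun i => (hg i).integrable_gradient
  have hsumsm : ∀ s : Finset ι, ContDiff ℝ ∞ fun x => ∑ i ∈ s, θ i x := fun s =>
    ContDiff.sum fun i _ => hθ i
  have hsumc : ∀ s : Finset ι, HasCompactSupport fun x => ∑ i ∈ s, θ i x := by
    intro s
    induction s using Finset.induction_on with
    | empty => simp only [Finset.sum_empty]; exact HasCompactSupport.zero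
    | insert a s ha ih => simp_rw [Finset.sum_insert ha]; exact (hc a).add ih
  have hmod : ∀ s : Finset ι, (∀ x, ∑ i ∈ s, θ i x ≤ 1) →
      modular Ω M (fun x => (2 * lam)⁻¹ • prodGrad (fun x => ∑ i ∈ s, θ i x) φ G x) < ⊤ :=
    fun s hs => hM.modular_prodGrad_lt_top hΩ.measurableSet hΩb.measure_lt_top.ne hMc
      hGi.1.restrict hB0 hB hfin (hsumsm s) (hsumc s) fun x => by
        rw [abs_of_nonneg (Finset.sum_nonneg fun i _ => hθ0 i x)]; exact hs x
  induction s using Finset.induction_on with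
  | empty =>
    refine (approxAt_zero hM).congr (ae_of_all _ fun x => by simp) (ae_of_all _ fun x => ?_)
    rw [prodGrad_of_eventuallyEq_const (a := 0) (by simp), zero_smul]
  | insert a s ha ih =>
    have hs' : ∀ x, ∑ i ∈ s, θ i x ≤ 1 := fun x =>
      (Finset.sum_le_sum_of_subset_of_nonneg (Finset.subset_insert a s)
        fun i _ _ => hθ0 i x).trans (hs x)
    have ha1 : ∀ x, θ a x ≤ 1 := fun x =>
      (Finset.single_le_sum (f := fun i => θ i x) (fun i _ => hθ0 i x)
        (Finset.mem_insert_self a s)).trans (hs x)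
    have hsplit : ∀ x, prodGrad (fun x => ∑ i ∈ insert a s, θ i x) φ G x =
        prodGrad (fun x => ∑ i ∈ s, θ i x) φ G x + prodGrad (θ a) φ G x := by
      intro x
      simp_rw [Finset.sum_insert ha]
      rw [prodGrad_add (hθ a) (hsumsm s), add_comm]
    have hmeas : AEStronglyMeasurable (prodGrad (fun x => ∑ i ∈ s, θ i x) φ G)
        (volume.restrict Ω) := by
      have : Integrable (prodGrad (fun x => ∑ i ∈ s, θ i x) φ G) := integrable_piLp_iff.2
        fun i => (hasIntegrableGradient_prodGrad hg (hsumsm s) (hsumc s) i).integrable_gradient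
      exact this.1.restrict
    have hnot : ∀ x, x ∉ tsupport (θ a) → θ a x = 0 := fun x hx => image_eq_zero_of_notMem_tsupport hx
    have h2lam : 0 < 2 * lam := by positivity
    have hzero : ∀ x, x ∉ Ω → prodGrad (θ a) φ G x = 0 := fun x hx => by
      ext i : 1
      simp [prodGrad, hφ0 x hx, hG0 x hx]
    have hmoda : modular Ω M (fun x => (2 * lam)⁻¹ • prodGrad (θ a) φ G x) < ⊤ := by
      simpa using hmod {a} (by simpa using ha1)
    have hmods : modular Ω M (fun x => (C * (2 * lam))⁻¹ •
        (prodGrad (fun x => ∑ i ∈ s, θ i x) φ G x + prodGrad (θ a) φ G x)) < ⊤ := by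
      have e : (fun x => (C * (2 * lam))⁻¹ •
          (prodGrad (fun x => ∑ i ∈ s, θ i x) φ G x + prodGrad (θ a) φ G x)) =
          fun x => C⁻¹ • (2 * lam)⁻¹ • prodGrad (fun x => ∑ i ∈ insert a s, θ i x) φ G x := by
        funext x; rw [smul_smul, mul_inv C, hsplit]
      rw [e]
      refine (hM.modular_mono hΩ.measurableSet ?_).trans_lt (hmod _ hs)
      rw [abs_of_nonneg (by positivity)]
      exact inv_le_one_of_one_le₀ hC
    have key := ApproxAt.add_piece hM hΩ hΩb hMc hγ hC hA h2lam hbal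
      (isClosed_tsupport _) (hTr a) (ih hs') hmeas
      (hasIntegrableGradient_prodGrad hg (hθ a) (hc a))
      (fun x hx => by rw [hφ0 x hx, smul_zero]) hzero
      (fun x hx => by rw [hnot x hx, zero_smul]) (hH a) (hhol a) (ae_of_all _ (hB' a)) (hsmall a)
      hmoda hmods
    rw [Finset.sum_insert ha, add_comm]
    refine key.congr (ae_of_all _ fun x => ?_) (ae_of_all _ fun x => (hsplit x).symm)
    rw [Finset.sum_insert ha]; module

/-- A smooth partition of unity on `closure Ω` with mollifiers pushing each piece into `Ω`. -/
structure IsTranslationPartition (Ω : Set (EuclideanSpace ℝ (Fin n))) {ι : Type*} [Fintype ι]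
    (θ : ι → EuclideanSpace ℝ (Fin n) → ℝ) (D : ι → ℝ) : Prop where
  contDiff : ∀ i, ContDiff ℝ ∞ (θ i)
  hasCompactSupport : ∀ i, HasCompactSupport (θ i)
  nonneg : ∀ i x, 0 ≤ θ i x
  sum_le_one : ∀ x, ∑ i, θ i x ≤ 1
  sum_eq_one : ∀ x ∈ Ω, ∑ i, θ i x = 1
  translatesInto : ∀ i, TranslatesInto Ω (tsupport (θ i)) (D i)

theorem TranslatesInto.mono {K K' : Set (EuclideanSpace ℝ (Fin n))} {D : ℝ}
    (h : TranslatesInto Ω K D) (hK : K' ⊆ K) : TranslatesInto Ω K' D := by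
  obtain ⟨hD, t₀, ht₀, h⟩ := h
  refine ⟨hD, t₀, ht₀, fun t ht htt => ?_⟩
  obtain ⟨κ, s, h1, h2, h3, h4, h5⟩ := h t ht htt
  exact ⟨κ, s, h1, h2, h3, fun y hy hyK => h4 y hy (hK hyK), h5⟩

theorem IsTranslationPartition.approxAt {ι : Type*} [Fintype ι]
    {θ : ι → EuclideanSpace ℝ (Fin n) → ℝ} {D : ι → ℝ} (hθ : IsTranslationPartition Ω θ D)
    (hM : IsWeakNFunction Ω M) (hΩ : IsOpen Ω) (hΩb : Bornology.IsBounded Ω)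
    (hMc : ContinuousOn (fun p : EuclideanSpace ℝ (Fin n) × ColMatrix n d => M p.1 p.2)
      (Ω ×ˢ univ)) {γ C A b lam B H : ℝ} (hγ : 0 ≤ γ) (hγ1 : γ ≤ 1) (hC : 1 ≤ C) (hA : 0 < A)
    (hb : 0 < b) (hlam : 0 < lam) (hbal : MollifyBound Ω γ M C A b)
    (hg : ∀ i, HasIntegrableGradient (fun x => φ x i) (fun x => G x i))
    (hφ0 : ∀ x, x ∉ Ω → φ x = 0) (hG0 : ∀ x, x ∉ Ω → G x = 0)
    (hB0 : 0 ≤ B) (hB : ∀ x, ‖φ x‖ ≤ B) (hfin : modular Ω M (fun x => lam⁻¹ • G x) < ⊤)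
    (hH : 0 ≤ H) (hhol : ∀ x y, ‖φ x - φ y‖ ≤ H * ‖x - y‖ ^ γ) :
    ApproxAt Ω M (3 * (C * (2 * lam))) (Fintype.card ι * B) φ G := by
  choose H' hH' hhol' using fun i => holder_smul hγ hγ1 hH hhol hB0 hB (hθ.contDiff i)
    (hθ.hasCompactSupport i)
  have hD : ∀ i, 0 ≤ D i := fun i => (hθ.translatesInto i).1
  -- `N + 1` exceeds every ratio between the gradient bound of a piece and the admissible `b`.
  obtain ⟨N, hN⟩ := exists_nat_ge
    (∑ i, (2 * lam)⁻¹ * (d * H' i * 2 ^ γ * D i) / b)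
  have hN1 : (0 : ℝ) < N + 1 := by positivity
  have hNi : ∀ i, (2 * lam)⁻¹ * (d * H' i * 2 ^ γ * D i) / b ≤ N + 1 := by
    intro i
    have := Finset.single_le_sum (f := fun i => (2 * lam)⁻¹ * (d * H' i * 2 ^ γ * D i) / b)
      (fun j _ => by have := hH' j; have := hD j; positivity) (Finset.mem_univ i)
    linarith
  have hθ1 : ∀ i x, |θ i x| ≤ 1 := fun i x => by
    rw [abs_of_nonneg (hθ.nonneg i x)]
    exact (Finset.single_le_sum (f := fun i => θ i x) (fun i _ => hθ.nonneg i x)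
        (Finset.mem_univ i)).trans (hθ.sum_le_one x)
  -- Each cut-off is split into `N + 1` equal copies. Hölder constants and sup bounds are divided by
  -- `N + 1`, so each copy satisfies the smallness condition, while the sum of the sup bounds
  -- remains `Fintype.card ι * B`.
  let ϑ : ι × Fin (N + 1) → EuclideanSpace ℝ (Fin n) → ℝ := fun p x => (N + 1 : ℝ)⁻¹ * θ p.1 x
  have hsum : ∀ x, ∑ p, ϑ p x = ∑ i, θ i x := by
    intro x
    rw [Fintype.sum_prod_type]
    refine Finset.sum_congr rfl fun i _ => ?_
    simp only [ϑ, Finset.sum_const, Finset.card_univ, Fintype.card_fin, nsmul_eq_mul]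
    push_cast
    field_simp
  have hsupp : ∀ p, tsupport (ϑ p) ⊆ tsupport (θ p.1) := fun p =>
    closure_mono (Function.support_subset_iff'.2 fun x hx => by
      simp [ϑ, Function.notMem_support.1 hx])
  have key := approxAt_sum_smul (θ := ϑ) (D := fun p => D p.1)
    (H := fun p => (N + 1 : ℝ)⁻¹ * H' p.1) (B' := fun _ => (N + 1 : ℝ)⁻¹ * B)
    hM hΩ hΩb hMc hγ hC hA hlam hbal hg hφ0 hG0 hB0 hB hfin
    (fun p => contDiff_const.mul (hθ.contDiff p.1))
    (fun p => (hθ.hasCompactSupport p.1).mul_left)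
    (fun p x => mul_nonneg (inv_nonneg.2 hN1.le) (hθ.nonneg p.1 x))
    (fun p => (hθ.translatesInto p.1).mono (hsupp p))
    (fun p => mul_nonneg (inv_nonneg.2 hN1.le) (hH' p.1)) (fun p x y => ?_) (fun p => ?_)
    (fun p x => ?_) Finset.univ (fun x => (hsum x).trans_le (hθ.sum_le_one x))
  · have e : ∑ _p : ι × Fin (N + 1), (N + 1 : ℝ)⁻¹ * B = Fintype.card ι * B := by
      simp only [Finset.sum_const, Finset.card_univ, Fintype.card_prod, Fintype.card_fin,
        nsmul_eq_mul]
      push_cast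
      field_simp
    rw [e] at key
    simp_rw [hsum] at key
    refine key.congr ?_ ?_
    · filter_upwards [ae_restrict_mem hΩ.measurableSet] with x hx
      rw [hθ.sum_eq_one x hx, one_smul]
    · filter_upwards [ae_restrict_mem hΩ.measurableSet] with x hx
      rw [prodGrad_of_eventuallyEq_const (a := 1), one_smul]
      filter_upwards [hΩ.mem_nhds hx] with y hy using hθ.sum_eq_one y hy
  · simp only [ϑ, mul_smul]
    rw [← smul_sub, norm_smul, Real.norm_of_nonneg (inv_nonneg.2 hN1.le), mul_assoc]
    exact mul_le_mul_of_nonneg_left (hhol' p.1 x y) (inv_nonneg.2 hN1.le)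
  · have h1 := hNi p.1
    rw [div_le_iff₀ hb] at h1
    calc _ = (N + 1 : ℝ)⁻¹ * ((2 * lam)⁻¹ * (d * H' p.1 * 2 ^ γ * D p.1)) := by ring
      _ ≤ (N + 1 : ℝ)⁻¹ * ((N + 1) * b) := mul_le_mul_of_nonneg_left h1 (inv_nonneg.2 hN1.le)
      _ = b := by field_simp
  · simp only [ϑ, mul_smul]
    rw [norm_smul, Real.norm_of_nonneg (inv_nonneg.2 hN1.le), norm_smul, Real.norm_eq_abs]
    refine mul_le_mul_of_nonneg_left ?_ (inv_nonneg.2 hN1.le)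
    exact (mul_le_of_le_one_left (norm_nonneg _) (hθ1 p.1 x)).trans (hB x)

-- Compactness of the closure selects finitely many balls. The number of functions obtained depends
-- on the domain only and yields the constant in the theorem.
open scoped Manifold in
theorem IsBoundedLipschitzDomain.exists_isTranslationPartition
    (hΩ : IsBoundedLipschitzDomain Ω) :
    ∃ (s : Finset (EuclideanSpace ℝ (Fin n))) (θ : s → EuclideanSpace ℝ (Fin n) → ℝ) (D : s → ℝ),
      IsTranslationPartition Ω θ D := by
  have hcpt : IsCompact (closure Ω) := hΩ.2.2.1.isCompact_closure
  choose! ρ D hρ hD using fun z (hz : z ∈ closure Ω) => hΩ.exists_translatesInto hz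
  obtain ⟨s, hs, hcov⟩ := hcpt.elim_nhds_subcover (fun z => Metric.ball z (ρ z))
    fun z hz => Metric.ball_mem_nhds z (hρ z hz)
  obtain ⟨f, hf⟩ := SmoothPartitionOfUnity.exists_isSubordinate 𝓘(ℝ, EuclideanSpace ℝ (Fin n))
    isClosed_closure (fun z : s => Metric.ball (z : EuclideanSpace ℝ (Fin n)) (ρ z))
    (fun z => Metric.isOpen_ball) (hcov.trans (by simp [iUnion_subtype]))
  refine ⟨s, fun i => f i, fun i => D i, fun i => (f i).contMDiff.contDiff, fun i => ?_,
    fun i x => f.nonneg i x, fun x => ?_, fun x hx => ?_, fun i => (hD _ (hs _ i.2)).mono (hf i)⟩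
  · exact (ProperSpace.isCompact_closedBall _ _).of_isClosed_subset (isClosed_tsupport _)
      ((hf i).trans Metric.ball_subset_closedBall)
  · rw [← finsum_eq_sum_of_fintype]; exact f.sum_le_one x
  · rw [← finsum_eq_sum_of_fintype]; exact f.sum_eq_one (subset_closure hx)

end ProductGradient

/-! ### From fixed-scale approximation to the conclusion; the Hölder case. -/

section SmoothApproximation

variable {n d : ℕ} {Ω : Set (EuclideanSpace ℝ (Fin n))}
  {M : EuclideanSpace ℝ (Fin n) → ColMatrix n d → ℝ}

theorem HasIntegrableGradient.congr {g g' : EuclideanSpace ℝ (Fin n) → ℝ}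
    {G : EuclideanSpace ℝ (Fin n) → EuclideanSpace ℝ (Fin n)} (h : HasIntegrableGradient g G)
    (hg : g =ᵐ[volume] g') : HasIntegrableGradient g' G := by
  refine ⟨h.integrable.congr hg, h.integrable_gradient, fun η hη hc v => ?_⟩
  rw [← h.integral_eq η hη hc v]
  refine integral_congr_ae ?_
  filter_upwards [hg] with x hx
  rw [hx]

/-- The maps with finite modular after some dilation already form a linear space, by convexity and
evenness, so they exhaust the span. -/
theorem IsWeakNFunction.exists_modular_lt_top (hM : IsWeakNFunction Ω M)
    (hΩ : MeasurableSet Ω) (hΩfin : volume Ω ≠ ⊤)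
    (hMc : ContinuousOn (fun p : EuclideanSpace ℝ (Fin n) × ColMatrix n d => M p.1 p.2)
      (Ω ×ˢ univ)) {G : EuclideanSpace ℝ (Fin n) → ColMatrix n d}
    (hG : G ∈ musielakOrlicz Ω M) :
    AEStronglyMeasurable G (volume.restrict Ω) ∧
      ∃ lam : ℝ, 0 < lam ∧ modular Ω M (fun x => lam⁻¹ • G x) < ⊤ := by
  induction hG using Submodule.span_induction with
  | mem G h => exact ⟨h.1, 1, one_pos, by simpa using h.2⟩
  | zero =>
    exact ⟨aestronglyMeasurable_const, 1, one_pos, hM.modular_lt_top_of_bounded hΩ hΩfin (R := 0)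
      (ae_of_all _ fun x => by simp)⟩
  | add a b _ _ iha ihb =>
    obtain ⟨ha, la, hla, hma⟩ := iha
    obtain ⟨hb, lb, hlb, hmb⟩ := ihb
    set l := max la lb
    have hl : 0 < l := lt_max_of_lt_left hla
    have hmono : ∀ (w : EuclideanSpace ℝ (Fin n) → ColMatrix n d) (s : ℝ), 0 < s → s ≤ l →
        modular Ω M (fun x => s⁻¹ • w x) < ⊤ → modular Ω M (fun x => l⁻¹ • w x) < ⊤ := by
      intro w s hs hsl hw
      have e : (fun x => l⁻¹ • w x) = fun x => (s / l) • s⁻¹ • w x := by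
        funext x
        rw [smul_smul]
        congr 1
        field_simp
      rw [e]
      refine (hM.modular_mono hΩ ?_).trans_lt hw
      rw [abs_of_nonneg (by positivity)]
      exact (div_le_one hl).2 hsl
    refine ⟨ha.add hb, 2 * l, by positivity, ?_⟩
    have e : (fun x => (2 * l)⁻¹ • (a + b) x) =
        fun x => (1 / 2 : ℝ) • (l⁻¹ • a x + l⁻¹ • b x) := by
      funext x
      rw [Pi.add_apply, mul_inv]
      module
    have ha' : AEStronglyMeasurable (fun x => l⁻¹ • a x) (volume.restrict Ω) := ha.const_smul l⁻¹
    rw [e]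
    exact (hM.modular_half_add_le hΩ hMc ha').trans_lt
      (ENNReal.add_lt_top.2 ⟨hmono a la hla (le_max_left _ _) hma,
        hmono b lb hlb (le_max_right _ _) hmb⟩)
  | smul c a _ iha =>
    obtain ⟨ha, la, hla, hma⟩ := iha
    have hc : 0 < |c| + 1 := by positivity
    refine ⟨ha.const_smul c, (|c| + 1) * la, by positivity, ?_⟩
    have e : (fun x => ((|c| + 1) * la)⁻¹ • (c • a) x) =
        fun x => (c / (|c| + 1)) • la⁻¹ • a x := by
      funext x
      rw [Pi.smul_apply, smul_smul, smul_smul]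
      congr 1
      field_simp
    rw [e]
    refine (hM.modular_mono hΩ ?_).trans_lt hma
    rw [abs_div, abs_of_pos hc, div_le_one hc]
    linarith

theorem MemV10LM.exists_hasIntegrableGradient (hM : IsWeakNFunction Ω M) (hΩ : IsOpen Ω)
    (hΩfin : volume Ω ≠ ⊤)
    (hMc : ContinuousOn (fun p : EuclideanSpace ℝ (Fin n) × ColMatrix n d => M p.1 p.2)
      (Ω ×ˢ univ)) {φ : EuclideanSpace ℝ (Fin n) → EuclideanSpace ℝ (Fin d)}
    (hφ : MemV10LM Ω M φ) :
    ∃ G, IsWeakGradient Ω φ G ∧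
      (∀ i, HasIntegrableGradient (fun x => Ω.indicator φ x i) (fun x => Ω.indicator G x i)) ∧
      ∃ lam : ℝ, 0 < lam ∧ modular Ω M (fun x => lam⁻¹ • Ω.indicator G x) < ⊤ := by
  obtain ⟨h1, G', hG', hmem⟩ := hφ
  obtain ⟨G, hG, hHIG⟩ := h1.exists_hasIntegrableGradient hΩ
  obtain ⟨-, lam, hlam, hmod⟩ := hM.exists_modular_lt_top hΩ.measurableSet hΩfin hMc hmem
  refine ⟨G, hG, hHIG, lam, hlam, lt_of_le_of_lt (le_of_eq (lintegral_congr_ae ?_)) hmod⟩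
  filter_upwards [hG.ae_eq hΩ hG', ae_restrict_mem hΩ.measurableSet] with x hx hxΩ
  rw [indicator_of_mem hxΩ, hx]

/-- Since `Λ` is the same for all `ε`, taking `ε = 1 / (k + 1)` produces one sequence converging
modularly at a single scale. -/
theorem smoothlyApproximable_of_forall (hΩ : IsOpen Ω)
    {φ : EuclideanSpace ℝ (Fin n) → EuclideanSpace ℝ (Fin d)}
    {G : EuclideanSpace ℝ (Fin n) → ColMatrix n d} (hG : IsWeakGradient Ω φ G)
    (hφ : AEStronglyMeasurable φ (volume.restrict Ω)) {c Λ : ℝ} (hc : 0 ≤ c) (hΛ : 0 < Λ)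
    (h : ∀ ε : ℝ≥0∞, 0 < ε → ∃ u, IsTestMap Ω u ∧ ∫⁻ x in Ω, ‖u x - φ x‖ₑ ≤ ε ∧
      modular Ω M (fun x => Λ⁻¹ • (gradMap u x - G x)) ≤ ε ∧
      (MemLp φ ⊤ (volume.restrict Ω) →
        ∀ x, ‖u x‖ ≤ c * (eLpNorm φ ⊤ (volume.restrict Ω)).toReal)) :
    SmoothlyApproximable Ω M c φ := by
  choose u hu h1 h2 h3 using fun k : ℕ => h ((k : ℝ≥0∞) + 1)⁻¹ (by simp [ENNReal.inv_pos])
  have hlim : Tendsto (fun k : ℕ => ((k : ℝ≥0∞) + 1)⁻¹) atTop (𝓝 0) := by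
    have := (tendsto_add_atTop_iff_nat 1).2 ENNReal.tendsto_inv_nat_nhds_zero
    simpa using this
  have hL1 : Tendsto (fun k => eLpNorm (fun x => u k x - φ x) 1 (volume.restrict Ω)) atTop
      (𝓝 0) := by
    refine tendsto_of_tendsto_of_tendsto_of_le_of_le tendsto_const_nhds hlim (fun _ => zero_le)
      fun k => ?_
    rw [eLpNorm_one_eq_lintegral_enorm]
    exact h1 k
  refine ⟨u, hu, hL1, tendstoInMeasure_of_tendsto_eLpNorm one_ne_zero
    (fun k => (hu k).1.continuous.aestronglyMeasurable) hφ hL1, fun G' hG' => ⟨Λ, hΛ, ?_⟩,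
    fun hLp k => ?_⟩
  · refine tendsto_of_tendsto_of_tendsto_of_le_of_le tendsto_const_nhds hlim (fun _ => zero_le)
      fun k => (le_of_eq (lintegral_congr_ae ?_)).trans (h2 k)
    filter_upwards [hG.ae_eq hΩ hG'] with x hx
    rw [hx]
  · rw [eLpNorm_exponent_top]
    refine (eLpNormEssSup_le_of_ae_bound (ae_of_all _ (h3 k hLp))).trans (le_of_eq ?_)
    rw [ENNReal.ofReal_mul hc, ENNReal.ofReal_toReal hLp.2.ne]

theorem ae_norm_le_eLpNorm_top {φ : EuclideanSpace ℝ (Fin n) → EuclideanSpace ℝ (Fin d)}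
    (hφ : MemLp φ ⊤ (volume.restrict Ω)) :
    ∀ᵐ x ∂(volume.restrict Ω), ‖φ x‖ ≤ (eLpNorm φ ⊤ (volume.restrict Ω)).toReal := by
  filter_upwards [ae_le_eLpNormEssSup (f := φ) (μ := volume.restrict Ω)] with x hx
  rw [← toReal_enorm]
  exact ENNReal.toReal_mono hφ.2.ne (by rwa [eLpNorm_exponent_top])

theorem continuous_of_holder {φ : EuclideanSpace ℝ (Fin n) → EuclideanSpace ℝ (Fin d)}
    {H γ : ℝ} (hγ : 0 < γ) (h : ∀ x y, ‖φ x - φ y‖ ≤ H * ‖x - y‖ ^ γ) : Continuous φ := by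
  refine continuous_iff_continuousAt.2 fun x => tendsto_iff_norm_sub_tendsto_zero.2 ?_
  refine squeeze_zero (fun _ => norm_nonneg _) (fun y => h y x) ?_
  have : Continuous fun y : EuclideanSpace ℝ (Fin n) => H * ‖y - x‖ ^ γ :=
    continuous_const.mul ((continuous_id.sub continuous_const).norm.rpow_const
      fun _ => Or.inr hγ.le)
  have h2 := this.tendsto x
  simpa [Real.zero_rpow hγ.ne'] using h2

theorem smoothlyApproximable_of_holder (hΩ : IsBoundedLipschitzDomain Ω)
    {ι : Type*} [Fintype ι] {θ : ι → EuclideanSpace ℝ (Fin n) → ℝ} {D : ι → ℝ}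
    (hθ : IsTranslationPartition Ω θ D) (hM : IsWeakNFunction Ω M)
    (hMc : ContinuousOn (fun p : EuclideanSpace ℝ (Fin n) × ColMatrix n d => M p.1 p.2)
      (Ω ×ˢ univ)) {γ : ℝ} (hγ : 0 < γ) (hγ1 : γ ≤ 1) (hbal : BalanceGen Ω γ M)
    {φ : EuclideanSpace ℝ (Fin n) → EuclideanSpace ℝ (Fin d)} (hφ : MemV10LM Ω M φ)
    (hhol : MemHolderClass Ω γ φ) : SmoothlyApproximable Ω M (Fintype.card ι + 1) φ := by
  have hΩo := hΩ.1
  have hΩb := hΩ.2.2.1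
  obtain ⟨G, hG, hg, lam, hlam, hfin⟩ :=
    hφ.exists_hasIntegrableGradient hM hΩo hΩb.measure_lt_top.ne hMc
  obtain ⟨C, A, b, hC, hA, hb, hmb⟩ := hbal.exists_mollifyBound hΩo hγ1
  obtain ⟨K, hK⟩ := hhol
  set ψ := Ω.indicator φ with hψ
  have hψφ : ∀ x ∈ Ω, ψ x = φ x := fun x hx => indicator_of_mem hx _
  have hψ0 : ∀ x, x ∉ Ω → ψ x = 0 := fun x hx => indicator_of_notMem hx _
  have hG0 : ∀ x, x ∉ Ω → Ω.indicator G x = 0 := fun x hx => indicator_of_notMem hx _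
  have hH : ∀ x y, ‖ψ x - ψ y‖ ≤ (d * |K|) * ‖x - y‖ ^ γ := by
    intro x y
    have hi : ∀ i, ‖(ψ x - ψ y) i‖ ≤ |K| * ‖x - y‖ ^ γ := fun i =>
      (hg i).holder_extension hΩ (fun x hx => by rw [hψ0 x hx]; rfl)
        (fun x hx => by rw [hG0 x hx]; rfl) (abs_nonneg K) hγ (fun x hx y hy => by
          rw [hψφ x hx, hψφ y hy]
          refine ((PiLp.norm_apply_le (φ x - φ y) i).trans (hK x hx y hy)).trans ?_
          gcongr
          exact le_abs_self K) x y
    calc _ ≤ ∑ i, ‖(ψ x - ψ y) i‖ := norm_piLp_two_le_sum _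
      _ ≤ ∑ _i : Fin d, |K| * ‖x - y‖ ^ γ := Finset.sum_le_sum fun i _ => hi i
      _ = _ := by
        rw [Finset.sum_const, Finset.card_univ, Fintype.card_fin, nsmul_eq_mul, mul_assoc]
  have hcont := continuous_of_holder hγ hH
  have hbdd : ∃ B, 0 ≤ B ∧ (∀ x, ‖ψ x‖ ≤ B) ∧ (MemLp φ ⊤ (volume.restrict Ω) →
      B = (eLpNorm φ ⊤ (volume.restrict Ω)).toReal) := by
    by_cases hLp : MemLp φ ⊤ (volume.restrict Ω)
    · refine ⟨_, ENNReal.toReal_nonneg, fun x => ?_, fun _ => rfl⟩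
      have hae : ∀ᵐ x, ‖ψ x‖ ≤ (eLpNorm φ ⊤ (volume.restrict Ω)).toReal := by
        filter_upwards [(ae_restrict_iff' hΩo.measurableSet).1 (ae_norm_le_eLpNorm_top hLp)]
          with x hx
        by_cases hxΩ : x ∈ Ω
        · rw [hψφ x hxΩ]; exact hx hxΩ
        · rw [hψ0 x hxΩ, norm_zero]; exact ENNReal.toReal_nonneg
      have hcl := isClosed_le hcont.norm
        (continuous_const (y := (eLpNorm φ ⊤ (volume.restrict Ω)).toReal))
      have := (Measure.dense_of_ae hae).closure_eq
      rw [hcl.closure_eq] at this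
      -- By continuity the essential bound holds everywhere: the set where it holds is closed and of
      -- full measure, hence dense.
      exact (this.symm ▸ mem_univ x : x ∈ {b | ‖ψ b‖ ≤ _})
    · have hsupp : HasCompactSupport ψ :=
        HasCompactSupport.intro hΩb.isCompact_closure fun x hx => hψ0 x fun h =>
          hx (subset_closure h)
      obtain ⟨B, hB⟩ := hcont.bounded_above_of_compact_support hsupp
      exact ⟨B, (norm_nonneg _).trans (hB 0), hB, fun h => absurd h hLp⟩
  obtain ⟨B, hB0, hB, hBeq⟩ := hbdd
  have key := (hθ.approxAt hM hΩo hΩb hMc hγ.le hγ1 hC hA hb hlam hmb hg hψ0 hG0 hB0 hB hfin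
    (by positivity) hH).congr (ψ' := φ) (ξ' := G)
    ((ae_restrict_mem hΩo.measurableSet).mono hψφ)
    ((ae_restrict_mem hΩo.measurableSet).mono fun x hx => indicator_of_mem hx _)
  have hφm : AEStronglyMeasurable φ (volume.restrict Ω) :=
    hcont.aestronglyMeasurable.congr ((ae_restrict_mem hΩo.measurableSet).mono hψφ)
  refine smoothlyApproximable_of_forall hΩo hG hφm (by positivity)
    (Λ := 3 * (C * (2 * lam))) (by positivity) fun ε hε => ?_
  obtain ⟨u, h1, h2, h3, h4⟩ := key ε hε
  refine ⟨u, h1, h2, h3, fun hLp x => (h4 x).trans ?_⟩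
  rw [← hBeq hLp]
  gcongr
  linarith

end SmoothApproximation

/-! ### Smooth truncation and the case `γ = 0`. -/

section Truncation

/-- The smooth truncation `s ↦ a arctan (s / a)`. -/
noncomputable def arctanTrunc (a s : ℝ) : ℝ := a * Real.arctan (s / a)

theorem contDiff_arctanTrunc (a : ℝ) : ContDiff ℝ ∞ (arctanTrunc a) :=
  contDiff_const.mul (Real.contDiff_arctan.comp (contDiff_id.div_const a))

theorem deriv_arctanTrunc {a : ℝ} (ha : a ≠ 0) (s : ℝ) :
    deriv (arctanTrunc a) s = 1 / (1 + (s / a) ^ 2) := by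
  have h := (((hasDerivAt_id s).div_const a).arctan).const_mul a
  refine (h.congr_deriv ?_).deriv
  simp only [id]
  field_simp

theorem arctanTrunc_zero (a : ℝ) : arctanTrunc a 0 = 0 := by simp [arctanTrunc]

theorem abs_arctanTrunc_le {a : ℝ} (ha : 0 < a) (s : ℝ) : |arctanTrunc a s| ≤ a * 2 := by
  rw [arctanTrunc, abs_mul, abs_of_pos ha]
  refine mul_le_mul_of_nonneg_left (abs_le.2 ⟨?_, ?_⟩) ha.le
  · linarith [Real.neg_pi_div_two_lt_arctan (s / a), Real.pi_le_four]
  · linarith [Real.arctan_lt_pi_div_two (s / a), Real.pi_le_four]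

theorem deriv_arctanTrunc_mem {a : ℝ} (ha : a ≠ 0) (s : ℝ) :
    0 ≤ deriv (arctanTrunc a) s ∧ deriv (arctanTrunc a) s ≤ 1 := by
  rw [deriv_arctanTrunc ha]
  refine ⟨by positivity, (div_le_one (by positivity)).2 ?_⟩
  linarith [sq_nonneg (s / a)]

theorem abs_arctanTrunc_le_abs {a : ℝ} (ha : a ≠ 0) (s : ℝ) : |arctanTrunc a s| ≤ |s| := by
  have := convex_univ.norm_image_sub_le_of_norm_deriv_le (f := arctanTrunc a) (C := 1) (x := 0)
    (y := s) (fun x _ => (contDiff_arctanTrunc a).differentiable (by simp) x)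
    (fun x _ => by
      rw [Real.norm_eq_abs, abs_of_nonneg (deriv_arctanTrunc_mem ha x).1]
      exact (deriv_arctanTrunc_mem ha x).2) (mem_univ _) (mem_univ _)
  simpa [arctanTrunc_zero] using this

theorem tendsto_div_natCast_add_one (s : ℝ) :
    Tendsto (fun k : ℕ => s / ((k : ℝ) + 1)) atTop (𝓝 0) := by
  have := (tendsto_one_div_add_atTop_nhds_zero_nat (𝕜 := ℝ)).const_mul s
  simpa [div_eq_mul_inv] using this

theorem tendsto_deriv_arctanTrunc (s : ℝ) :
    Tendsto (fun k : ℕ => deriv (arctanTrunc ((k : ℝ) + 1)) s) atTop (𝓝 1) := by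
  have h0 : ∀ k : ℕ, ((k : ℝ) + 1) ≠ 0 := fun k => by positivity
  simp_rw [fun k => deriv_arctanTrunc (h0 k) s]
  have h1 : Tendsto (fun k : ℕ => 1 + (s / ((k : ℝ) + 1)) ^ 2) atTop (𝓝 1) := by
    simpa using ((tendsto_div_natCast_add_one s).pow 2).const_add 1
  simpa using h1.inv₀ one_ne_zero

theorem tendsto_arctanTrunc (s : ℝ) :
    Tendsto (fun k : ℕ => arctanTrunc ((k : ℝ) + 1) s) atTop (𝓝 s) := by
  rcases eq_or_ne s 0 with rfl | hs
  · simp [arctanTrunc_zero]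
  have h1 : Tendsto (fun t : ℝ => t⁻¹ • (Real.arctan (0 + t) - Real.arctan 0)) (𝓝[≠] 0)
      (𝓝 1) := by
    have := (Real.hasDerivAt_arctan 0).tendsto_slope_zero
    simpa using this
  have h2 : Tendsto (fun k : ℕ => s / ((k : ℝ) + 1)) atTop (𝓝[≠] 0) :=
    tendsto_nhdsWithin_iff.2 ⟨tendsto_div_natCast_add_one s, Eventually.of_forall fun k =>
      div_ne_zero hs (by positivity)⟩
  have h3 := (h1.comp h2).const_mul s
  rw [mul_one] at h3
  refine h3.congr fun k => ?_
  have : ((k : ℝ) + 1) ≠ 0 := by positivity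
  simp only [Function.comp_apply, zero_add, Real.arctan_zero, sub_zero, smul_eq_mul, arctanTrunc]
  field_simp

variable {n d : ℕ} {Ω : Set (EuclideanSpace ℝ (Fin n))}
  {M : EuclideanSpace ℝ (Fin n) → ColMatrix n d → ℝ}

/-- The only use of the splitting over columns. For a general convex integrand, multiplying columns
by different factors of modulus at most `1` may increase the value. -/
theorem ae_le_of_column_smul {Mi : Fin d → EuclideanSpace ℝ (Fin n) → EuclideanSpace ℝ (Fin n) → ℝ}
    (hΩ : MeasurableSet Ω) (hMi : ∀ i, IsWeakNFunction Ω (Mi i))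
    (hsum : ∀ x ∈ Ω, ∀ ξ : ColMatrix n d, M x ξ = ∑ i, Mi i x (ξ i)) :
    ∀ᵐ x ∂(volume.restrict Ω), ∀ (τ : Fin d → ℝ) (w : ColMatrix n d), (∀ i, |τ i| ≤ 1) →
      M x (WithLp.toLp 2 fun i => τ i • w i) ≤ M x w := by
  filter_upwards [ae_restrict_mem hΩ, ae_all_iff.2 fun i => (hMi i).ae_isEvenConvex hΩ]
    with x hx hc τ w hτ
  rw [hsum x hx, hsum x hx]
  exact Finset.sum_le_sum fun i _ => (hc i).smul_le (hτ i) _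

/-- A bounded map is Hölder of exponent `0` with constant `2 * B`; no continuity is needed. -/
theorem IsTranslationPartition.approxAt_of_bounded {ι : Type*} [Fintype ι]
    {θ : ι → EuclideanSpace ℝ (Fin n) → ℝ} {D : ι → ℝ} (hθ : IsTranslationPartition Ω θ D)
    (hM : IsWeakNFunction Ω M) (hΩ : IsOpen Ω) (hΩb : Bornology.IsBounded Ω)
    (hMc : ContinuousOn (fun p : EuclideanSpace ℝ (Fin n) × ColMatrix n d => M p.1 p.2)
      (Ω ×ˢ univ)) {C A b lam B : ℝ} (hC : 1 ≤ C) (hA : 0 < A)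
    (hb : 0 < b) (hlam : 0 < lam) (hbal : MollifyBound Ω 0 M C A b)
    {φ : EuclideanSpace ℝ (Fin n) → EuclideanSpace ℝ (Fin d)}
    {G : EuclideanSpace ℝ (Fin n) → ColMatrix n d}
    (hg : ∀ i, HasIntegrableGradient (fun x => φ x i) (fun x => G x i))
    (hφ0 : ∀ x, x ∉ Ω → φ x = 0) (hG0 : ∀ x, x ∉ Ω → G x = 0)
    (hB : ∀ x, ‖φ x‖ ≤ B) (hfin : modular Ω M (fun x => lam⁻¹ • G x) < ⊤) :
    ApproxAt Ω M (3 * (C * (2 * lam))) (Fintype.card ι * B) φ G := by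
  have hB0 : 0 ≤ B := (norm_nonneg _).trans (hB 0)
  refine hθ.approxAt hM hΩ hΩb hMc le_rfl zero_le_one hC hA hb hlam hbal hg hφ0 hG0 hB0 hB hfin
    (H := 2 * B) (by positivity) fun x y => ?_
  rw [Real.rpow_zero, mul_one]
  exact (norm_sub_le _ _).trans (by linarith [hB x, hB y])

theorem smoothlyApproximable_of_balanceGen_zero (hΩ : IsBoundedLipschitzDomain Ω)
    {ι : Type*} [Fintype ι] {θ : ι → EuclideanSpace ℝ (Fin n) → ℝ} {D : ι → ℝ}
    (hθ : IsTranslationPartition Ω θ D) (hM : IsWeakNFunction Ω M)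
    (hMc : ContinuousOn (fun p : EuclideanSpace ℝ (Fin n) × ColMatrix n d => M p.1 p.2)
      (Ω ×ˢ univ))
    {Mi : Fin d → EuclideanSpace ℝ (Fin n) → EuclideanSpace ℝ (Fin n) → ℝ}
    (hMi : ∀ i, IsWeakNFunction Ω (Mi i))
    (hsum : ∀ x ∈ Ω, ∀ ξ : ColMatrix n d, M x ξ = ∑ i, Mi i x (ξ i)) (hbal : BalanceGen Ω 0 M)
    {φ : EuclideanSpace ℝ (Fin n) → EuclideanSpace ℝ (Fin d)} (hφ : MemV10LM Ω M φ) :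
    SmoothlyApproximable Ω M (Fintype.card ι + 1) φ := by
  have hΩo := hΩ.1
  have hΩm := hΩo.measurableSet
  have hΩb := hΩ.2.2.1
  obtain ⟨G, hG, hg, lam, hlam, hfin⟩ :=
    hφ.exists_hasIntegrableGradient hM hΩo hΩb.measure_lt_top.ne hMc
  obtain ⟨C, A, b, hC, hA, hb, hmb⟩ := hbal.exists_mollifyBound hΩo zero_le_one
  set ψ := Ω.indicator φ with hψ
  set ξ := Ω.indicator G with hξ
  have hψφ : ∀ x ∈ Ω, ψ x = φ x := fun x hx => indicator_of_mem hx _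
  have hψ0 : ∀ x, x ∉ Ω → ψ x = 0 := fun x hx => indicator_of_notMem hx _
  have hξ0 : ∀ x, x ∉ Ω → ξ x = 0 := fun x hx => indicator_of_notMem hx _
  have hψi : Integrable ψ := integrable_piLp_iff.2 fun i => (hg i).integrable
  have hξi : Integrable ξ := integrable_piLp_iff.2 fun i => (hg i).integrable_gradient
  have aeψ : ∀ᵐ x ∂(volume.restrict Ω), ψ x = φ x := (ae_restrict_mem hΩm).mono hψφ
  have aeξ : ∀ᵐ x ∂(volume.restrict Ω), ξ x = G x :=
    (ae_restrict_mem hΩm).mono fun x hx => indicator_of_mem hx _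
  have hφm : AEStronglyMeasurable φ (volume.restrict Ω) := hψi.1.restrict.congr aeψ
  by_cases hLp : MemLp φ ⊤ (volume.restrict Ω)
  · set B := (eLpNorm φ ⊤ (volume.restrict Ω)).toReal with hBdef
    have hB0 : 0 ≤ B := ENNReal.toReal_nonneg
    -- Redefinition on a null set turns the essential bound into a bound at every point. No
    -- truncation is made for bounded maps, so the sup bound keeps its constant.
    let ψ' : EuclideanSpace ℝ (Fin n) → EuclideanSpace ℝ (Fin d) :=
      {x | ‖ψ x‖ ≤ B}.indicator ψ
    have hae : ∀ᵐ x, ψ x = ψ' x := by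
      filter_upwards [(ae_restrict_iff' hΩm).1 (ae_norm_le_eLpNorm_top hLp)] with x hx
      refine (indicator_of_mem ?_ ψ).symm
      by_cases hxΩ : x ∈ Ω
      · change ‖ψ x‖ ≤ B
        rw [hψφ x hxΩ]; exact hx hxΩ
      · change ‖ψ x‖ ≤ B
        rw [hψ0 x hxΩ, norm_zero]; exact hB0
    have key := (hθ.approxAt_of_bounded hM hΩo hΩb hMc hC hA hb hlam hmb (φ := ψ') (G := ξ)
      (B := B) (fun i => (hg i).congr (hae.mono fun x hx => congrArg (fun w => w i) hx))
      (fun x hx => by simp [ψ', indicator_apply, hψ0 x hx]) hξ0 (fun x => by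
        by_cases hx : ‖ψ x‖ ≤ B
        · simp [ψ', hx]
        · simpa [ψ', indicator_apply, hx] using hB0) hfin).congr (ψ' := φ) (ξ' := G)
      (by filter_upwards [aeψ, ae_restrict_of_ae hae] with x h1 h2; rw [← h2, h1]) aeξ
    refine smoothlyApproximable_of_forall hΩo hG hφm (by positivity)
      (Λ := 3 * (C * (2 * lam))) (by positivity) fun ε hε => ?_
    obtain ⟨u, h1, h2, h3, h4⟩ := key ε hε
    refine ⟨u, h1, h2, h3, fun _ x => (h4 x).trans ?_⟩
    gcongr
    linarith
  · let ψk : ℕ → EuclideanSpace ℝ (Fin n) → EuclideanSpace ℝ (Fin d) := fun k x =>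
      WithLp.toLp 2 fun i => arctanTrunc ((k : ℝ) + 1) (ψ x i)
    let τ : ℕ → EuclideanSpace ℝ (Fin n) → Fin d → ℝ := fun k x i =>
      deriv (arctanTrunc ((k : ℝ) + 1)) (ψ x i)
    let ξk : ℕ → EuclideanSpace ℝ (Fin n) → ColMatrix n d := fun k x =>
      WithLp.toLp 2 fun i => τ k x i • ξ x i
    have hk0 : ∀ k : ℕ, (0 : ℝ) < (k : ℝ) + 1 := fun k => by positivity
    have hτ0 : ∀ k x i, 0 ≤ τ k x i := fun k x i => (deriv_arctanTrunc_mem (hk0 k).ne' _).1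
    have hτ1 : ∀ k x i, τ k x i ≤ 1 := fun k x i => (deriv_arctanTrunc_mem (hk0 k).ne' _).2
    have hgk : ∀ k i, HasIntegrableGradient (fun x => ψk k x i) (fun x => ξk k x i) := fun k i =>
      (hg i).comp (contDiff_arctanTrunc _) (arctanTrunc_zero _) (C := 1) fun s => by
        rw [abs_of_nonneg (deriv_arctanTrunc_mem (hk0 k).ne' s).1]
        exact (deriv_arctanTrunc_mem (hk0 k).ne' s).2
    have hψki : ∀ k, Integrable (ψk k) := fun k =>
      integrable_piLp_iff.2 fun i => (hgk k i).integrable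
    have hξki : ∀ k, Integrable (ξk k) := fun k =>
      integrable_piLp_iff.2 fun i => (hgk k i).integrable_gradient
    have hcol := ae_le_of_column_smul hΩm hMi hsum
    have hle1 : ∀ k, ∀ᵐ x ∂(volume.restrict Ω), M x (lam⁻¹ • ξk k x) ≤ M x (lam⁻¹ • ξ x) := by
      intro k
      filter_upwards [hcol] with x hx
      refine le_trans (le_of_eq ?_) (hx (τ k x) (lam⁻¹ • ξ x) fun i => abs_le.2
        ⟨by linarith [hτ0 k x i], hτ1 k x i⟩)
      congr 1
      ext i : 1
      exact smul_comm lam⁻¹ (τ k x i) (ξ x i)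
    -- The columns of the truncation error are multiplied by `τ - 1 ∈ [-1, 0]`, so the error is
    -- dominated by the integrand of the gradient itself at scale `lam`.
    have hle2 : ∀ k, ∀ᵐ x ∂(volume.restrict Ω),
        M x (lam⁻¹ • (ξk k x - ξ x)) ≤ M x (lam⁻¹ • ξ x) := by
      intro k
      filter_upwards [hcol] with x hx
      refine le_trans (le_of_eq ?_) (hx (fun i => τ k x i - 1) (lam⁻¹ • ξ x) fun i => abs_le.2
        ⟨by linarith [hτ0 k x i], by linarith [hτ1 k x i]⟩)
      congr 1
      ext i : 1
      change lam⁻¹ • (τ k x i • ξ x i - ξ x i) = (τ k x i - 1) • lam⁻¹ • ξ x i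
      module
    have hψlim : Tendsto (fun k => ∫⁻ x in Ω, ‖ψk k x - ψ x‖ₑ) atTop (𝓝 0) := by
      have hbd : ∀ k x, ‖ψk k x - ψ x‖ ≤ 2 * ∑ i, ‖ψ x i‖ := by
        intro k x
        refine (norm_piLp_two_le_sum _).trans ?_
        rw [Finset.mul_sum]
        refine Finset.sum_le_sum fun i _ => ?_
        have h1 : |arctanTrunc ((k : ℝ) + 1) (ψ x i)| ≤ |ψ x i| :=
          abs_arctanTrunc_le_abs (hk0 k).ne' _
        have h2 : ‖(ψk k x - ψ x) i‖ ≤ |arctanTrunc ((k : ℝ) + 1) (ψ x i)| + |ψ x i| :=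
          abs_sub _ _
        rw [Real.norm_eq_abs (ψ x i)]
        linarith
      have hdom : Integrable (fun x => 2 * ∑ i, ‖ψ x i‖) (volume.restrict Ω) :=
        ((integrable_finsetSum _ fun i _ => (hg i).integrable.norm).const_mul 2).restrict
      have hlim : ∀ x, Tendsto (fun k => ψk k x) atTop (𝓝 (ψ x)) := fun x =>
        ((PiLp.continuous_toLp 2 _).tendsto _).comp
          (tendsto_pi_nhds.2 fun i => tendsto_arctanTrunc (ψ x i))
      have hmeas : ∀ k, AEStronglyMeasurable (fun x => ψk k x - ψ x) (volume.restrict Ω) :=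
        fun k => ((hψki k).sub hψi).1.restrict
      have := tendsto_lintegral_of_dominated_convergence' (μ := volume.restrict Ω)
        (F := fun k x => ‖ψk k x - ψ x‖ₑ) (f := fun _ => 0)
        (fun x => ENNReal.ofReal (2 * ∑ i, ‖ψ x i‖)) (fun k => (hmeas k).enorm)
        (fun k => ae_of_all _ fun x => by
          exact (ofReal_norm _).symm.trans_le (ENNReal.ofReal_le_ofReal (hbd k x)))
        ((hasFiniteIntegral_iff_ofReal (ae_of_all _ fun x => by positivity)).1 hdom.2).ne
        (ae_of_all _ fun x => by
          simpa using ((hlim x).sub_const (ψ x)).enorm)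
      simpa using this
    have hξlim : Tendsto (fun k => modular Ω M (fun x => lam⁻¹ • (ξk k x - ξ x))) atTop
        (𝓝 0) := by
      have hmeas : ∀ k, AEStronglyMeasurable (fun x => lam⁻¹ • (ξk k x - ξ x))
          (volume.restrict Ω) := fun k => (((hξki k).sub hξi).1.restrict).const_smul lam⁻¹
      have hlim : ∀ x, Tendsto (fun k => lam⁻¹ • (ξk k x - ξ x)) atTop (𝓝 0) := fun x => by
        have h1 : Tendsto (fun k => ξk k x) atTop (𝓝 (ξ x)) :=
          ((PiLp.continuous_toLp 2 _).tendsto _).comp (tendsto_pi_nhds.2 fun i => by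
            have := (tendsto_deriv_arctanTrunc (ψ x i)).smul_const (ξ x i)
            rwa [one_smul] at this)
        simpa using (h1.sub_const (ξ x)).const_smul lam⁻¹
      have := tendsto_lintegral_of_dominated_convergence' (μ := volume.restrict Ω)
        (F := fun k x => ENNReal.ofReal (M x (lam⁻¹ • (ξk k x - ξ x)))) (f := fun _ => 0)
        (fun x => ENNReal.ofReal (M x (lam⁻¹ • ξ x)))
        (fun k => (aemeasurable_comp_of_continuousOn hΩm hMc (hmeas k)).ennreal_ofReal)
        (fun k => (hle2 k).mono fun x hx => ENNReal.ofReal_le_ofReal hx) hfin.ne (by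
          filter_upwards [hM.ae_isEvenConvex hΩm] with x hx
          have h2 := (ENNReal.continuous_ofReal.comp hx.continuous).tendsto 0 |>.comp (hlim x)
          simpa [Function.comp_def, hx.zero] using h2)
      simpa [modular] using this
    -- Truncation and mollification errors are combined by convexity, which doubles the scale once.
    -- The scale for the truncated maps does not depend on `k`, since their gradients have finite
    -- modular at the same `lam`.
    refine smoothlyApproximable_of_forall hΩo hG hφm (by positivity)
      (Λ := 2 * (3 * (C * (2 * lam)))) (by positivity) fun ε hε => ?_
    have hε2 : 0 < ε / 2 := ENNReal.half_pos hε.ne'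
    obtain ⟨k, hk1, hk2⟩ := ((hψlim.eventually_lt_const hε2).and
      (hξlim.eventually_lt_const hε2)).exists
    have hfink : modular Ω M (fun x => lam⁻¹ • ξk k x) < ⊤ :=
      (lintegral_mono_ae ((hle1 k).mono fun x hx => ENNReal.ofReal_le_ofReal hx)).trans_lt hfin
    obtain ⟨u, h1, h2, h3, -⟩ := hθ.approxAt_of_bounded hM hΩo hΩb hMc hC hA hb hlam hmb (hgk k)
      (fun x hx => by
        ext i
        simp [ψk, hψ0 x hx, arctanTrunc_zero])
      (fun x hx => by
        ext i : 1
        simp [ξk, hξ0 x hx])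
      (B := d * (((k : ℝ) + 1) * 2)) (fun x => by
        refine (norm_piLp_two_le_sum _).trans ?_
        calc _ ≤ ∑ _i : Fin d, ((k : ℝ) + 1) * 2 :=
              Finset.sum_le_sum fun i _ => abs_arctanTrunc_le (hk0 k) _
          _ = _ := by rw [Finset.sum_const, Finset.card_univ, Fintype.card_fin, nsmul_eq_mul])
      hfink (ε / 2) hε2
    set Λ := 3 * (C * (2 * lam)) with hΛ
    have hΛ0 : 0 < Λ := by positivity
    refine ⟨u, h1, ?_, ?_, fun h => absurd h hLp⟩
    · have hmeas : AEMeasurable (fun x => ‖u x - ψk k x‖ₑ) (volume.restrict Ω) :=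
        (h1.1.continuous.aestronglyMeasurable.sub (hψki k).1.restrict).enorm
      calc ∫⁻ x in Ω, ‖u x - φ x‖ₑ
          ≤ ∫⁻ x in Ω, (‖u x - ψk k x‖ₑ + ‖ψk k x - ψ x‖ₑ) := by
            refine lintegral_mono_ae ?_
            filter_upwards [aeψ] with x hx
            rw [← hx, ← sub_add_sub_cancel (u x) (ψk k x) (ψ x)]
            exact enorm_add_le _ _
        _ ≤ ε / 2 + ε / 2 := by
            rw [lintegral_add_left' hmeas]
            exact add_le_add h2 hk1.le
        _ = ε := ENNReal.add_halves ε
    · have hmeas : AEStronglyMeasurable (fun x => Λ⁻¹ • (gradMap u x - ξk k x))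
          (volume.restrict Ω) :=
        ((continuous_gradMap h1.1).aestronglyMeasurable.sub (hξki k).1.restrict).const_smul Λ⁻¹
      have hmono : modular Ω M (fun x => Λ⁻¹ • (ξk k x - ξ x)) ≤ ε / 2 := by
        have e : (fun x => Λ⁻¹ • (ξk k x - ξ x)) =
            fun x => (lam / Λ) • lam⁻¹ • (ξk k x - ξ x) := by
          funext x
          rw [smul_smul]
          congr 1
          field_simp
        rw [e]
        refine (hM.modular_mono hΩm ?_).trans hk2.le
        rw [abs_of_nonneg (by positivity), div_le_one hΛ0, hΛ]
        nlinarith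
      calc modular Ω M (fun x => (2 * Λ)⁻¹ • (gradMap u x - G x))
          = modular Ω M (fun x => (1 / 2 : ℝ) •
              (Λ⁻¹ • (gradMap u x - ξk k x) + Λ⁻¹ • (ξk k x - ξ x))) := by
            refine lintegral_congr_ae ?_
            filter_upwards [aeξ] with x hx
            rw [← smul_add, sub_add_sub_cancel, hx, smul_smul, mul_inv, one_div]
        _ ≤ ε / 2 + ε / 2 :=
            (hM.modular_half_add_le hΩm hMc hmeas).trans (add_le_add h3 hmono)
        _ = ε := ENNReal.add_halves ε

end Truncation

/-! ### The density theorem. -/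

theorem mainTheorem6 (n : ℕ) (hn : 1 ≤ n) (Ω : Set (EuclideanSpace ℝ (Fin n)))
    (hΩ : IsBoundedLipschitzDomain Ω) :
    ∃ c : ℝ, 0 < c ∧
      ∀ (d : ℕ), 1 ≤ d →
      ∀ M : EuclideanSpace ℝ (Fin n) → ColMatrix n d → ℝ,
        IsWeakNFunction Ω M →
        ContinuousOn (fun p : EuclideanSpace ℝ (Fin n) × ColMatrix n d => M p.1 p.2)
          (Ω ×ˢ Set.univ) →
        (∃ Mi : Fin d → EuclideanSpace ℝ (Fin n) → EuclideanSpace ℝ (Fin n) → ℝ,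
          (∀ i, IsWeakNFunction Ω (Mi i)) ∧
          ∀ x ∈ Ω, ∀ ξ : ColMatrix n d, M x ξ = ∑ i, Mi i x (ξ i)) →
        (BalanceGen Ω 0 M →
          ∀ φ : EuclideanSpace ℝ (Fin n) → EuclideanSpace ℝ (Fin d),
            MemV10LM Ω M φ → SmoothlyApproximable Ω M c φ) ∧
        (∀ γ : ℝ, 0 < γ → γ ≤ 1 → BalanceGen Ω γ M →
          ∀ φ : EuclideanSpace ℝ (Fin n) → EuclideanSpace ℝ (Fin d),
            MemV10LM Ω M φ → MemHolderClass Ω γ φ → SmoothlyApproximable Ω M c φ) := by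
  obtain ⟨s, θ, D, hθ⟩ := hΩ.exists_isTranslationPartition
  -- The number of partition functions, chosen before `d`, `M` and `φ`; the `+ 1` makes positivity
  -- immediate.
  refine ⟨Fintype.card s + 1, by positivity, fun d _ M hM hMc ⟨Mi, hMi, hsum⟩ => ⟨?_, ?_⟩⟩
  · exact fun hbal φ hφ =>
      smoothlyApproximable_of_balanceGen_zero hΩ hθ hM hMc hMi hsum hbal hφ
  · exact fun γ hγ hγ1 hbal φ hφ hhol =>
      smoothlyApproximable_of_holder hΩ hθ hM hMc hγ hγ1 hbal hφ hhol
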